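/- Let $0<r<n$. Let $\mathbb C_{2n}$ be the complex Clifford algebra with generators $e_1,\dots,e_{2n}$, $e_\alpha e_\beta+e_\beta e_\alpha=-2\delta_{\alpha\beta}$, with Witt basis $f_j=\frac12(e_j-i\,e_{n+j})$, $f_j^\dagger=-\frac12(e_j+i\,e_{n+j})$ $(1\le j\le n)$ and idempotent $I=\prod_{j=1}^n f_jf_j^\dagger$. Let $(\Lambda_n^\dagger)^{(r)}I$ be the span of all $f_{k_1}^\dagger\cdots f_{k_r}^\dagger I$ with distinct $k_1,\dots,k_r\in\{1,\dots,n\}$, and $(\Lambda_{n-1}^\dagger)^{(r)}I$ the span of those with all $k_i\le n-1$. Identify $\mathbb R^{2n}$ with $\mathbb C^n$ by $z_j=x_j+iy_j$, $z_j^c=x_j-iy_j$, and $\mathbb R^{2n-2}=\mathbb C^{n-1}$ with $\{z_n=0\}$. Put $\partial_z=\sum_{j=1}^n f_j^\dagger\partial_{z_j}$, $\partial_z^\dagger=\sum_{j=1}^n f_j\partial_{z_j^c}$, and let $\tilde\partial_z,\tilde\partial_z^\dagger$ be the same sums over $j\le n-1$. A $C^1$ function $G$ on an open set is Hermitean monogenic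 if $\partial_zG=0=\partial_z^\dagger G$ there. Let $\tilde F$ be real-analytic at the origin of $\mathbb R^{2n-2}$ with values, near the origin, in $(\Lambda_n^\dagger)^{(r)}I$, and decompose it there as $\tilde F=\tilde F^0+f_n^\dagger\tilde F^1$, where $\tilde F^0$ takes values in $(\Lambda_{n-1}^\dagger)^{(r)}I$ and $\tilde F^1$ in $(\Lambda_{n-1}^\dagger)^{(r-1)}I$. (A) If $\tilde F$ has a Hermitean monogenic extension to a neighbourhood of the origin in $\mathbb R^{2n}$, then near the origin $$\tilde\partial_z\tilde F^0=0,\qquad \tilde\partial_z^\dagger\tilde F^1=0.\qquad(*)$$ (B) Conversely, assume $(*)$ near the origin. Then near the origin $\tilde F^0$ and $\tilde F^1$ are sums of convergent multiple power series $\tilde F^\epsilon=\sum_{\alpha,\beta}z^\alpha(z^c)^\beta C^\epsilon_{\alpha,\beta}$ $(\epsilon=0,1)$ in $z_1,\dots,z_{n-1},z_1^c,\dots,z_{n-1}^c$. For any such expansions, $C^0_{\alpha,\beta}\in(\Lambda_{n-1}^\dagger)^{(r)}I$ and $C^1_{\alpha,\beta}\in(\Lambda_{n-1}^\dagger)^{(r-1)}I$,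 and the components $p^\epsilon_{a,b}=\sum_{|\alpha|=a,|\beta|=b}z^\alpha(z^c)^\beta C^\epsilon_{\alpha,\beta}$ have the following properties. 1. For all $a,b\ge 0$: $\tilde\partial_zp^0_{a,b}=0$ and $\tilde\partial_z^\dagger p^1_{a,b}=0$. 2. For all $a,b\ge0$ there is exactly one Hermitean monogenic polynomial $M=CK[p^0_{a,b}]$ on $\mathbb C^n$ of bidegree $(a,b)$ with values in $(\Lambda_n^\dagger)^{(r)}I$ such that, on $\{z_n=0\}$, $M=p^0_{a,b}$, $\partial_{z_n^c}M=-f_n^\dagger\tilde\partial_z^\dagger p^0_{a,b}$, $\partial_{z_n^c}^jM=0$ for $2\le j\le b$ and $\partial_{z_n}^iM=0$ for $1\le i\le a$. Likewise there is exactly one such $M=CK[f_n^\dagger p^1_{a,b}]$ such that, on $\{z_n=0\}$, $M=f_n^\dagger p^1_{a,b}$, $\partial_{z_n^c}^jM=0$ for $1\le j\le b$, $\partial_{z_n}M=\tilde\partial_zp^1_{a,b}$ and $\partial_{z_n}^iM=0$ for $2\le i\le a$. With $$T_k[p]=\frac{1}{\lfloor k/2\rfloor!\,\lfloor (k+1)/2\rfloor!}\bigl(z_n\tilde\partial_zf_n+z_n^c\tilde\partial_z^\dagger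 f_n^\dagger\bigr)^k[p],$$ they are given by $$CK[p^0_{a,b}]=\sum_{k=0}^{\min(2a+1,2b)}T_k[p^0_{a,b}],\qquad CK[f_n^\dagger p^1_{a,b}]=\sum_{k=0}^{\min(2a,2b+1)}T_k[f_n^\dagger p^1_{a,b}].$$ 3. There are an open neighbourhood $\Omega$ of the origin in $\mathbb R^{2n}$ and a Hermitean monogenic function $G$ on $\Omega$ with values in $(\Lambda_n^\dagger)^{(r)}I$ such that $G=\tilde F$ on $\Omega\cap\{z_n=0\}$ and, with unconditional convergence at every point of $\Omega$, $$G=\sum_{a,b\ge0}\bigl(CK[p^0_{a,b}]+CK[f_n^\dagger p^1_{a,b}]\bigr)=\sum_{a,b,k\ge0}T_k\bigl[p^0_{a,b}+f_n^\dagger p^1_{a,b}\bigr].$$ -/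

import Mathlib

open Filter Topology

namespace HermClifford

noncomputable section

/-- The complex quadratic form `v ↦ - ∑ v_a ^ 2` on `ℂ^(2n)`. -/
def form (n : ℕ) : QuadraticForm ℂ (Fin (n + n) → ℂ) :=
  QuadraticMap.weightedSumSquares ℂ (fun _ : Fin (n + n) => (-1 : ℂ))

/-- The complex Clifford algebra `ℂ_{2n}`, with generators satisfying
`e_a e_b + e_b e_a = -2 δ_{ab}`. -/
abbrev Cl (n : ℕ) : Type := CliffordAlgebra (form n)

/-- The coordinates `λ_A` of a Clifford number `λ = ∑_A λ_A e_A`, where `e_A` is the product, in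
increasing order, of the generators indexed by `A` (the canonical linear isomorphism with the
exterior algebra takes `e_A` to the corresponding wedge product). -/
def coords (n : ℕ) : Cl n →ₗ[ℂ] EuclideanSpace ℂ (Finset (Fin (n + n))) :=
  (WithLp.linearEquiv 2 ℂ (Finset (Fin (n + n)) → ℂ)).symm.toLinearMap ∘ₗ
    ((Pi.basisFun ℂ (Fin (n + n))).ExteriorAlgebra.equivFun.toLinearMap ∘ₗ
      (CliffordAlgebra.equivExterior (form n)).toLinearMap)

theorem coords_injective (n : ℕ) : Function.Injective (coords n) := by
  intro x y h
  apply (CliffordAlgebra.equivExterior (form n)).injective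
  apply (Pi.basisFun ℂ (Fin (n + n))).ExteriorAlgebra.equivFun.injective
  exact (WithLp.linearEquiv 2 ℂ (Finset (Fin (n + n)) → ℂ)).symm.injective h

/-- The norm `|λ| = (∑_A |λ_A|^2)^(1/2)` on `ℂ_{2n}`. -/
instance instNormedAddCommGroup (n : ℕ) : NormedAddCommGroup (Cl n) :=
  NormedAddCommGroup.induced (Cl n) (EuclideanSpace ℂ (Finset (Fin (n + n)))) (coords n)
    (coords_injective n)

instance instNormedSpace (n : ℕ) : NormedSpace ℂ (Cl n) :=
  NormedSpace.induced ℂ (Cl n) (EuclideanSpace ℂ (Finset (Fin (n + n)))) (coords n)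

/-- The generators `e_1, …, e_{2n}`. -/
def gen {n : ℕ} (a : Fin (n + n)) : Cl n := CliffordAlgebra.ι (form n) (Pi.single a 1)

/-- The Witt basis element `f_j = (e_j - i e_{n+j}) / 2`. -/
def f {n : ℕ} (j : Fin n) : Cl n :=
  (1 / 2 : ℂ) • (gen (Fin.castAdd n j) - Complex.I • gen (Fin.natAdd n j))

/-- The Witt basis element `f_j^† = - (e_j + i e_{n+j}) / 2`. -/
def fd {n : ℕ} (j : Fin n) : Cl n :=
  (-(1 / 2) : ℂ) • (gen (Fin.castAdd n j) + Complex.I • gen (Fin.natAdd n j))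

/-- The primitive idempotent `I = I_1 ⋯ I_n`, `I_j = f_j f_j^†`. -/
def idem (n : ℕ) : Cl n := (List.ofFn fun j : Fin n => f j * fd j).prod

/-- The span of `f_{k_1}^† ⋯ f_{k_r}^† I` with distinct `k_1, …, k_r` in `s`. -/
def bladeSpace {n : ℕ} (s : Set (Fin n)) (r : ℕ) : Submodule ℂ (Cl n) :=
  Submodule.span ℂ {x | ∃ l : List (Fin n), l.Nodup ∧ l.length = r ∧ (∀ k ∈ l, k ∈ s) ∧
    x = (l.map fd).prod * idem n}

/-- The homogeneous part `(Λ_n^†)^{(r)} I` of spinor space. -/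
def spinorPart (n r : ℕ) : Submodule ℂ (Cl n) := bladeSpace Set.univ r

/-- `(Λ_{n-1}^†)^{(r)}(f_1^†, …, f_{n-1}^†) I` inside `ℂ_{2n}`, where `n = m + 1`. -/
def tildeSpinorPart (m r : ℕ) : Submodule ℂ (Cl (m + 1)) :=
  bladeSpace {k | k ≠ Fin.last m} r

section Calculus

variable {k : ℕ} {E : Type*} [NormedAddCommGroup E] [NormedSpace ℂ E]

/-- `∂_{z_j} = (∂_{x_j} - i ∂_{y_j}) / 2` for functions on `ℂ^k ≃ ℝ^(2k)`. -/
def dz (j : Fin k) (G : (Fin k → ℂ) → E) : (Fin k → ℂ) → E := fun z =>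
  (1 / 2 : ℂ) • (fderiv ℝ G z (Pi.single j 1) - Complex.I • fderiv ℝ G z (Pi.single j Complex.I))

/-- `∂_{z_j^c} = (∂_{x_j} + i ∂_{y_j}) / 2`. -/
def dzc (j : Fin k) (G : (Fin k → ℂ) → E) : (Fin k → ℂ) → E := fun z =>
  (1 / 2 : ℂ) • (fderiv ℝ G z (Pi.single j 1) + Complex.I • fderiv ℝ G z (Pi.single j Complex.I))

/-- The monomial `∏_j z_j^{α_j} (z_j^c)^{β_j}`. -/
def zMonomial (α β : Fin k → ℕ) (z : Fin k → ℂ) : ℂ :=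
  ∏ j, z j ^ α j * (starRingEnd ℂ (z j)) ^ β j

/-- The part of bidegree `(a, b)` of the series `∑ z^α (z^c)^β C_{α,β}`. -/
def bihomPart (C : (Fin k → ℕ) → (Fin k → ℕ) → E) (a b : ℕ) : (Fin k → ℂ) → E := fun z =>
  ∑ α ∈ Finset.Nat.antidiagonalTuple k a, ∑ β ∈ Finset.Nat.antidiagonalTuple k b,
    zMonomial α β z • C α β

/-- Near the origin, `G` is the sum of the convergent multiple power series
`∑_{α,β} z^α (z^c)^β C_{α,β}`. -/
def HasZSeries (G : (Fin k → ℂ) → E) (C : (Fin k → ℕ) → (Fin k → ℕ) → E) : Prop :=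
  ∀ᶠ z in 𝓝 (0 : Fin k → ℂ),
    HasSum (fun γ : (Fin k → ℕ) × (Fin k → ℕ) => zMonomial γ.1 γ.2 z • C γ.1 γ.2) (G z)

end Calculus

/-- The Hermitean Dirac operator `∂_z = ∑_j f_j^† ∂_{z_j}`. -/
def diracZ {n : ℕ} (G : (Fin n → ℂ) → Cl n) : (Fin n → ℂ) → Cl n := fun z =>
  ∑ j, fd j * dz j G z

/-- The Hermitean Dirac operator `∂_z^† = ∑_j f_j ∂_{z_j^c}`. -/
def diracZd {n : ℕ} (G : (Fin n → ℂ) → Cl n) : (Fin n → ℂ) → Cl n := fun z =>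
  ∑ j, f j * dzc j G z

/-- Continuously differentiable null solutions of both Hermitean Dirac operators. -/
def HermiteanMonogenicOn {n : ℕ} (G : (Fin n → ℂ) → Cl n) (Ω : Set (Fin n → ℂ)) : Prop :=
  IsOpen Ω ∧ ContDiffOn ℝ 1 G Ω ∧ ∀ z ∈ Ω, diracZ G z = 0 ∧ diracZd G z = 0

variable {m : ℕ}

/-- `∂̃_z = ∑_{j<n} f_j^† ∂_{z_j}`, acting on functions on `ℂ^{n-1}`, `n = m + 1`. -/
def tildeDiracZ (G : (Fin m → ℂ) → Cl (m + 1)) : (Fin m → ℂ) → Cl (m + 1) := fun z =>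
  ∑ j : Fin m, fd j.castSucc * dz j G z

/-- `∂̃_z^† = ∑_{j<n} f_j ∂_{z_j^c}`, acting on functions on `ℂ^{n-1}`, `n = m + 1`. -/
def tildeDiracZd (G : (Fin m → ℂ) → Cl (m + 1)) : (Fin m → ℂ) → Cl (m + 1) := fun z =>
  ∑ j : Fin m, f j.castSucc * dzc j G z

/-- The inclusion of `ℂ^{n-1}` in `ℂ^n` as the hyperplane `z_n = 0`, `n = m + 1`. -/
def incl (z : Fin m → ℂ) : Fin (m + 1) → ℂ := Fin.snoc (α := fun _ => ℂ) z 0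

/-- The operator `w ∂̃_z f_n + w^c ∂̃_z^† f_n^†` on functions on `ℂ^{n-1}`; the variable `z_n`
occurs in it as the parameter `w`. -/
def ckOp (w : ℂ) (G : (Fin m → ℂ) → Cl (m + 1)) : (Fin m → ℂ) → Cl (m + 1) := fun z =>
  w • tildeDiracZ (fun u => f (Fin.last m) * G u) z +
    (starRingEnd ℂ w) • tildeDiracZd (fun u => fd (Fin.last m) * G u) z

/-- The `k`-th term
`1 / (⌊k/2⌋! ⌊(k+1)/2⌋!) (z_n ∂̃_z f_n + z_n^c ∂̃_z^† f_n^†)^k [p]` of the extension series. -/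
def ckTerm (k : ℕ) (p : (Fin m → ℂ) → Cl (m + 1)) : (Fin (m + 1) → ℂ) → Cl (m + 1) := fun z =>
  (((k / 2).factorial * ((k + 1) / 2).factorial : ℕ) : ℂ)⁻¹ •
    (ckOp (z (Fin.last m)))^[k] p (Fin.init z)

/-- `CK[p]` for `p` of bidegree `(a, b)` with values in `(Λ_{n-1}^†)^{(r)} I`. -/
def ckExt0 (a b : ℕ) (p : (Fin m → ℂ) → Cl (m + 1)) : (Fin (m + 1) → ℂ) → Cl (m + 1) := fun z =>
  ∑ k ∈ Finset.range (min (2 * a + 1) (2 * b) + 1), ckTerm k p z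

/-- `CK[f_n^† p]` for `p` of bidegree `(a, b)` with values in `(Λ_{n-1}^†)^{(r-1)} I`. -/
def ckExt1 (a b : ℕ) (p : (Fin m → ℂ) → Cl (m + 1)) : (Fin (m + 1) → ℂ) → Cl (m + 1) := fun z =>
  ∑ k ∈ Finset.range (min (2 * a) (2 * b + 1) + 1), ckTerm k (fun u => fd (Fin.last m) * p u) z

/-- Hermitean monogenic polynomials on `ℂ^n` of bidegree `(a, b)`, with values in
`(Λ_n^†)^{(r)} I`. -/
structure IsHMPoly (r a b : ℕ) {n : ℕ} (M : (Fin n → ℂ) → Cl n) : Prop where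
  bihom : ∃ C : (Fin n → ℕ) → (Fin n → ℕ) → Cl n, M = bihomPart C a b
  values : ∀ z, M z ∈ spinorPart n r
  monogenic : HermiteanMonogenicOn M Set.univ

/-- `M` is a polynomial CK-extension of `p`, where `p` has bidegree `(a, b)` and values in
`(Λ_{n-1}^†)^{(r)} I`. -/
structure IsCKExt0 (r a b : ℕ) (p : (Fin m → ℂ) → Cl (m + 1))
    (M : (Fin (m + 1) → ℂ) → Cl (m + 1)) : Prop where
  poly : IsHMPoly r a b M
  restrict : ∀ u, M (incl u) = p u
  dzc_one : ∀ u, dzc (Fin.last m) M (incl u) = -(fd (Fin.last m) * tildeDiracZd p u)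
  dzc_ge : ∀ j, 2 ≤ j → j ≤ b → ∀ u, (dzc (Fin.last m))^[j] M (incl u) = 0
  dz_ge : ∀ i, 1 ≤ i → i ≤ a → ∀ u, (dz (Fin.last m))^[i] M (incl u) = 0

/-- `M` is a polynomial CK-extension of `f_n^† p`, where `p` has bidegree `(a, b)` and values in
`(Λ_{n-1}^†)^{(r-1)} I`. -/
structure IsCKExt1 (r a b : ℕ) (p : (Fin m → ℂ) → Cl (m + 1))
    (M : (Fin (m + 1) → ℂ) → Cl (m + 1)) : Prop where
  poly : IsHMPoly r a b M
  restrict : ∀ u, M (incl u) = fd (Fin.last m) * p u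
  dzc_ge : ∀ j, 1 ≤ j → j ≤ b → ∀ u, (dzc (Fin.last m))^[j] M (incl u) = 0
  dz_one : ∀ u, dz (Fin.last m) M (incl u) = tildeDiracZ p u
  dz_ge : ∀ i, 2 ≤ i → i ≤ a → ∀ u, (dz (Fin.last m))^[i] M (incl u) = 0

end

end HermClifford

/-! Split off the last variable: ∂_z = ∂̃_z + f_n^† ∂_{z_n} and ∂_z^† = ∂̃_z^† + f_n ∂_{z_n^c}. On
z_n = 0, left multiplication by f_n^†, respectively f_n, removes the transversal derivative, because
these elements square to zero. Since F^0 = f_n f_n^† F and F^1 = f_n F, what remains is the pair of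
compatibility conditions (`tildeDirac_eq_zero_of_extension`).

The converse is carried out on coefficient arrays of power series in z and z^c. Write d = ∂̃_z, δ =
∂̃_z^†, A = d f_n, B = δ f_n^† and L = -(dδ + δd) = -∑_{j<n} ∂_{z_j} ∂_{z_j^c}. Then A² = B² = 0, L
commutes with everything, and (AB + BA) X = L X for compatible X (`CKRel.AB_add_BA_apply`). The
powers of wA + w^c B therefore collapse: in the extension series only w^s (w^c)^t with |s - t| ≤ 1
survive, with coefficient L^s, L^t A or L^s B divided by s! t! (`ck_pow_eq_sum`). The two Dirac
equations become recursions between neighbouring coefficients (`CKRel.d_ckCoeff`,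
`CKRel.δ_ckCoeff`).

Convergence: the coefficient at (s, t) involves s + t derivatives, which the denominator s! t!
balances. In a weighted ℓ¹ norm the whole series costs only a fixed factor θ of the radius
(`exists_ckSeries_bound`).

The extension preserves the bidegree in all variables (`ckSeries_weight`), so the polynomials CK[p]
are the bihomogeneous parts of one convergent series, and the sums in the theorem are regroupings of
it (`hasSum_ckTerm_bidegree`).

Uniqueness: ∂_z ∂_z^† + ∂_z^† ∂_z = ∑_j ∂_{z_j} ∂_{z_j^c}, so null solutions are harmonic, and
harmonicity recovers every mixed coefficient in z_n, z_n^c from the pure ones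
(`coeffExtend_eq_zero_of_monogenic`). -/

namespace HermClifford

noncomputable section

open scoped ENNReal NNReal

/-! ### Witt basis relations and the graded spinor spaces. -/

section Clifford

theorem gen_mul_gen_add_swap {n : ℕ} (a b : Fin (n + n)) :
    (gen a * gen b + gen b * gen a : Cl n) = algebraMap ℂ (Cl n) (if a = b then -2 else 0) := by
  rw [gen, gen, CliffordAlgebra.ι_mul_ι_add_swap]
  congr 1
  simp only [QuadraticMap.polar, form, QuadraticMap.weightedSumSquares_apply, Pi.add_apply,
    ← Finset.sum_sub_distrib]
  rcases eq_or_ne a b with rfl | h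
  · rw [Finset.sum_eq_single a]
    · simp; norm_num
    · intro c _ hc; simp [hc]
    · simp
  · rw [if_neg h]
    refine Finset.sum_eq_zero fun c _ => ?_
    by_cases h1 : c = a
    · subst h1; simp [h]
    · simp [h1]

theorem castAdd_ne_natAdd {n : ℕ} (j k : Fin n) : Fin.castAdd n j ≠ Fin.natAdd n k := by
  intro h
  have := congrArg Fin.val h
  simp at this
  omega

/-- One bilinear expansion serves all the Witt relations: up to scalars f_j and f_j^† are e_j ∓ i
e_{n+j}, so only p, q = ±i vary. -/
theorem smul_pair_anticomm {n : ℕ} (a b c d : Cl n) (p q : ℂ) (x y z w : ℂ)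
    (h1 : a * c + c * a = algebraMap ℂ _ x) (h2 : a * d + d * a = algebraMap ℂ _ y)
    (h3 : b * c + c * b = algebraMap ℂ _ z) (h4 : b * d + d * b = algebraMap ℂ _ w) :
    (a + p • b) * (c + q • d) + (c + q • d) * (a + p • b) =
      algebraMap ℂ _ (x + q * y + p * z + p * q * w) := by
  simp only [map_add, map_mul, ← h1, ← h2, ← h3, ← h4, ← Algebra.smul_def]
  simp only [add_mul, mul_add, smul_mul_assoc, mul_smul_comm, smul_add]
  simp only [smul_smul, mul_comm q p]
  simp only [← Algebra.smul_def, mul_smul]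
  abel

theorem f_mul_fd_add_swap {n : ℕ} (j k : Fin n) :
    (f j * fd k + fd k * f j : Cl n) = if j = k then 1 else 0 := by
  have h := smul_pair_anticomm _ _ _ _ (-Complex.I) Complex.I _ _ _ _
    (gen_mul_gen_add_swap (Fin.castAdd n j) (Fin.castAdd n k))
    (gen_mul_gen_add_swap (Fin.castAdd n j) (Fin.natAdd n k))
    (gen_mul_gen_add_swap (Fin.natAdd n j) (Fin.castAdd n k))
    (gen_mul_gen_add_swap (Fin.natAdd n j) (Fin.natAdd n k))
  have h2 : (f j * fd k + fd k * f j : Cl n) = (-(1 / 4) : ℂ) •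
      ((gen (Fin.castAdd n j) + (-Complex.I) • gen (Fin.natAdd n j)) *
        (gen (Fin.castAdd n k) + Complex.I • gen (Fin.natAdd n k)) +
       (gen (Fin.castAdd n k) + Complex.I • gen (Fin.natAdd n k)) *
        (gen (Fin.castAdd n j) + (-Complex.I) • gen (Fin.natAdd n j))) := by
    rw [f, fd, smul_mul_smul_comm, smul_mul_smul_comm, neg_smul Complex.I, ← sub_eq_add_neg,
      smul_add]
    norm_num
  rw [h2, h, Algebra.smul_def, ← map_mul]
  simp only [castAdd_ne_natAdd, (castAdd_ne_natAdd _ _).symm, if_false, Fin.castAdd_inj,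
    Fin.natAdd_inj]
  split_ifs
  · rw [← map_one (algebraMap ℂ (Cl n))]; congr 1
    linear_combination (-(1 / 2 : ℂ)) * Complex.I_mul_I
  · simp

theorem f_mul_f {n : ℕ} (j k : Fin n) : (f j * f k : Cl n) = -(f k * f j) := by
  rw [eq_neg_iff_add_eq_zero]
  have h := smul_pair_anticomm _ _ _ _ (-Complex.I) (-Complex.I) _ _ _ _
    (gen_mul_gen_add_swap (Fin.castAdd n j) (Fin.castAdd n k))
    (gen_mul_gen_add_swap (Fin.castAdd n j) (Fin.natAdd n k))
    (gen_mul_gen_add_swap (Fin.natAdd n j) (Fin.castAdd n k))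
    (gen_mul_gen_add_swap (Fin.natAdd n j) (Fin.natAdd n k))
  simp only [f, sub_eq_add_neg, ← neg_smul]
  rw [smul_mul_assoc, mul_smul_comm, smul_mul_assoc, mul_smul_comm, ← smul_add, ← smul_add, h]
  simp only [castAdd_ne_natAdd, (castAdd_ne_natAdd _ _).symm, if_false, Fin.castAdd_inj,
    Fin.natAdd_inj]
  split_ifs <;> simp

theorem fd_mul_fd {n : ℕ} (j k : Fin n) : (fd j * fd k : Cl n) = -(fd k * fd j) := by
  rw [eq_neg_iff_add_eq_zero]
  have h := smul_pair_anticomm _ _ _ _ Complex.I Complex.I _ _ _ _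
    (gen_mul_gen_add_swap (Fin.castAdd n j) (Fin.castAdd n k))
    (gen_mul_gen_add_swap (Fin.castAdd n j) (Fin.natAdd n k))
    (gen_mul_gen_add_swap (Fin.natAdd n j) (Fin.castAdd n k))
    (gen_mul_gen_add_swap (Fin.natAdd n j) (Fin.natAdd n k))
  simp only [fd]
  rw [smul_mul_assoc, mul_smul_comm, smul_mul_assoc, mul_smul_comm, ← smul_add, ← smul_add, h]
  simp only [castAdd_ne_natAdd, (castAdd_ne_natAdd _ _).symm, if_false, Fin.castAdd_inj,
    Fin.natAdd_inj]
  split_ifs <;> simp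

theorem eq_zero_of_eq_neg_self {V : Type*} [AddCommGroup V] [Module ℂ V] {x : V} (h : x = -x) :
    x = 0 := by
  have h2 : (2 : ℂ) • x = 0 := by rw [two_smul]; nth_rw 1 [h]; exact neg_add_cancel x
  exact (smul_eq_zero.1 h2).resolve_left two_ne_zero

theorem f_mul_self {n : ℕ} (j : Fin n) : (f j * f j : Cl n) = 0 :=
  eq_zero_of_eq_neg_self (f_mul_f j j)

theorem fd_mul_self {n : ℕ} (j : Fin n) : (fd j * fd j : Cl n) = 0 :=
  eq_zero_of_eq_neg_self (fd_mul_fd j j)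

theorem f_mul_fd_self {n : ℕ} (j : Fin n) : (f j * fd j : Cl n) = 1 - fd j * f j := by
  rw [eq_sub_iff_add_eq, f_mul_fd_add_swap, if_pos rfl]

theorem f_mul_fd_of_ne {n : ℕ} {j k : Fin n} (h : j ≠ k) : (f j * fd k : Cl n) = -(fd k * f j) := by
  rw [eq_neg_iff_add_eq_zero, f_mul_fd_add_swap, if_neg h]

/-- For k ≠ j, f_j commutes with f_k f_k^† (two sign changes), so it travels to its own factor,
where f_j f_j = 0. -/
theorem f_mul_idem {n : ℕ} (j : Fin n) : (f j * idem n : Cl n) = 0 := by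
  have key : ∀ l : List (Fin n), j ∈ l → (f j * (l.map fun k => f k * fd k).prod : Cl n) = 0 := by
    intro l
    induction l with
    | nil => simp
    | cons k l ih =>
      intro hj
      rw [List.map_cons, List.prod_cons]
      rcases eq_or_ne j k with rfl | h
      · rw [← mul_assoc, ← mul_assoc, f_mul_self, zero_mul, zero_mul]
      · rw [← mul_assoc, ← mul_assoc, f_mul_f, neg_mul, mul_assoc (f k), f_mul_fd_of_ne h, mul_neg,
          neg_neg, mul_assoc, mul_assoc, ih ((List.mem_cons.1 hj).resolve_left h), mul_zero,
          mul_zero]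
  rw [idem, List.ofFn_eq_map]
  exact key _ (List.mem_finRange j)

theorem bladeSpace_mono {n : ℕ} {s t : Set (Fin n)} (h : s ⊆ t) (r : ℕ) :
    bladeSpace s r ≤ bladeSpace t r :=
  Submodule.span_mono fun _ ⟨l, h1, h2, h3, h4⟩ => ⟨l, h1, h2, fun k hk => h (h3 k hk), h4⟩

theorem fd_mul_mem_bladeSpace {n : ℕ} {s : Set (Fin n)} {j : Fin n} (hj : j ∈ s) {r : ℕ} {x : Cl n}
    (hx : x ∈ bladeSpace s r) : fd j * x ∈ bladeSpace s (r + 1) := by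
  suffices h : bladeSpace s r ≤ (bladeSpace s (r + 1)).comap (LinearMap.mulLeft ℂ (fd j)) from h hx
  refine Submodule.span_le.2 ?_
  rintro _ ⟨l, h1, h2, h3, rfl⟩
  change fd j * _ ∈ bladeSpace s (r + 1)
  by_cases hjl : j ∈ l
  -- A repeated index gives zero: f_j^† anticommutes up to its twin and squares to zero.
  · have key : ∀ l : List (Fin n), j ∈ l → (fd j * (l.map fd).prod : Cl n) = 0 := by
      intro l
      induction l with
      | nil => simp
      | cons k l ih =>
        intro hj
        rw [List.map_cons, List.prod_cons]
        rcases eq_or_ne j k with rfl | h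
        · rw [← mul_assoc, fd_mul_self, zero_mul]
        · rw [← mul_assoc, fd_mul_fd, neg_mul, mul_assoc,
            ih ((List.mem_cons.1 hj).resolve_left h), mul_zero, neg_zero]
    rw [← mul_assoc, key l hjl, zero_mul]
    exact Submodule.zero_mem _
  · refine Submodule.subset_span ⟨j :: l, List.nodup_cons.2 ⟨hjl, h1⟩, by simp [h2], ?_, ?_⟩
    · simpa [hj] using h3
    · simp [mul_assoc]

/-- Contraction: f_j f_k^† = δ_{jk} - f_k^† f_j moves f_j through the word one letter at a time, and
f_j I = 0 at the end. -/
theorem f_mul_mem_bladeSpace {n : ℕ} {s : Set (Fin n)} (j : Fin n) {r : ℕ} {x : Cl n}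
    (hx : x ∈ bladeSpace s (r + 1)) : f j * x ∈ bladeSpace s r := by
  suffices h : bladeSpace s (r + 1) ≤ (bladeSpace s r).comap (LinearMap.mulLeft ℂ (f j)) from h hx
  clear hx x
  refine Submodule.span_le.2 ?_
  rintro _ ⟨l, h1, h2, h3, rfl⟩
  change f j * _ ∈ bladeSpace s r
  induction l generalizing r with
  | nil => simp at h2
  | cons k l ih =>
    have hl : ∀ i ∈ l, i ∈ s := fun i hi => h3 i (List.mem_cons_of_mem _ hi)
    have hk : k ∈ s := h3 k List.mem_cons_self
    have hr : l.length = r := by simpa using h2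
    have e : (f j * ((List.map fd (k :: l)).prod * idem n) : Cl n) =
        (if j = k then 1 else 0) * ((l.map fd).prod * idem n) -
          fd k * (f j * ((l.map fd).prod * idem n)) := by
      rw [← f_mul_fd_add_swap, List.map_cons, List.prod_cons]
      noncomm_ring
    rw [e]
    refine Submodule.sub_mem _ ?_ ?_
    · split_ifs
      · rw [one_mul]
        exact Submodule.subset_span ⟨l, (List.nodup_cons.1 h1).2, hr, hl, rfl⟩
      · rw [zero_mul]; exact Submodule.zero_mem _
    · cases r with
      | zero =>
        rw [List.length_eq_zero_iff] at hr
        subst hr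
        simp [f_mul_idem]
      | succ r =>
        exact fd_mul_mem_bladeSpace hk
          (ih (List.nodup_cons.1 h1).2 hr hl)

theorem f_mul_eq_zero_of_mem_bladeSpace {n : ℕ} {s : Set (Fin n)} {j : Fin n} (hj : j ∉ s) {r : ℕ}
    {x : Cl n} (hx : x ∈ bladeSpace s r) : f j * x = 0 := by
  suffices h : bladeSpace s r ≤ LinearMap.ker (LinearMap.mulLeft ℂ (f j : Cl n)) from h hx
  refine Submodule.span_le.2 ?_
  rintro _ ⟨l, -, -, h3, rfl⟩
  change f j * _ = 0
  induction l with
  | nil => simp [f_mul_idem]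
  | cons k l ih =>
    have hk : j ≠ k := fun h => hj (h ▸ h3 k List.mem_cons_self)
    rw [List.map_cons, List.prod_cons, mul_assoc, ← mul_assoc, f_mul_fd_of_ne hk, neg_mul,
      mul_assoc, ih fun i hi => h3 i (List.mem_cons_of_mem _ hi), mul_zero, neg_zero]

theorem f_last_mul_of_mem {m r : ℕ} {x : Cl (m + 1)} (hx : x ∈ tildeSpinorPart m r) :
    f (Fin.last m) * x = 0 :=
  f_mul_eq_zero_of_mem_bladeSpace (by simp) hx

instance instFiniteDimensional (n : ℕ) : FiniteDimensional ℂ (Cl n) :=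
  Module.Finite.of_injective (coords n) (coords_injective n)

instance instCompleteSpace (n : ℕ) : CompleteSpace (Cl n) := FiniteDimensional.complete ℂ (Cl n)

/-- Left multiplication by a Clifford number, as a continuous linear map. -/
def mulLeftL {n : ℕ} (a : Cl n) : Cl n →L[ℂ] Cl n := (LinearMap.mulLeft ℂ a).toContinuousLinearMap

end Clifford

/-! ### Power series in z and z^c: coefficient arrays and monomials. -/

section Series

variable {k : ℕ} {E : Type*} [NormedAddCommGroup E] [NormedSpace ℂ E]

/-- Coefficient arrays of multiple power series in `z_1, …, z_k, z_1^c, …, z_k^c`. -/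
abbrev ZCoeff (k : ℕ) (E : Type*) : Type _ := (Fin k → ℕ) → (Fin k → ℕ) → E

/-- On the ball of radius `R`, `G` is the sum of the power series with coefficients `C`. -/
def HasZSumOn (G : (Fin k → ℂ) → E) (C : ZCoeff k E) (R : ℝ) : Prop :=
  ∀ z : Fin k → ℂ, ‖z‖ < R →
    HasSum (fun γ : (Fin k → ℕ) × (Fin k → ℕ) => zMonomial γ.1 γ.2 z • C γ.1 γ.2) (G z)

theorem hasZSeries_iff {G : (Fin k → ℂ) → E} {C : ZCoeff k E} :
    HasZSeries G C ↔ ∃ R > 0, HasZSumOn G C R := by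
  rw [HasZSeries, Metric.eventually_nhds_iff]
  simp [HasZSumOn]

/-- The coefficients of `∂_{z_j}` of a power series. -/
def coeffDz (j : Fin k) : ZCoeff k E →ₗ[ℂ] ZCoeff k E where
  toFun C := fun α β => ((α j + 1 : ℕ) : ℂ) • C (α + Pi.single j 1) β
  map_add' _ _ := by ext; simp
  map_smul' c _ := by ext; exact smul_comm _ c _

/-- The coefficients of `∂_{z_j^c}` of a power series. -/
def coeffDzc (j : Fin k) : ZCoeff k E →ₗ[ℂ] ZCoeff k E where
  toFun C := fun α β => ((β j + 1 : ℕ) : ℂ) • C α (β + Pi.single j 1)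
  map_add' _ _ := by ext; simp
  map_smul' c _ := by ext; exact smul_comm _ c _

theorem coeffDz_apply (j : Fin k) (C : ZCoeff k E) (α β : Fin k → ℕ) :
    coeffDz j C α β = ((α j + 1 : ℕ) : ℂ) • C (α + Pi.single j 1) β := rfl

theorem coeffDzc_apply (j : Fin k) (C : ZCoeff k E) (α β : Fin k → ℕ) :
    coeffDzc j C α β = ((β j + 1 : ℕ) : ℂ) • C α (β + Pi.single j 1) := rfl

theorem norm_zMonomial_le (α β : Fin k → ℕ) {z : Fin k → ℂ} {s : ℝ} (hz : ‖z‖ ≤ s) :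
    ‖zMonomial α β z‖ ≤ s ^ (∑ j, α j + ∑ j, β j) := by
  rw [zMonomial, norm_prod, ← Finset.sum_add_distrib, ← Finset.prod_pow_eq_pow_sum]
  refine Finset.prod_le_prod (fun _ _ => norm_nonneg _) fun j _ => ?_
  rw [norm_mul, norm_pow, norm_pow, RCLike.norm_conj, ← pow_add]
  exact pow_le_pow_left₀ (norm_nonneg _) ((norm_le_pi_norm z j).trans hz) _

/-- At a real diagonal point a monomial sees only its total degree; this test point turns
convergence into a bound on the coefficients. -/
theorem zMonomial_const (α β : Fin k → ℕ) (s : ℝ) :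
    zMonomial α β (fun _ => (s : ℂ)) = (s : ℂ) ^ (∑ j, α j + ∑ j, β j) := by
  rw [zMonomial, ← Finset.sum_add_distrib, ← Finset.prod_pow_eq_pow_sum]
  refine Finset.prod_congr rfl fun j _ => ?_
  rw [Complex.conj_ofReal, pow_add]

/-- The coordinate `z_j` as a real linear form. -/
def zCoord (j : Fin k) : (Fin k → ℂ) →L[ℝ] ℂ := ContinuousLinearMap.proj j

/-- The conjugate coordinate `z_j^c` as a real linear form. -/
def zcCoord (j : Fin k) : (Fin k → ℂ) →L[ℝ] ℂ :=
  (Complex.conjCLE : ℂ →L[ℝ] ℂ).comp (ContinuousLinearMap.proj j)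

@[simp] theorem zCoord_apply (j : Fin k) (z : Fin k → ℂ) : zCoord j z = z j := rfl

@[simp] theorem zcCoord_apply (j : Fin k) (z : Fin k → ℂ) : zcCoord j z = starRingEnd ℂ (z j) := rfl

theorem norm_zCoord_le (j : Fin k) : ‖zCoord j‖ ≤ 1 :=
  ContinuousLinearMap.opNorm_le_bound _ zero_le_one fun z => by
    simpa using norm_le_pi_norm z j

theorem norm_zcCoord_le (j : Fin k) : ‖zcCoord j‖ ≤ 1 :=
  ContinuousLinearMap.opNorm_le_bound _ zero_le_one fun z => by
    simpa using norm_le_pi_norm z j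

/-- The real differential of a monomial. -/
def zMonomialDeriv (α β : Fin k → ℕ) (z : Fin k → ℂ) : (Fin k → ℂ) →L[ℝ] ℂ :=
  ∑ j, (((α j : ℂ) * zMonomial (α - Pi.single j 1) β z) • zCoord j +
    ((β j : ℂ) * zMonomial α (β - Pi.single j 1) z) • zcCoord j)

theorem zMonomial_sub_single_left (α β : Fin k → ℕ) (z : Fin k → ℂ) (j : Fin k) :
    zMonomial (α - Pi.single j 1) β z =
      (∏ i ∈ Finset.univ.erase j, z i ^ α i * (starRingEnd ℂ (z i)) ^ β i) *
        (z j ^ (α j - 1) * (starRingEnd ℂ (z j)) ^ β j) := by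
  rw [zMonomial, ← Finset.prod_erase_mul _ _ (Finset.mem_univ j)]
  congr 1
  · refine Finset.prod_congr rfl fun i hi => ?_
    simp [Finset.ne_of_mem_erase hi]
  · simp

theorem zMonomial_sub_single_right (α β : Fin k → ℕ) (z : Fin k → ℂ) (j : Fin k) :
    zMonomial α (β - Pi.single j 1) z =
      (∏ i ∈ Finset.univ.erase j, z i ^ α i * (starRingEnd ℂ (z i)) ^ β i) *
        (z j ^ α j * (starRingEnd ℂ (z j)) ^ (β j - 1)) := by
  rw [zMonomial, ← Finset.prod_erase_mul _ _ (Finset.mem_univ j)]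
  congr 1
  · refine Finset.prod_congr rfl fun i hi => ?_
    simp [Finset.ne_of_mem_erase hi]
  · simp

theorem hasFDerivAt_zMonomial (α β : Fin k → ℕ) (z : Fin k → ℂ) :
    HasFDerivAt (zMonomial α β) (zMonomialDeriv α β z) z := by
  have h : ∀ j ∈ (Finset.univ : Finset (Fin k)), HasFDerivAt
      (fun z : Fin k → ℂ => z j ^ α j * (starRingEnd ℂ (z j)) ^ β j)
      ((z j ^ α j) • (((β j : ℂ) * (starRingEnd ℂ (z j)) ^ (β j - 1)) • zcCoord j) +
        ((starRingEnd ℂ (z j)) ^ β j) • (((α j : ℂ) * z j ^ (α j - 1)) • zCoord j)) z := by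
    intro j _
    have h1 : HasFDerivAt (fun z : Fin k → ℂ => z j ^ α j) _ z := (zCoord j).hasFDerivAt.pow (α j)
    have h2 : HasFDerivAt (fun z : Fin k → ℂ => (starRingEnd ℂ (z j)) ^ β j) _ z :=
      (zcCoord j).hasFDerivAt.pow (β j)
    refine (h1.mul h2).congr_fderiv ?_
    ext v
    simp
  refine (HasFDerivAt.finsetProd h).congr_fderiv ?_
  rw [zMonomialDeriv]
  refine Finset.sum_congr rfl fun j _ => ?_
  rw [zMonomial_sub_single_left, zMonomial_sub_single_right]
  ext v
  simp
  ring

/-- In ρ^N - s^N = (ρ - s) ∑ ρ^i s^{N-1-i} each of the N summands is at least s^{N-1}. This pays for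
the factor N of a derivative by a loss of radius. -/
theorem natCast_mul_pow_pred_le {s ρ : ℝ} (hs : 0 ≤ s) (hρ : s ≤ ρ) (N : ℕ) :
    N * s ^ (N - 1) * (ρ - s) ≤ ρ ^ N := by
  have h : N * s ^ (N - 1) * (ρ - s) ≤ ρ ^ N - s ^ N := by
    rw [← geom_sum₂_mul]
    refine mul_le_mul_of_nonneg_right ?_ (sub_nonneg.2 hρ)
    rw [← nsmul_eq_mul, ← Finset.card_range N, ← Finset.sum_const, Finset.card_range]
    refine Finset.sum_le_sum fun i hi => ?_
    rw [← Nat.add_sub_of_le (Nat.le_sub_one_of_lt (Finset.mem_range.1 hi)), pow_add,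
      Nat.add_sub_cancel_left]
    gcongr
  exact h.trans (sub_le_self _ (pow_nonneg hs N))

theorem sum_add_single (α : Fin k → ℕ) (j : Fin k) :
    ∑ i, (α + Pi.single j 1 : Fin k → ℕ) i = ∑ i, α i + 1 := by
  simp [Finset.sum_add_distrib]

theorem sub_single_add_single {α : Fin k → ℕ} {j : Fin k} (h : 0 < α j) :
    α - Pi.single j 1 + Pi.single j 1 = α := by
  refine tsub_add_cancel_of_le fun i => ?_
  rcases eq_or_ne i j with rfl | hi
  · simp; omega
  · simp [hi]

theorem sum_sub_single_add_one {α : Fin k → ℕ} {j : Fin k} (h : 0 < α j) :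
    ∑ i, (α - Pi.single j 1 : Fin k → ℕ) i + 1 = ∑ i, α i := by
  rw [← sum_add_single, sub_single_add_single h]

theorem norm_zMonomialDeriv_le (α β : Fin k → ℕ) {z : Fin k → ℂ} {s : ℝ} (hz : ‖z‖ ≤ s) :
    ‖zMonomialDeriv α β z‖ ≤
      ((∑ j, α j + ∑ j, β j : ℕ) : ℝ) * s ^ (∑ j, α j + ∑ j, β j - 1) := by
  have hs : 0 ≤ s := (norm_nonneg z).trans hz
  have h1 : ∀ j, ‖((α j : ℂ) * zMonomial (α - Pi.single j 1) β z) • zCoord j‖ ≤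
      α j * s ^ (∑ j, α j + ∑ j, β j - 1) := by
    intro j
    rw [norm_smul, norm_mul, Complex.norm_natCast, mul_assoc]
    rcases Nat.eq_zero_or_pos (α j) with h0 | h0
    · simp [h0]
    · refine mul_le_mul_of_nonneg_left ?_ (Nat.cast_nonneg _)
      refine (mul_le_of_le_one_right (norm_nonneg _) (norm_zCoord_le j)).trans
        ((norm_zMonomial_le _ _ hz).trans_eq ?_)
      congr 1
      have := sum_sub_single_add_one h0
      omega
  have h2 : ∀ j, ‖((β j : ℂ) * zMonomial α (β - Pi.single j 1) z) • zcCoord j‖ ≤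
      β j * s ^ (∑ j, α j + ∑ j, β j - 1) := by
    intro j
    rw [norm_smul, norm_mul, Complex.norm_natCast, mul_assoc]
    rcases Nat.eq_zero_or_pos (β j) with h0 | h0
    · simp [h0]
    · refine mul_le_mul_of_nonneg_left ?_ (Nat.cast_nonneg _)
      refine (mul_le_of_le_one_right (norm_nonneg _) (norm_zcCoord_le j)).trans
        ((norm_zMonomial_le _ _ hz).trans_eq ?_)
      congr 1
      have := sum_sub_single_add_one h0
      omega
  rw [Nat.cast_add, Nat.cast_sum, Nat.cast_sum, ← Finset.sum_add_distrib, Finset.sum_mul]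
  refine (norm_sum_le _ _).trans (Finset.sum_le_sum fun j _ => ?_)
  rw [add_mul]
  exact (norm_add_le _ _).trans (add_le_add (h1 j) (h2 j))

end Series

/-! ### Termwise differentiation and uniqueness of coefficients. -/

section Series

variable {k : ℕ} {E : Type*} [NormedAddCommGroup E] [NormedSpace ℂ E]
  {G H : (Fin k → ℂ) → E} {C D : ZCoeff k E} {R : ℝ}

/-- Evaluate at (ρ, …, ρ), whose sup norm is at most ρ; in finite dimension unconditional
convergence is absolute. -/
theorem HasZSumOn.summable_norm [FiniteDimensional ℂ E] (h : HasZSumOn G C R) {ρ : ℝ} (h0 : 0 ≤ ρ)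
    (hρ : ρ < R) :
    Summable fun γ : (Fin k → ℕ) × (Fin k → ℕ) =>
      ‖C γ.1 γ.2‖ * ρ ^ (∑ j, γ.1 j + ∑ j, γ.2 j) := by
  have : FiniteDimensional ℝ E := FiniteDimensional.complexToReal E
  have h1 : ‖(fun _ : Fin k => (ρ : ℂ))‖ < R := by
    refine lt_of_le_of_lt ((pi_norm_le_iff_of_nonneg h0).2 fun _ => ?_) hρ
    rw [Complex.norm_real, Real.norm_of_nonneg h0]
  refine (h _ h1).summable.norm.congr fun γ => ?_
  rw [norm_smul, zMonomial_const, norm_pow, Complex.norm_real, Real.norm_of_nonneg h0, mul_comm]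

theorem norm_smulRight_le (c : (Fin k → ℂ) →L[ℝ] ℂ) (x : E) : ‖c.smulRight x‖ ≤ ‖c‖ * ‖x‖ := by
  refine ContinuousLinearMap.opNorm_le_bound _ (by positivity) fun v => ?_
  rw [ContinuousLinearMap.smulRight_apply, norm_smul, mul_right_comm]
  exact mul_le_mul_of_nonneg_right (c.le_opNorm v) (norm_nonneg _)

theorem HasZSumOn.hasFDerivAt [FiniteDimensional ℂ E] (h : HasZSumOn G C R) {z : Fin k → ℂ}
    (hz : ‖z‖ < R) :
    DifferentiableAt ℝ G z ∧
      HasSum (fun γ : (Fin k → ℕ) × (Fin k → ℕ) =>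
        (zMonomialDeriv γ.1 γ.2 z).smulRight (C γ.1 γ.2)) (fderiv ℝ G z) := by
  have : CompleteSpace E := FiniteDimensional.complete ℂ E
  -- With ‖z‖ < s < ρ < R, the differentials of the terms on the ball of radius s are dominated by
  -- the absolutely convergent series at radius ρ, times (ρ - s)⁻¹.
  obtain ⟨s, hs, hsR⟩ := exists_between hz
  obtain ⟨ρ, hρ, hρR⟩ := exists_between hsR
  have hs0 : 0 ≤ s := (norm_nonneg z).trans hs.le
  have hsum := (h.summable_norm (hs0.trans hρ.le) hρR).mul_left (ρ - s)⁻¹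
  have hbound : ∀ (γ : (Fin k → ℕ) × (Fin k → ℕ)) (x : Fin k → ℂ), x ∈ Metric.ball 0 s →
      ‖(zMonomialDeriv γ.1 γ.2 x).smulRight (C γ.1 γ.2)‖ ≤
        (ρ - s)⁻¹ * (‖C γ.1 γ.2‖ * ρ ^ (∑ j, γ.1 j + ∑ j, γ.2 j)) := by
    intro γ x hx
    refine (norm_smulRight_le _ _).trans ?_
    rw [mul_comm, mul_left_comm]
    refine mul_le_mul_of_nonneg_left ?_ (norm_nonneg _)
    refine (norm_zMonomialDeriv_le _ _ (mem_ball_zero_iff.1 hx).le).trans ?_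
    rw [← div_eq_inv_mul, le_div_iff₀ (sub_pos.2 hρ)]
    exact natCast_mul_pow_pred_le hs0 hρ.le _
  have hzs : z ∈ Metric.ball (0 : Fin k → ℂ) s := mem_ball_zero_iff.2 hs
  have hf : ∀ (γ : (Fin k → ℕ) × (Fin k → ℕ)) (x : Fin k → ℂ), x ∈ Metric.ball 0 s →
      HasFDerivAt (fun x => zMonomial γ.1 γ.2 x • C γ.1 γ.2)
        ((zMonomialDeriv γ.1 γ.2 x).smulRight (C γ.1 γ.2)) x := fun γ x _ =>
    (hasFDerivAt_zMonomial γ.1 γ.2 x).smul_const (C γ.1 γ.2)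
  have hd := hasFDerivAt_tsum_of_isPreconnected hsum Metric.isOpen_ball
    (convex_ball (0 : Fin k → ℂ) s).isPreconnected
    hf hbound hzs
    (h z hz).summable hzs
  have heq : G =ᶠ[𝓝 z] fun x => ∑' γ : (Fin k → ℕ) × (Fin k → ℕ),
      zMonomial γ.1 γ.2 x • C γ.1 γ.2 := by
    filter_upwards [Metric.isOpen_ball.mem_nhds hzs] with x hx
    exact (h x ((mem_ball_zero_iff.1 hx).trans hsR)).tsum_eq.symm
  have hd' := hd.congr_of_eventuallyEq heq
  refine ⟨hd'.differentiableAt, ?_⟩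
  rw [hd'.fderiv]
  exact (Summable.of_norm_bounded hsum fun γ => hbound γ z hzs).hasSum

theorem HasZSumOn.differentiableAt [FiniteDimensional ℂ E] (h : HasZSumOn G C R) {z : Fin k → ℂ}
    (hz : ‖z‖ < R) : DifferentiableAt ℝ G z := (h.hasFDerivAt hz).1

theorem zMonomialDeriv_single_one (α β : Fin k → ℕ) (z : Fin k → ℂ) (j : Fin k) :
    zMonomialDeriv α β z (Pi.single j 1) =
      (α j : ℂ) * zMonomial (α - Pi.single j 1) β z +
        (β j : ℂ) * zMonomial α (β - Pi.single j 1) z := by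
  rw [zMonomialDeriv, sum_apply, Finset.sum_eq_single j]
  · simp
  · intro i _ hi; simp [hi]
  · simp

theorem zMonomialDeriv_single_I (α β : Fin k → ℕ) (z : Fin k → ℂ) (j : Fin k) :
    zMonomialDeriv α β z (Pi.single j Complex.I) =
      (α j : ℂ) * zMonomial (α - Pi.single j 1) β z * Complex.I -
        (β j : ℂ) * zMonomial α (β - Pi.single j 1) z * Complex.I := by
  rw [zMonomialDeriv, sum_apply, Finset.sum_eq_single j]
  · simp [sub_eq_add_neg]
  · intro i _ hi; simp [hi]
  · simp

/-- The combination ½(D(1) - i D(i)) cancels the z_j^c part of each term. What is left is re-indexed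
by α ↦ α + e_j; outside the range of this shift α_j = 0 and the term vanishes. -/
theorem HasZSumOn.dz [FiniteDimensional ℂ E] (h : HasZSumOn G C R) (j : Fin k) :
    HasZSumOn (dz j G) (coeffDz j C) R := by
  intro z hz
  have hs := (h.hasFDerivAt hz).2
  have h1 := (ContinuousLinearMap.apply ℝ E (Pi.single j 1 : Fin k → ℂ)).hasSum hs
  have h2 := (ContinuousLinearMap.apply ℝ E (Pi.single j Complex.I : Fin k → ℂ)).hasSum hs
  have h3 := (h1.sub (h2.const_smul Complex.I)).const_smul (1 / 2 : ℂ)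
  have hinj : Function.Injective (fun γ : (Fin k → ℕ) × (Fin k → ℕ) =>
      ((γ.1 + Pi.single j 1, γ.2) : (Fin k → ℕ) × (Fin k → ℕ))) := by
    rintro ⟨a, b⟩ ⟨a', b'⟩ hab
    simpa using hab
  refine ((hinj.hasSum_iff ?_).2 h3).congr_fun ?_
  · rintro ⟨α, β⟩ hγ
    have h0 : α j = 0 := by
      by_contra h0
      exact hγ ⟨(α - Pi.single j 1, β), by
        simp [sub_single_add_single (Nat.pos_of_ne_zero h0)]⟩
    simp [zMonomialDeriv_single_one, zMonomialDeriv_single_I, h0, smul_smul]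
    rw [← add_smul]
    convert zero_smul ℂ _
    linear_combination (1 / 2 : ℂ) * (β j : ℂ) * zMonomial α (β - Pi.single j 1) z * Complex.I_mul_I
  · rintro ⟨α, β⟩
    simp [zMonomialDeriv_single_one, zMonomialDeriv_single_I, coeffDz_apply, smul_smul, ← sub_smul]
    congr 1
    linear_combination (-(1 / 2) : ℂ) * ((β j : ℂ) * zMonomial (α + Pi.single j 1)
      (β - Pi.single j 1) z - ((α j : ℂ) + 1) * zMonomial α β z) * Complex.I_mul_I

theorem HasZSumOn.dzc [FiniteDimensional ℂ E] (h : HasZSumOn G C R) (j : Fin k) :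
    HasZSumOn (dzc j G) (coeffDzc j C) R := by
  intro z hz
  have hs := (h.hasFDerivAt hz).2
  have h1 := (ContinuousLinearMap.apply ℝ E (Pi.single j 1 : Fin k → ℂ)).hasSum hs
  have h2 := (ContinuousLinearMap.apply ℝ E (Pi.single j Complex.I : Fin k → ℂ)).hasSum hs
  have h3 := (h1.add (h2.const_smul Complex.I)).const_smul (1 / 2 : ℂ)
  have hinj : Function.Injective (fun γ : (Fin k → ℕ) × (Fin k → ℕ) =>
      ((γ.1, γ.2 + Pi.single j 1) : (Fin k → ℕ) × (Fin k → ℕ))) := by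
    rintro ⟨a, b⟩ ⟨a', b'⟩ hab
    simpa using hab
  refine ((hinj.hasSum_iff ?_).2 h3).congr_fun ?_
  · rintro ⟨α, β⟩ hγ
    have h0 : β j = 0 := by
      by_contra h0
      exact hγ ⟨(α, β - Pi.single j 1), by
        simp [sub_single_add_single (Nat.pos_of_ne_zero h0)]⟩
    simp [zMonomialDeriv_single_one, zMonomialDeriv_single_I, h0, smul_smul]
    rw [← add_smul]
    convert zero_smul ℂ _
    linear_combination (1 / 2 : ℂ) * (α j : ℂ) * zMonomial (α - Pi.single j 1) β z * Complex.I_mul_I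
  · rintro ⟨α, β⟩
    simp [zMonomialDeriv_single_one, zMonomialDeriv_single_I, coeffDzc_apply, smul_smul, ← add_smul]
    congr 1
    linear_combination (-(1 / 2) : ℂ) * ((α j : ℂ) * zMonomial (α - Pi.single j 1)
      (β + Pi.single j 1) z - ((β j : ℂ) + 1) * zMonomial α β z) * Complex.I_mul_I

theorem HasZSumOn.add (h : HasZSumOn G C R) (h' : HasZSumOn H D R) :
    HasZSumOn (fun z => G z + H z) (C + D) R := fun z hz =>
  ((h z hz).add (h' z hz)).congr_fun fun _ => smul_add _ _ _

theorem HasZSumOn.sub (h : HasZSumOn G C R) (h' : HasZSumOn H D R) :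
    HasZSumOn (fun z => G z - H z) (C - D) R := fun z hz =>
  ((h z hz).sub (h' z hz)).congr_fun fun _ => smul_sub _ _ _

theorem HasZSumOn.sum {ι : Type*} (s : Finset ι) {G : ι → (Fin k → ℂ) → E} {C : ι → ZCoeff k E}
    (h : ∀ i ∈ s, HasZSumOn (G i) (C i) R) :
    HasZSumOn (fun z => ∑ i ∈ s, G i z) (∑ i ∈ s, C i) R := fun z hz =>
  (hasSum_sum fun i hi => h i hi z hz).congr_fun fun γ => by
    rw [← Finset.smul_sum, Finset.sum_apply, Finset.sum_apply]

theorem HasZSumOn.const_smul (h : HasZSumOn G C R) (c : ℂ) :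
    HasZSumOn (fun z => c • G z) (c • C) R := fun z hz =>
  ((h z hz).const_smul c).congr_fun fun _ => smul_comm _ _ _

/-- Apply a linear map to all coefficients of a power series. -/
def coeffMap {E' : Type*} [AddCommGroup E'] [Module ℂ E'] (T : E →ₗ[ℂ] E') :
    ZCoeff k E →ₗ[ℂ] ZCoeff k E' where
  toFun C := fun α β => T (C α β)
  map_add' _ _ := by ext; simp
  map_smul' c _ := by ext; exact T.map_smul c _

theorem HasZSumOn.map {E' : Type*} [NormedAddCommGroup E'] [NormedSpace ℂ E']
    (h : HasZSumOn G C R) (T : E →L[ℂ] E') :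
    HasZSumOn (fun z => T (G z)) (coeffMap T.toLinearMap C) R := fun z hz =>
  (T.hasSum (h z hz)).congr_fun fun _ => (T.map_smul _ _).symm

theorem HasZSumOn.mono (h : HasZSumOn G C R) {R' : ℝ} (hR : R' ≤ R) : HasZSumOn G C R' :=
  fun z hz => h z (hz.trans_le hR)

theorem HasZSumOn.congr (h : HasZSumOn G C R) (hG : ∀ z, ‖z‖ < R → H z = G z) :
    HasZSumOn H C R := fun z hz => by rw [hG z hz]; exact h z hz

theorem HasZSumOn.apply_zero (h : HasZSumOn G C R) (hR : 0 < R) : G 0 = C 0 0 := by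
  refine (h 0 (by simpa using hR)).unique ?_
  have h1 := hasSum_single (f := fun γ : (Fin k → ℕ) × (Fin k → ℕ) =>
    zMonomial γ.1 γ.2 0 • C γ.1 γ.2) (0, 0) ?_
  · simpa [zMonomial] using h1
  · rintro ⟨α, β⟩ hne
    have : ∃ j, α j ≠ 0 ∨ β j ≠ 0 := by
      by_contra! hcon
      exact hne (Prod.ext (funext fun j => (hcon j).1) (funext fun j => (hcon j).2))
    obtain ⟨j, hj⟩ := this
    have : zMonomial α β (0 : Fin k → ℂ) = 0 := by
      refine Finset.prod_eq_zero (Finset.mem_univ j) ?_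
      rcases hj with hj | hj <;> simp [hj]
    simp [this]

/-- Induction on the total degree: the constant coefficient is the value at the origin, and a
coefficient of degree N + 1 is, up to a nonzero integer factor, a coefficient of degree N of a first
derivative, which vanishes as well. -/
theorem HasZSumOn.coeff_eq_zero [FiniteDimensional ℂ E] (h : HasZSumOn G C R) (hR : 0 < R)
    (hG : ∀ z, ‖z‖ < R → G z = 0) : C = 0 := by
  suffices key : ∀ N : ℕ, ∀ (G : (Fin k → ℂ) → E) (C : ZCoeff k E), HasZSumOn G C R →
      (∀ z, ‖z‖ < R → G z = 0) → ∀ α β : Fin k → ℕ, ∑ j, α j + ∑ j, β j = N → C α β = 0 by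
    ext α β
    exact key _ G C h hG α β rfl
  intro N
  induction N with
  | zero =>
    intro G C h hG α β hN
    have hα : α = 0 := funext fun j => by
      have := Finset.single_le_sum (fun i _ => Nat.zero_le (α i)) (Finset.mem_univ j)
      simp only [Pi.zero_apply]; omega
    have hβ : β = 0 := funext fun j => by
      have := Finset.single_le_sum (fun i _ => Nat.zero_le (β i)) (Finset.mem_univ j)
      simp only [Pi.zero_apply]; omega
    rw [hα, hβ, ← h.apply_zero hR, hG 0 (by simpa using hR)]
  | succ N ih =>
    intro G C h hG α β hN
    have hfd : ∀ z, ‖z‖ < R → fderiv ℝ G z = 0 := by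
      intro z hz
      have : G =ᶠ[𝓝 z] fun _ => 0 := by
        filter_upwards [Metric.isOpen_ball.mem_nhds (mem_ball_zero_iff.2 hz)] with x hx
        exact hG x (mem_ball_zero_iff.1 hx)
      rw [this.fderiv_eq, fderiv_fun_const, Pi.zero_apply]
    have hex : (∃ j, 0 < α j) ∨ ∃ j, 0 < β j := by
      by_contra! hcon
      simp [fun j => Nat.le_zero.1 (hcon.1 j), fun j => Nat.le_zero.1 (hcon.2 j)] at hN
    rcases hex with ⟨j, hj⟩ | ⟨j, hj⟩
    · have h1 := ih _ _ (h.dz j) (fun z hz => by simp [HermClifford.dz, hfd z hz])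
        (α - Pi.single j 1) β (by have := sum_sub_single_add_one hj; omega)
      rw [coeffDz_apply, sub_single_add_single hj] at h1
      exact (smul_eq_zero.1 h1).resolve_left (Nat.cast_ne_zero.2 (Nat.succ_ne_zero _))
    · have h1 := ih _ _ (h.dzc j) (fun z hz => by simp [HermClifford.dzc, hfd z hz])
        α (β - Pi.single j 1) (by have := sum_sub_single_add_one hj; omega)
      rw [coeffDzc_apply, sub_single_add_single hj] at h1
      exact (smul_eq_zero.1 h1).resolve_left (Nat.cast_ne_zero.2 (Nat.succ_ne_zero _))

theorem HasZSumOn.coeff_unique [FiniteDimensional ℂ E] (h : HasZSumOn G C R) (hR : 0 < R)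
    (h' : HasZSumOn G D R) : C = D :=
  sub_eq_zero.1 ((h.sub h').coeff_eq_zero hR fun _ _ => sub_self _)

/-- A linear functional that kills W but not a stray coefficient would turn G into the zero function
with a nonzero coefficient. -/
theorem HasZSumOn.coeff_mem [FiniteDimensional ℂ E] (h : HasZSumOn G C R) (hR : 0 < R)
    (W : Submodule ℂ E) (hG : ∀ z, ‖z‖ < R → G z ∈ W) (α β : Fin k → ℕ) : C α β ∈ W := by
  by_contra hC
  obtain ⟨φ, hφ, hW⟩ := W.exists_le_ker_of_notMem hC
  refine hφ ?_
  have h0 := (h.map φ.toContinuousLinearMap).coeff_eq_zero hR fun z hz => hW (hG z hz)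
  exact congrFun (congrFun h0 α) β

theorem HasZSumOn.mem [FiniteDimensional ℂ E] (h : HasZSumOn G C R) (W : Submodule ℂ E)
    (hC : ∀ α β, C α β ∈ W) {z : Fin k → ℂ} (hz : ‖z‖ < R) : G z ∈ W :=
  W.closed_of_finiteDimensional.mem_of_tendsto (h z hz)
    (Filter.Eventually.of_forall fun _ => W.sum_mem fun _ _ => W.smul_mem _ (hC _ _))

/-- The splitting of a real-linear map into complex-linear and antilinear parts, used both for
differentials and for the slots of multilinear maps. -/
theorem realLinear_apply_eq_sum (T : (Fin k → ℂ) →L[ℝ] E) (v : Fin k → ℂ) :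
    T v = ∑ j, (v j • (1 / 2 : ℂ) • (T (Pi.single j 1) - Complex.I • T (Pi.single j Complex.I)) +
      starRingEnd ℂ (v j) •
        (1 / 2 : ℂ) • (T (Pi.single j 1) + Complex.I • T (Pi.single j Complex.I))) := by
  have hv : v = ∑ j, ((v j).re • (Pi.single j 1 : Fin k → ℂ) +
      (v j).im • (Pi.single j Complex.I : Fin k → ℂ)) := by
    ext i
    simp only [Finset.sum_apply, Pi.add_apply, Pi.smul_apply]
    rw [Finset.sum_eq_single i]
    · simp [Complex.re_add_im]
    · intro j _ hj; simp [hj.symm]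
    · simp
  conv_lhs => rw [hv]
  rw [map_sum]
  refine Finset.sum_congr rfl fun j _ => ?_
  simp only [map_add, map_smul]
  have e1 : (v j) = ((v j).re : ℂ) + ((v j).im : ℂ) * Complex.I := (Complex.re_add_im _).symm
  have e2 : starRingEnd ℂ (v j) = ((v j).re : ℂ) - ((v j).im : ℂ) * Complex.I := by
    apply Complex.ext <;> simp
  rw [e2]
  nth_rewrite 3 [e1]
  rw [← Complex.coe_smul, ← Complex.coe_smul]
  match_scalars
  · ring
  · ring_nf; simp

theorem fderiv_apply_eq_sum (G : (Fin k → ℂ) → E) (z v : Fin k → ℂ) :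
    fderiv ℝ G z v = ∑ j, (v j • dz j G z + starRingEnd ℂ (v j) • dzc j G z) :=
  realLinear_apply_eq_sum (fderiv ℝ G z) v

/-- The differential is a combination of the derivatives in z_j and z_j^c, which are power series on
the same ball and hence continuous. -/
theorem HasZSumOn.contDiffOn [FiniteDimensional ℂ E] (h : HasZSumOn G C R) :
    ContDiffOn ℝ 1 G (Metric.ball 0 R) := by
  have hd : ∀ {G : (Fin k → ℂ) → E} {C : ZCoeff k E}, HasZSumOn G C R →
      DifferentiableOn ℝ G (Metric.ball 0 R) := fun h z hz =>
    (h.differentiableAt (mem_ball_zero_iff.1 hz)).differentiableWithinAt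
  rw [show (1 : WithTop ℕ∞) = 0 + 1 from rfl,
    contDiffOn_succ_iff_fderiv_of_isOpen Metric.isOpen_ball]
  refine ⟨hd h, by simp, contDiffOn_zero.2 (continuousOn_clm_apply.2 fun v => ?_)⟩
  simp only [fderiv_apply_eq_sum]
  exact continuousOn_finsetSum _ fun j _ =>
    ((hd (h.dz j)).continuousOn.const_smul _).add ((hd (h.dzc j)).continuousOn.const_smul _)

end Series

/-- The map i ↦ (φ i, i) spreads the family over the graph of φ in κ × ι, and summing along ι first
groups it by fibres. The regroupings by bidegree and by degree in z_n, z_n^c rest on this. -/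
theorem hasSum_fiberwise {ι κ E : Type*} [NormedAddCommGroup E] [CompleteSpace E] [DecidableEq κ]
    {g : ι → E} {a : E} (h : HasSum g a) (φ : ι → κ) :
    HasSum (fun d => ∑' i, if φ i = d then g i else 0) a := by
  have hinj : Function.Injective fun i => (φ i, i) := fun i j hij => (Prod.ext_iff.1 hij).2
  have h2 : HasSum (fun x : κ × ι => if φ x.2 = x.1 then g x.2 else 0) a := by
    refine (hinj.hasSum_iff ?_).1 (h.congr_fun fun i => ?_)
    · rintro ⟨d, i⟩ hx
      exact if_neg fun h => hx ⟨i, Prod.ext h rfl⟩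
    · simp
  exact h2.prod_fiberwise fun d => (h2.summable.prod_factor d).hasSum

/-! ### From real-analyticity to power series in z and z^c. -/

section Analytic

variable {m : ℕ} {E : Type*} [NormedAddCommGroup E] [NormedSpace ℂ E]

/-- The coordinates `z_j` and `z_j^c`, indexed by `(j, true)` and `(j, false)`. -/
def zOrConj (z : Fin m → ℂ) (s : Fin m × Bool) : ℂ :=
  if s.2 then z s.1 else starRingEnd ℂ (z s.1)

theorem norm_zOrConj_le (z : Fin m → ℂ) (s : Fin m × Bool) : ‖zOrConj z s‖ ≤ ‖z‖ := by
  rw [zOrConj]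
  split_ifs
  · exact norm_le_pi_norm z s.1
  · rw [RCLike.norm_conj]; exact norm_le_pi_norm z s.1

/-- Each slot is expanded in z_j and z_j^c. The bound does not grow with k, because a slot
contributes half of a sum of two terms of norm at most ‖P‖; the only cost is the number (2m)^k of
words. -/
theorem exists_multilinear_expansion (k : ℕ)
    (P : ContinuousMultilinearMap ℝ (fun _ : Fin k => Fin m → ℂ) E) :
    ∃ Q : (Fin k → Fin m × Bool) → E,
      (∀ z, P (fun _ => z) = ∑ c, (∏ i, zOrConj z (c i)) • Q c) ∧ ∀ c, ‖Q c‖ ≤ ‖P‖ := by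
  induction k with
  | zero =>
    refine ⟨fun _ => P 0, fun z => ?_, fun _ => ?_⟩
    · simp [Subsingleton.elim (fun _ : Fin 0 => z) 0]
    · simp
  | succ k ih =>
    let PS : Fin m × Bool → ContinuousMultilinearMap ℝ (fun _ : Fin k => Fin m → ℂ) E := fun s =>
      if s.2 then (1 / 2 : ℂ) • (P.curryLeft (Pi.single s.1 1) -
        Complex.I • P.curryLeft (Pi.single s.1 Complex.I))
      else (1 / 2 : ℂ) • (P.curryLeft (Pi.single s.1 1) +
        Complex.I • P.curryLeft (Pi.single s.1 Complex.I))
    have hn1 : ∀ j : Fin m, ‖P.curryLeft (Pi.single j 1)‖ ≤ ‖P‖ := fun j => by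
      have := P.curryLeft.le_opNorm (Pi.single j 1)
      rwa [ContinuousMultilinearMap.curryLeft_norm, Pi.norm_single, norm_one, mul_one] at this
    have hn2 : ∀ j : Fin m, ‖Complex.I • P.curryLeft (Pi.single j Complex.I)‖ ≤ ‖P‖ := fun j => by
      have := P.curryLeft.le_opNorm (Pi.single j Complex.I)
      rw [ContinuousMultilinearMap.curryLeft_norm, Pi.norm_single, Complex.norm_I, mul_one] at this
      rwa [norm_smul, Complex.norm_I, one_mul]
    have hPS : ∀ s, ‖PS s‖ ≤ ‖P‖ := by
      rintro ⟨j, b⟩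
      cases b
      · simp only [PS, Bool.false_eq_true, if_false]
        rw [norm_smul]
        have := (norm_add_le _ _).trans (add_le_add (hn1 j) (hn2 j))
        norm_num
        linarith
      · simp only [PS, if_true]
        rw [norm_smul]
        have := (norm_sub_le _ _).trans (add_le_add (hn1 j) (hn2 j))
        norm_num
        linarith
    choose Q hQ hQn using fun s => ih (PS s)
    refine ⟨fun c => Q (c 0) (Fin.tail c), fun z => ?_, fun c => (hQn _ _).trans (hPS _)⟩
    have h1 : P (fun _ => z) = ∑ s, zOrConj z s • PS s (fun _ => z) := by
      have h2 := realLinear_apply_eq_sum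
        ((ContinuousMultilinearMap.apply ℝ (fun _ : Fin k => Fin m → ℂ) E fun _ => z).comp
          P.curryLeft) z
      have h3 : (Fin.cons z (fun _ => z) : Fin (k + 1) → Fin m → ℂ) = fun _ => z := by
        funext i
        refine Fin.cases ?_ (fun _ => ?_) i <;> simp
      simp only [ContinuousLinearMap.comp_apply, ContinuousMultilinearMap.apply_apply,
        ContinuousMultilinearMap.curryLeft_apply] at h2
      rw [h3] at h2
      rw [h2, Fintype.sum_prod_type]
      refine Finset.sum_congr rfl fun j _ => ?_
      simp [zOrConj, PS]
    rw [h1]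
    conv_rhs => rw [← (Fin.consEquiv fun _ : Fin (k + 1) => Fin m × Bool).sum_comp,
      Fintype.sum_prod_type]
    refine Finset.sum_congr rfl fun s _ => ?_
    rw [hQ, Finset.smul_sum]
    refine Finset.sum_congr rfl fun c _ => ?_
    simp [Fin.consEquiv, Fin.prod_univ_succ, smul_smul]

theorem prod_zOrConj {k : ℕ} (z : Fin m → ℂ) (c : Fin k → Fin m × Bool) :
    ∏ i, zOrConj z (c i) =
      zMonomial (fun j => (Finset.univ.filter fun i => c i = (j, true)).card)
        (fun j => (Finset.univ.filter fun i => c i = (j, false)).card) z := by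
  rw [← Finset.prod_fiberwise Finset.univ c, Fintype.prod_prod_type, zMonomial]
  refine Finset.prod_congr rfl fun j _ => ?_
  rw [Fintype.prod_bool]
  congr 1
  · exact (Finset.prod_congr rfl fun i hi =>
      congrArg (zOrConj z) (Finset.mem_filter.1 hi).2).trans (Finset.prod_const _)
  · exact (Finset.prod_congr rfl fun i hi =>
      congrArg (zOrConj z) (Finset.mem_filter.1 hi).2).trans (Finset.prod_const _)

theorem _root_.AnalyticAt.exists_hasZSeries [CompleteSpace E] {F : (Fin m → ℂ) → E}
    (hF : AnalyticAt ℝ F 0) : ∃ C, HasZSeries F C := by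
  obtain ⟨p, r, hp⟩ := hF
  choose Q hQ hQn using fun k => exists_multilinear_expansion k (p k)
  let φ : (Σ k, (Fin k → Fin m × Bool)) → (Fin m → ℕ) × (Fin m → ℕ) := fun x =>
    (fun j => (Finset.univ.filter fun i => x.2 i = (j, true)).card,
      fun j => (Finset.univ.filter fun i => x.2 i = (j, false)).card)
  refine ⟨fun α β => ∑' x, if φ x = (α, β) then Q x.1 x.2 else 0, hasZSeries_iff.2 ?_⟩
  obtain ⟨ρ, hρ0, hρ⟩ := ENNReal.lt_iff_exists_nnreal_btwn.1 hp.r_pos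
  have hρ0' : (0 : ℝ) < ρ := by exact_mod_cast hρ0
  have hsum : Summable fun k => ‖p k‖ * (ρ : ℝ) ^ k :=
    p.summable_norm_mul_pow (hρ.trans_le hp.r_le)
  -- The (2m)^k words of degree k require 2m‖z‖ ≤ ρ; the extra 1 keeps the denominator positive for
  -- m = 0 and also gives ‖z‖ ≤ ρ.
  refine ⟨ρ / (2 * m + 1), by positivity, fun z hz => ?_⟩
  have hz1 : (2 * m + 1) * ‖z‖ ≤ ρ := by
    rw [lt_div_iff₀ (by positivity)] at hz
    linarith
  have hz2 : 2 * m * ‖z‖ ≤ ρ := by linarith [norm_nonneg z]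
  have hz3 : ‖z‖ ≤ ρ := by nlinarith [norm_nonneg z, (Nat.cast_nonneg m : (0 : ℝ) ≤ m)]
  have hs : Summable fun x : Σ k, (Fin k → Fin m × Bool) =>
      (∏ i, zOrConj z (x.2 i)) • Q x.1 x.2 := by
    refine Summable.of_norm ?_
    rw [summable_sigma_of_nonneg fun _ => norm_nonneg _]
    refine ⟨fun k => (hasSum_fintype _).summable, ?_⟩
    refine Summable.of_nonneg_of_le (fun k => tsum_nonneg fun _ => norm_nonneg _) (fun k => ?_) hsum
    rw [tsum_fintype]
    have hc : ∀ c : Fin k → Fin m × Bool, ‖(∏ i, zOrConj z (c i)) • Q k c‖ ≤ ‖z‖ ^ k * ‖p k‖ := by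
      intro c
      rw [norm_smul, norm_prod]
      refine mul_le_mul ?_ (hQn k c) (norm_nonneg _) (by positivity)
      refine (Finset.prod_le_prod (fun _ _ => norm_nonneg _)
        fun i _ => norm_zOrConj_le z (c i)).trans_eq ?_
      simp
    refine (Finset.sum_le_sum fun c _ => hc c).trans ?_
    rw [Finset.sum_const, nsmul_eq_mul]
    simp only [Finset.card_univ, Fintype.card_pi, Fintype.card_prod, Fintype.card_fin,
      Fintype.card_bool, Finset.prod_const, Nat.cast_pow, Nat.cast_mul, Nat.cast_ofNat]
    rw [← mul_assoc, ← mul_pow, mul_comm, mul_comm (m : ℝ)]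
    exact mul_le_mul_of_nonneg_left (pow_le_pow_left₀ (by positivity) hz2 k) (norm_nonneg _)
  have h1 : HasSum (fun x : Σ k, (Fin k → Fin m × Bool) =>
      (∏ i, zOrConj z (x.2 i)) • Q x.1 x.2) (F z) := by
    have h2 := hs.hasSum.sigma fun k => hasSum_fintype _
    have h3 := hp.hasSum (y := z) (by
      rw [Metric.mem_eball, edist_zero_right]
      refine lt_of_le_of_lt ?_ hρ
      rw [← ofReal_norm, ← ENNReal.ofReal_coe_nnreal]
      exact ENNReal.ofReal_le_ofReal hz3)
    simp only [← hQ] at h2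
    rw [zero_add] at h3
    rw [← h2.unique h3]
    exact hs.hasSum
  refine (hasSum_fiberwise h1 φ).congr_fun fun γ => ?_
  rw [← tsum_const_smul'']
  refine tsum_congr fun x => ?_
  split_ifs with hx
  · obtain rfl : φ x = γ := hx
    rw [prod_zOrConj]
  · rw [smul_zero]

end Analytic

/-! ### The abstract operator algebra behind the extension. -/

/-- The relations between `d = ∂̃_z`, `δ = ∂̃_z^†` and the left multiplications `F`, `F'` by `f_n`,
`f_n^†`. -/
structure CKRel {R : Type*} [Ring R] (d δ F F' : R) : Prop where
  d_sq : d * d = 0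
  δ_sq : δ * δ = 0
  F_sq : F * F = 0
  F'_sq : F' * F' = 0
  F_F' : F * F' + F' * F = 1
  F_d : F * d = -(d * F)
  F'_d : F' * d = -(d * F')
  F_δ : F * δ = -(δ * F)
  F'_δ : F' * δ = -(δ * F')

namespace CKRel

section Ring

variable {R : Type*} [Ring R] {d δ F F' : R}

/-- The relations are symmetric under exchanging both pairs, so each result for d yields its mirror
image for δ. -/
theorem swap (h : CKRel d δ F F') : CKRel δ d F' F :=
  ⟨h.δ_sq, h.d_sq, h.F'_sq, h.F_sq, (add_comm _ _).trans h.F_F', h.F'_δ, h.F_δ, h.F'_d, h.F_d⟩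

theorem commute_d (h : CKRel d δ F F') : Commute (-(d * δ + δ * d)) d := by
  refine Commute.neg_left ?_
  rw [commute_iff_eq, mul_add, add_mul, ← mul_assoc d d, h.d_sq, mul_assoc δ d, h.d_sq]
  simp [mul_assoc]

theorem commute_δ (h : CKRel d δ F F') : Commute (-(d * δ + δ * d)) δ := by
  rw [add_comm]; exact h.swap.commute_d

theorem commute_F (h : CKRel d δ F F') : Commute (-(d * δ + δ * d)) F := by
  refine Commute.neg_left ?_
  have e1 : F * (d * δ) = d * δ * F := by
    rw [← mul_assoc, h.F_d, neg_mul, mul_assoc, h.F_δ, mul_neg, neg_neg, mul_assoc]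
  have e2 : F * (δ * d) = δ * d * F := by
    rw [← mul_assoc, h.F_δ, neg_mul, mul_assoc, h.F_d, mul_neg, neg_neg, mul_assoc]
  rw [commute_iff_eq, mul_add, add_mul, e1, e2]

theorem commute_F' (h : CKRel d δ F F') : Commute (-(d * δ + δ * d)) F' := by
  rw [add_comm]; exact h.swap.commute_F

theorem A_sq (h : CKRel d δ F F') : d * F * (d * F) = 0 := by
  rw [mul_assoc, ← mul_assoc F, h.F_d, neg_mul, mul_assoc d F F, h.F_sq]
  simp

theorem F'_B (h : CKRel d δ F F') : F' * (δ * F') = 0 := by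
  rw [← mul_assoc, h.F'_δ, neg_mul, mul_assoc, h.F'_sq, mul_zero, neg_zero]

theorem d_A (h : CKRel d δ F F') : d * (d * F) = 0 := by
  rw [← mul_assoc, h.d_sq, zero_mul]

end Ring

section Module

variable {V : Type*} [AddCommGroup V] [Module ℂ V] {d δ F F' : Module.End ℂ V} {X : V}

/-- Split X = F F' X + F' F X: the hypothesis kills d of the first part, and d anticommutes with F'
on the second. -/
theorem d_apply (h : CKRel d δ F F') (h1 : d (F (F' X)) = 0) : d X = -F' ((d * F) X) := by
  have e : (F * F' + F' * F) X = X := by rw [h.F_F']; rfl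
  have e2 : F' ((d * F) X) = -(d * F') (F X) := by
    rw [← LinearMap.neg_apply, ← h.F'_d]; rfl
  conv_lhs => rw [← e]
  rw [e2]
  simp [h1]

theorem d_F'_apply (h : CKRel d δ F F') (h1 : d (F (F' X)) = 0) : d (F' X) = 0 := by
  have e2 : F' (d (F (F' X))) = -(d (F' (F (F' X)))) := by
    change (F' * d) _ = _; rw [h.F'_d]; rfl
  have e : (F * F' + F' * F) (F' X) = F' X := by rw [h.F_F']; rfl
  have e3 : F' (F' X) = 0 := by change (F' * F') X = 0; rw [h.F'_sq]; rfl
  rw [h1, map_zero] at e2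
  rw [← e]
  simp only [LinearMap.add_apply, Module.End.mul_apply, e3, map_zero, zero_add]
  exact neg_eq_zero.1 e2.symm

theorem d_B_apply (h : CKRel d δ F F') (h1 : d (F (F' X)) = 0) :
    d ((δ * F') X) + F' ((-(d * δ + δ * d)) X) = 0 := by
  have e := LinearMap.congr_fun h.commute_F'.eq X
  rw [Module.End.mul_apply, Module.End.mul_apply] at e
  rw [← e]
  simp [h.d_F'_apply h1]

/-- Anticommuting gives AB = -dδ F F' and BA = -δd F' F. Expanding L X along X = F F' X + F' F X
yields these two terms and two others, killed by the two hypotheses. -/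
theorem AB_add_BA_apply (h : CKRel d δ F F') (h1 : d (F (F' X)) = 0) (h2 : δ (F' (F X)) = 0) :
    (d * F) ((δ * F') X) + (δ * F') ((d * F) X) = (-(d * δ + δ * d)) X := by
  have e1 : F (δ (F' X)) = -(δ (F (F' X))) := by
    change (F * δ) _ = _; rw [h.F_δ]; rfl
  have e2 : F' (d (F X)) = -(d (F' (F X))) := by
    change (F' * d) _ = _; rw [h.F'_d]; rfl
  have e : (F * F' + F' * F) X = X := by rw [h.F_F']; rfl
  conv_rhs => rw [← e]
  simp [e1, e2, h1, h2, add_comm]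

theorem apply_L_pow {T L : Module.End ℂ V} (h : Commute L T) (s : ℕ) (Y : V) :
    T ((L ^ s) Y) = (L ^ s) (T Y) :=
  (LinearMap.congr_fun (h.pow_left s).eq Y).symm

end Module

end CKRel

/-! ### Collapse of the powers and the recursion for the coefficients. -/

section Phi

variable {V : Type*} [AddCommGroup V] [Module ℂ V]

/-- The coefficient of `w^s (w^c)^t` in `∑_k (w A + w^c B)^k / (⌊k/2⌋! ⌊(k+1)/2⌋!)`, when
`A² = B² = 0` and `A B + B A = L`. -/
def ckCoeff (A B L : Module.End ℂ V) (s t : ℕ) : Module.End ℂ V :=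
  ((s.factorial * t.factorial : ℕ) : ℂ)⁻¹ •
    if s = t then L ^ s else if s = t + 1 then L ^ t * A else if t = s + 1 then L ^ s * B else 0

variable {A B L : Module.End ℂ V} {X : V}

theorem ck_sq_apply (hA : A * A = 0) (hB : B * B = 0) (w w' : ℂ) (Y : V) :
    (w • A + w' • B) ((w • A + w' • B) Y) = (w * w') • (A (B Y) + B (A Y)) := by
  have hA' : A (A Y) = 0 := LinearMap.congr_fun hA Y
  have hB' : B (B Y) = 0 := LinearMap.congr_fun hB Y
  simp only [LinearMap.add_apply, LinearMap.smul_apply, map_add, map_smul, hA', hB', smul_zero,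
    zero_add, add_zero, smul_smul, smul_add, mul_comm w' w]
  rw [add_comm]

/-- The square of wA + w'B is ww'(AB + BA). That AB + BA acts as L is known only at X, but it
carries over to L^s X because L commutes with A and B. -/
theorem ck_pow_even (hA : A * A = 0) (hB : B * B = 0) (hLA : Commute L A) (hLB : Commute L B)
    (hX : A (B X) + B (A X) = L X) (w w' : ℂ) (s : ℕ) :
    ((w • A + w' • B) ^ (2 * s)) X = (w * w') ^ s • (L ^ s) X := by
  induction s with
  | zero => simp
  | succ s ih =>
    rw [show 2 * (s + 1) = 2 + 2 * s by ring, pow_add, Module.End.mul_apply, ih, map_smul, pow_two,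
      Module.End.mul_apply, ck_sq_apply hA hB, CKRel.apply_L_pow hLB, CKRel.apply_L_pow hLA,
      CKRel.apply_L_pow hLA, CKRel.apply_L_pow hLB, ← map_add, hX, smul_smul, ← pow_succ,
      pow_succ L, Module.End.mul_apply]

theorem ck_pow_odd (hA : A * A = 0) (hB : B * B = 0) (hLA : Commute L A) (hLB : Commute L B)
    (hX : A (B X) + B (A X) = L X) (w w' : ℂ) (s : ℕ) :
    ((w • A + w' • B) ^ (2 * s + 1)) X =
      (w * w') ^ s • (w • (L ^ s) (A X) + w' • (L ^ s) (B X)) := by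
  rw [pow_succ', Module.End.mul_apply, ck_pow_even hA hB hLA hLB hX, map_smul]
  simp [CKRel.apply_L_pow hLB, CKRel.apply_L_pow hLA]

/-- Only exponents with |s - t| ≤ 1 survive, and for these s! t! = ⌊k/2⌋! ⌊(k+1)/2⌋!; this explains
the normalisation. -/
theorem ck_pow_eq_sum (hA : A * A = 0) (hB : B * B = 0) (hLA : Commute L A) (hLB : Commute L B)
    (hX : A (B X) + B (A X) = L X) (w w' : ℂ) (k : ℕ) :
    (((k / 2).factorial * ((k + 1) / 2).factorial : ℕ) : ℂ)⁻¹ • ((w • A + w' • B) ^ k) X =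
      ∑ x ∈ Finset.HasAntidiagonal.antidiagonal k, (w ^ x.1 * w' ^ x.2) • ckCoeff A B L x.1 x.2 X := by
  obtain ⟨s, rfl | rfl⟩ := Nat.even_or_odd' k
  · rw [ck_pow_even hA hB hLA hLB hX, Finset.sum_eq_single (s, s)]
    · have h1 : 2 * s / 2 = s := by omega
      have h2 : (2 * s + 1) / 2 = s := by omega
      simp only [h1, h2, ckCoeff, if_true, LinearMap.smul_apply, mul_pow]
      rw [smul_comm]
    · rintro ⟨a, b⟩ hab hne
      rw [Finset.HasAntidiagonal.mem_antidiagonal] at hab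
      have h1 : ¬ a = b := fun h => hne (by subst h; ext <;> simp <;> simp at hab <;> omega)
      have h2 : ¬ a = b + 1 := fun h => by simp at hab; omega
      have h3 : ¬ b = a + 1 := fun h => by simp at hab; omega
      simp [ckCoeff, h1, h2, h3]
    · intro h; simp at h; omega
  · rw [ck_pow_odd hA hB hLA hLB hX,
      Finset.sum_eq_add_of_mem (s + 1, s) (s, s + 1) (by simp; omega) (by simp; omega) (by simp)]
    · have h1 : (2 * s + 1) / 2 = s := by omega
      have h2 : (2 * s + 1 + 1) / 2 = s + 1 := by omega
      simp only [h1, h2, ckCoeff, if_true, LinearMap.smul_apply, mul_pow, Nat.succ_ne_self, if_false,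
        show ¬ s = s + 1 + 1 by omega, show ¬ s = s + 1 by omega, Module.End.mul_apply,
        mul_comm (s + 1).factorial]
      simp only [smul_add, smul_smul]
      congr 2 <;> ring
    · rintro ⟨a, b⟩ hab hne
      rw [Finset.HasAntidiagonal.mem_antidiagonal] at hab
      have h1 : ¬ a = b := fun h => by simp at hab; omega
      have h2 : ¬ a = b + 1 := fun h => hne.1 (by ext <;> simp <;> simp at hab <;> omega)
      have h3 : ¬ b = a + 1 := fun h => hne.2 (by ext <;> simp <;> simp at hab <;> omega)
      simp [ckCoeff, h1, h2, h3]

/-- This is the equation ∂_z G = 0 at w^s (w^c)^t. The factor s + 1 is absorbed by the factorial,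
and powers of L pass through d and F'. There remain dX = -F'AX for s = t, dA = 0 for s = t + 1, dBX
= -F'LX for t = s + 1, and F'B = 0 for t = s + 2. -/
theorem CKRel.d_ckCoeff {d δ F F' : Module.End ℂ V} (h : CKRel d δ F F') (h1 : d (F (F' X)) = 0)
    (s t : ℕ) :
    d (ckCoeff (d * F) (δ * F') (-(d * δ + δ * d)) s t X) +
      F' (((s + 1 : ℕ) : ℂ) • ckCoeff (d * F) (δ * F') (-(d * δ + δ * d)) (s + 1) t X) = 0 := by
  set L := -(d * δ + δ * d) with hL
  have hs : ((s + 1 : ℕ) : ℂ) * (((s + 1).factorial * t.factorial : ℕ) : ℂ)⁻¹ =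
      ((s.factorial * t.factorial : ℕ) : ℂ)⁻¹ := by
    rw [Nat.factorial_succ, mul_assoc, Nat.cast_mul, mul_inv, ← mul_assoc, mul_inv_cancel₀
      (Nat.cast_ne_zero.2 (Nat.succ_ne_zero s)), one_mul]
  have hd := fun s Y => CKRel.apply_L_pow h.commute_d s Y
  have hF' := fun s Y => CKRel.apply_L_pow h.commute_F' s Y
  rw [← hL] at hd hF'
  simp only [ckCoeff, LinearMap.smul_apply, map_smul, smul_smul, hs]
  rw [← smul_add]
  convert smul_zero _
  rcases eq_or_ne s t with rfl | h0
  · simp only [if_true, Nat.succ_ne_self, if_false]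
    rw [hd, Module.End.mul_apply, hF', ← map_add, h.d_apply h1, neg_add_cancel, map_zero]
  · rcases eq_or_ne s (t + 1) with rfl | h2
    · simp only [Nat.succ_ne_self, if_false, if_true, show ¬ t + 1 + 1 = t by omega,
        show ¬ t + 1 + 1 = t + 1 by omega, show ¬ t = t + 1 + 1 + 1 by omega]
      rw [Module.End.mul_apply, hd, ← Module.End.mul_apply d, h.d_A]
      simp
    · rcases eq_or_ne t (s + 1) with rfl | h3
      · simp only [if_true, h0, h2, if_false]
        rw [pow_succ, Module.End.mul_apply (L ^ s) L, hF', Module.End.mul_apply (L ^ s), hd,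
          ← map_add, h.d_B_apply h1, map_zero]
      · simp only [h0, h2, h3, if_false, h3.symm, show ¬ s + 1 = t + 1 by omega]
        split_ifs with h4
        · rw [Module.End.mul_apply, hF', ← Module.End.mul_apply F', h.F'_B]
          simp
        · simp

theorem ckCoeff_swap (s t : ℕ) : ckCoeff A B L s t = ckCoeff B A L t s := by
  rw [ckCoeff, ckCoeff, mul_comm]
  congr 1
  split_ifs <;> first | rfl | omega | (subst_vars; rfl)

theorem CKRel.δ_ckCoeff {d δ F F' : Module.End ℂ V} (h : CKRel d δ F F') (h2 : δ (F' (F X)) = 0)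
    (s t : ℕ) :
    δ (ckCoeff (d * F) (δ * F') (-(d * δ + δ * d)) s t X) +
      F (((t + 1 : ℕ) : ℂ) • ckCoeff (d * F) (δ * F') (-(d * δ + δ * d)) s (t + 1) X) = 0 := by
  rw [ckCoeff_swap s, ckCoeff_swap s, add_comm (d * δ)]
  exact h.swap.d_ckCoeff h2 t s

end Phi

/-! ### The Dirac operators acting on coefficient arrays. -/

section Operators

variable {k n m : ℕ}

/-- Left multiplication of all coefficients by a Clifford number. -/
def coeffMulLeft (a : Cl n) : Module.End ℂ (ZCoeff k (Cl n)) := coeffMap (LinearMap.mulLeft ℂ a)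

/-- The operator `∑_j c_j ∂_{z_j}` on power series. -/
def coeffDirac (c : Fin k → Cl n) : Module.End ℂ (ZCoeff k (Cl n)) :=
  ∑ j, coeffMulLeft (c j) * coeffDz j

/-- The operator `∑_j c_j ∂_{z_j^c}` on power series. -/
def coeffDiracc (c : Fin k → Cl n) : Module.End ℂ (ZCoeff k (Cl n)) :=
  ∑ j, coeffMulLeft (c j) * coeffDzc j

theorem coeffMulLeft_apply (a : Cl n) (X : ZCoeff k (Cl n)) (α β : Fin k → ℕ) :
    coeffMulLeft a X α β = a * X α β := rfl

theorem coeffMulLeft_mul (a b : Cl n) :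
    (coeffMulLeft a * coeffMulLeft b : Module.End ℂ (ZCoeff k (Cl n))) = coeffMulLeft (a * b) := by
  ext X α β
  exact (mul_assoc _ _ _).symm

theorem coeffMulLeft_add (a b : Cl n) :
    (coeffMulLeft (a + b) : Module.End ℂ (ZCoeff k (Cl n))) = coeffMulLeft a + coeffMulLeft b := by
  ext X α β
  exact add_mul _ _ _

theorem coeffMulLeft_neg_mul (a : Cl n) (S : Module.End ℂ (ZCoeff k (Cl n))) :
    coeffMulLeft (-a) * S = -(coeffMulLeft a * S) := by
  ext X α β
  exact neg_mul _ _

theorem coeffMulLeft_zero : (coeffMulLeft (0 : Cl n) : Module.End ℂ (ZCoeff k (Cl n))) = 0 := by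
  ext X α β
  exact zero_mul _

theorem coeffMulLeft_one : (coeffMulLeft (1 : Cl n) : Module.End ℂ (ZCoeff k (Cl n))) = 1 := by
  ext X α β
  exact one_mul _

theorem coeffDz_mulLeft (j : Fin k) (a : Cl n) :
    (coeffDz j * coeffMulLeft a : Module.End ℂ (ZCoeff k (Cl n))) = coeffMulLeft a * coeffDz j := by
  ext X α β
  simp only [Module.End.mul_apply, coeffDz_apply, coeffMulLeft_apply, mul_smul_comm]

theorem coeffDzc_mulLeft (j : Fin k) (a : Cl n) :
    (coeffDzc j * coeffMulLeft a : Module.End ℂ (ZCoeff k (Cl n))) =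
      coeffMulLeft a * coeffDzc j := by
  ext X α β
  simp only [Module.End.mul_apply, coeffDzc_apply, coeffMulLeft_apply, mul_smul_comm]

theorem coeffDz_comm (i j : Fin k) :
    (coeffDz i * coeffDz j : Module.End ℂ (ZCoeff k (Cl n))) = coeffDz j * coeffDz i := by
  rcases eq_or_ne i j with rfl | h
  · rfl
  ext X α β
  simp only [Module.End.mul_apply, coeffDz_apply, smul_smul, Pi.add_apply, Pi.single_eq_of_ne h,
    Pi.single_eq_of_ne h.symm, add_zero]
  rw [add_right_comm, mul_comm]

theorem coeffDzc_comm (i j : Fin k) :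
    (coeffDzc i * coeffDzc j : Module.End ℂ (ZCoeff k (Cl n))) = coeffDzc j * coeffDzc i := by
  rcases eq_or_ne i j with rfl | h
  · rfl
  ext X α β
  simp only [Module.End.mul_apply, coeffDzc_apply, smul_smul, Pi.add_apply, Pi.single_eq_of_ne h,
    Pi.single_eq_of_ne h.symm, add_zero]
  rw [add_right_comm, mul_comm]

theorem coeffDz_dzc_comm (i j : Fin k) :
    (coeffDz i * coeffDzc j : Module.End ℂ (ZCoeff k (Cl n))) = coeffDzc j * coeffDz i := by
  ext X α β
  simp only [Module.End.mul_apply, coeffDz_apply, coeffDzc_apply]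
  rw [smul_comm]

theorem mulLeft_mul_mulLeft_mul (a b : Cl n) (S T : Module.End ℂ (ZCoeff k (Cl n)))
    (hS : S * coeffMulLeft b = coeffMulLeft b * S) :
    coeffMulLeft a * S * (coeffMulLeft b * T) = coeffMulLeft (a * b) * (S * T) := by
  rw [← coeffMulLeft_mul, mul_assoc, ← mul_assoc S, hS]
  simp only [mul_assoc]

theorem sum_sum_eq_zero_of_antisymm {ι V : Type*} [Fintype ι] [AddCommGroup V] [Module ℂ V]
    (t : ι → ι → V) (h : ∀ i j, t i j = -t j i) : ∑ i, ∑ j, t i j = 0 := by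
  refine eq_zero_of_eq_neg_self ?_
  conv_lhs => rw [Finset.sum_comm]
  rw [← Finset.sum_neg_distrib]
  refine Finset.sum_congr rfl fun i _ => ?_
  rw [← Finset.sum_neg_distrib]
  exact Finset.sum_congr rfl fun j _ => h j i

theorem coeffDirac_sq (c : Fin k → Cl n) (hc : ∀ i j, c i * c j = -(c j * c i)) :
    coeffDirac c * coeffDirac c = 0 := by
  rw [coeffDirac, Finset.sum_mul_sum]
  refine sum_sum_eq_zero_of_antisymm _ fun i j => ?_
  rw [mulLeft_mul_mulLeft_mul _ _ _ _ (coeffDz_mulLeft _ _),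
    mulLeft_mul_mulLeft_mul _ _ _ _ (coeffDz_mulLeft _ _), hc, coeffMulLeft_neg_mul,
    coeffDz_comm]

theorem coeffDiracc_sq (c : Fin k → Cl n) (hc : ∀ i j, c i * c j = -(c j * c i)) :
    coeffDiracc c * coeffDiracc c = 0 := by
  rw [coeffDiracc, Finset.sum_mul_sum]
  refine sum_sum_eq_zero_of_antisymm _ fun i j => ?_
  rw [mulLeft_mul_mulLeft_mul _ _ _ _ (coeffDzc_mulLeft _ _),
    mulLeft_mul_mulLeft_mul _ _ _ _ (coeffDzc_mulLeft _ _), hc, coeffMulLeft_neg_mul,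
    coeffDzc_comm]

/-- The derivatives commute, so only the anticommutators of the Clifford factors matter and the
off-diagonal terms cancel. With n - 1 Witt pairs this computes L; with all n of them it makes null
solutions harmonic. -/
theorem coeffDirac_mul_coeffDiracc_add (c c' : Fin k → Cl n)
    (hc : ∀ i j, c i * c' j + c' j * c i = if i = j then 1 else 0) :
    coeffDirac c * coeffDiracc c' + coeffDiracc c' * coeffDirac c =
      ∑ j, (coeffDz j * coeffDzc j : Module.End ℂ (ZCoeff k (Cl n))) := by
  rw [coeffDirac, coeffDiracc, Finset.sum_mul_sum, Finset.sum_mul_sum, Finset.sum_comm (γ := Fin k),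
    ← Finset.sum_add_distrib]
  refine Finset.sum_congr rfl fun j _ => ?_
  rw [← Finset.sum_add_distrib, Finset.sum_eq_single j]
  · rw [mulLeft_mul_mulLeft_mul _ _ _ _ (coeffDz_mulLeft _ _),
      mulLeft_mul_mulLeft_mul _ _ _ _ (coeffDzc_mulLeft _ _), ← coeffDz_dzc_comm, ← add_mul,
      ← coeffMulLeft_add, hc, if_pos rfl, coeffMulLeft_one, one_mul]
  · intro i _ hi
    rw [mulLeft_mul_mulLeft_mul _ _ _ _ (coeffDz_mulLeft _ _),
      mulLeft_mul_mulLeft_mul _ _ _ _ (coeffDzc_mulLeft _ _), ← coeffDz_dzc_comm, ← add_mul,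
      ← coeffMulLeft_add, hc, if_neg hi, coeffMulLeft_zero, zero_mul]
  · simp

theorem coeffMulLeft_mul_coeffDirac (a : Cl n) (c : Fin k → Cl n)
    (hc : ∀ j, a * c j = -(c j * a)) :
    coeffMulLeft a * coeffDirac c = -(coeffDirac c * coeffMulLeft a) := by
  rw [coeffDirac, Finset.mul_sum, Finset.sum_mul, ← Finset.sum_neg_distrib]
  refine Finset.sum_congr rfl fun j _ => ?_
  rw [← mul_assoc, coeffMulLeft_mul, mul_assoc, coeffDz_mulLeft, ← mul_assoc, coeffMulLeft_mul, hc,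
    coeffMulLeft_neg_mul]

theorem coeffMulLeft_mul_coeffDiracc (a : Cl n) (c : Fin k → Cl n)
    (hc : ∀ j, a * c j = -(c j * a)) :
    coeffMulLeft a * coeffDiracc c = -(coeffDiracc c * coeffMulLeft a) := by
  rw [coeffDiracc, Finset.mul_sum, Finset.sum_mul, ← Finset.sum_neg_distrib]
  refine Finset.sum_congr rfl fun j _ => ?_
  rw [← mul_assoc, coeffMulLeft_mul, mul_assoc, coeffDzc_mulLeft, ← mul_assoc, coeffMulLeft_mul, hc,
    coeffMulLeft_neg_mul]

/-- `∂̃_z` on power series in `z_1, …, z_{n-1}`. -/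
def coeffTildeZ (m : ℕ) : Module.End ℂ (ZCoeff m (Cl (m + 1))) :=
  coeffDirac fun j => fd j.castSucc

/-- `∂̃_z^†` on power series in `z_1, …, z_{n-1}`. -/
def coeffTildeZd (m : ℕ) : Module.End ℂ (ZCoeff m (Cl (m + 1))) :=
  coeffDiracc fun j => f j.castSucc

/-- Left multiplication by `f_n` on power series in `z_1, …, z_{n-1}`. -/
def coeffF (m : ℕ) : Module.End ℂ (ZCoeff m (Cl (m + 1))) := coeffMulLeft (f (Fin.last m))

/-- Left multiplication by `f_n^†` on power series in `z_1, …, z_{n-1}`. -/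
def coeffFd (m : ℕ) : Module.End ℂ (ZCoeff m (Cl (m + 1))) := coeffMulLeft (fd (Fin.last m))

theorem ckRel (m : ℕ) : CKRel (coeffTildeZ m) (coeffTildeZd m) (coeffF m) (coeffFd m) where
  d_sq := coeffDirac_sq _ fun _ _ => fd_mul_fd _ _
  δ_sq := coeffDiracc_sq _ fun _ _ => f_mul_f _ _
  F_sq := by rw [coeffF, coeffMulLeft_mul, f_mul_self, coeffMulLeft_zero]
  F'_sq := by rw [coeffFd, coeffMulLeft_mul, fd_mul_self, coeffMulLeft_zero]
  F_F' := by
    rw [coeffF, coeffFd, coeffMulLeft_mul, coeffMulLeft_mul, ← coeffMulLeft_add, f_mul_fd_add_swap,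
      if_pos rfl, coeffMulLeft_one]
  F_d := coeffMulLeft_mul_coeffDirac _ _ fun j => f_mul_fd_of_ne (Fin.castSucc_lt_last j).ne'
  F'_d := coeffMulLeft_mul_coeffDirac _ _ fun _ => fd_mul_fd _ _
  F_δ := coeffMulLeft_mul_coeffDiracc _ _ fun _ => f_mul_f _ _
  F'_δ := coeffMulLeft_mul_coeffDiracc _ _ fun j => by
    rw [f_mul_fd_of_ne (Fin.castSucc_lt_last j).ne, neg_neg]

/-- The coefficients of `∂̃_z f_n`. -/
def coeffA (m : ℕ) : Module.End ℂ (ZCoeff m (Cl (m + 1))) := coeffTildeZ m * coeffF m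

/-- The coefficients of `∂̃_z^† f_n^†`. -/
def coeffB (m : ℕ) : Module.End ℂ (ZCoeff m (Cl (m + 1))) := coeffTildeZd m * coeffFd m

/-- The coefficients of `-(∂̃_z ∂̃_z^† + ∂̃_z^† ∂̃_z)`. -/
def coeffL (m : ℕ) : Module.End ℂ (ZCoeff m (Cl (m + 1))) :=
  -(coeffTildeZ m * coeffTildeZd m + coeffTildeZd m * coeffTildeZ m)

theorem coeffL_eq (m : ℕ) : coeffL m = -∑ j, coeffDz j * coeffDzc j := by
  rw [coeffL, coeffTildeZ, coeffTildeZd, coeffDirac_mul_coeffDiracc_add]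
  intro i j
  refine (add_comm _ _).trans ((f_mul_fd_add_swap _ _).trans ?_)
  simp [eq_comm]

/-- The coefficients of `z_n^s (z_n^c)^t` in the extension series. -/
abbrev ckPhi (m s t : ℕ) : Module.End ℂ (ZCoeff m (Cl (m + 1))) :=
  ckCoeff (coeffA m) (coeffB m) (coeffL m) s t

/-- The power series in `m + 1` variables in which `z_n^s (z_n^c)^t` has the coefficient `φ s t`. -/
def coeffExtend {E : Type*} (φ : ℕ → ℕ → ZCoeff m E) : ZCoeff (m + 1) E := fun α β =>
  φ (α (Fin.last m)) (β (Fin.last m)) (fun j => α j.castSucc) (fun j => β j.castSucc)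

/-- The coefficients of the extension series. -/
def ckSeries (m : ℕ) (X : ZCoeff m (Cl (m + 1))) : ZCoeff (m + 1) (Cl (m + 1)) :=
  coeffExtend fun s t => ckPhi m s t X

section Extend

variable {E : Type*} [NormedAddCommGroup E] [NormedSpace ℂ E] (φ : ℕ → ℕ → ZCoeff m E)

theorem add_single_castSucc (α : Fin (m + 1) → ℕ) (j : Fin m) :
    (fun i : Fin m => (α + Pi.single j.castSucc 1 : Fin (m + 1) → ℕ) i.castSucc) =
      (fun i : Fin m => α i.castSucc) + Pi.single j 1 := by
  ext i
  rcases eq_or_ne i j with rfl | h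
  · simp
  · simp [h]

theorem add_single_last (α : Fin (m + 1) → ℕ) :
    (fun i : Fin m => (α + Pi.single (Fin.last m) 1 : Fin (m + 1) → ℕ) i.castSucc) =
      fun i : Fin m => α i.castSucc := by
  ext i
  simp

theorem coeffDz_castSucc_extend (j : Fin m) :
    coeffDz j.castSucc (coeffExtend φ) = coeffExtend fun s t => coeffDz j (φ s t) := by
  ext α β
  simp only [coeffDz_apply, coeffExtend, add_single_castSucc]
  simp

theorem coeffDzc_castSucc_extend (j : Fin m) :
    coeffDzc j.castSucc (coeffExtend φ) = coeffExtend fun s t => coeffDzc j (φ s t) := by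
  ext α β
  simp only [coeffDzc_apply, coeffExtend, add_single_castSucc]
  simp

theorem coeffDz_last_extend :
    coeffDz (Fin.last m) (coeffExtend φ) =
      coeffExtend fun s t => ((s + 1 : ℕ) : ℂ) • φ (s + 1) t := by
  ext α β
  simp only [coeffDz_apply, coeffExtend, add_single_last]
  simp

theorem coeffDzc_last_extend :
    coeffDzc (Fin.last m) (coeffExtend φ) =
      coeffExtend fun s t => ((t + 1 : ℕ) : ℂ) • φ s (t + 1) := by
  ext α β
  simp only [coeffDzc_apply, coeffExtend, add_single_last]
  simp

end Extend

theorem coeffDirac_apply (c : Fin k → Cl n) (X : ZCoeff k (Cl n)) :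
    coeffDirac c X = ∑ j, coeffMulLeft (c j) (coeffDz j X) := by
  simp [coeffDirac, LinearMap.sum_apply]

theorem coeffDiracc_apply (c : Fin k → Cl n) (X : ZCoeff k (Cl n)) :
    coeffDiracc c X = ∑ j, coeffMulLeft (c j) (coeffDzc j X) := by
  simp [coeffDiracc, LinearMap.sum_apply]

/-- The splitting ∂_z = ∂̃_z + f_n^† ∂_{z_n}, read at the exponents (s, t) of z_n, z_n^c. -/
theorem coeffDirac_extend (φ : ℕ → ℕ → ZCoeff m (Cl (m + 1))) :
    coeffDirac fd (coeffExtend φ) = coeffExtend fun s t =>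
      coeffTildeZ m (φ s t) + coeffFd m (((s + 1 : ℕ) : ℂ) • φ (s + 1) t) := by
  rw [coeffDirac_apply, Fin.sum_univ_castSucc, coeffDz_last_extend]
  simp only [coeffDz_castSucc_extend, coeffTildeZ, coeffDirac_apply]
  ext α β
  simp only [Pi.add_apply, Finset.sum_apply, coeffExtend, coeffFd]
  rfl

theorem coeffDiracc_extend (φ : ℕ → ℕ → ZCoeff m (Cl (m + 1))) :
    coeffDiracc f (coeffExtend φ) = coeffExtend fun s t =>
      coeffTildeZd m (φ s t) + coeffF m (((t + 1 : ℕ) : ℂ) • φ s (t + 1)) := by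
  rw [coeffDiracc_apply, Fin.sum_univ_castSucc, coeffDzc_last_extend]
  simp only [coeffDzc_castSucc_extend, coeffTildeZd, coeffDiracc_apply]
  ext α β
  simp only [Pi.add_apply, Finset.sum_apply, coeffExtend, coeffF]
  rfl

/-- The compatibility conditions: `∂̃_z F^0 = 0` and `∂̃_z^† F^1 = 0` for `X = F^0 + f_n^† F^1`. -/
structure Compatible (X : ZCoeff m (Cl (m + 1))) : Prop where
  left : coeffTildeZ m (coeffF m (coeffFd m X)) = 0
  right : coeffTildeZd m (coeffFd m (coeffF m X)) = 0

theorem Compatible.coeffDirac_ckSeries {X : ZCoeff m (Cl (m + 1))} (hX : Compatible X) :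
    coeffDirac fd (ckSeries m X) = 0 := by
  rw [ckSeries, coeffDirac_extend]
  ext α β
  exact congrFun (congrFun ((ckRel m).d_ckCoeff hX.left _ _) _) _

theorem Compatible.coeffDiracc_ckSeries {X : ZCoeff m (Cl (m + 1))} (hX : Compatible X) :
    coeffDiracc f (ckSeries m X) = 0 := by
  rw [ckSeries, coeffDiracc_extend]
  ext α β
  exact congrFun (congrFun ((ckRel m).δ_ckCoeff hX.right _ _) _) _

theorem Compatible.pow_eq_sum {X : ZCoeff m (Cl (m + 1))} (hX : Compatible X) (w w' : ℂ) (k : ℕ) :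
    (((k / 2).factorial * ((k + 1) / 2).factorial : ℕ) : ℂ)⁻¹ •
      ((w • coeffA m + w' • coeffB m) ^ k) X =
      ∑ x ∈ Finset.HasAntidiagonal.antidiagonal k, (w ^ x.1 * w' ^ x.2) • ckPhi m x.1 x.2 X :=
  ck_pow_eq_sum (ckRel m).A_sq (ckRel m).swap.A_sq
    ((ckRel m).commute_d.mul_right (ckRel m).commute_F)
    ((ckRel m).commute_δ.mul_right (ckRel m).commute_F')
    ((ckRel m).AB_add_BA_apply hX.left hX.right) w w' k

theorem Compatible.add {X Y : ZCoeff m (Cl (m + 1))} (hX : Compatible X) (hY : Compatible Y) :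
    Compatible (X + Y) :=
  ⟨by simp only [map_add, hX.left, hY.left, add_zero],
    by simp only [map_add, hX.right, hY.right, add_zero]⟩

theorem coeffFd_coeffFd (X : ZCoeff m (Cl (m + 1))) : coeffFd m (coeffFd m X) = 0 :=
  LinearMap.congr_fun (ckRel m).F'_sq X

theorem coeffF_coeffFd {X : ZCoeff m (Cl (m + 1))} (hX : coeffF m X = 0) :
    coeffF m (coeffFd m X) = X := by
  have := LinearMap.congr_fun (ckRel m).F_F' X
  simpa [hX] using this

theorem coeffB_apply_eq (X : ZCoeff m (Cl (m + 1))) :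
    coeffB m X = -coeffFd m (coeffTildeZd m X) := by
  have := LinearMap.congr_fun (ckRel m).F'_δ X
  rw [Module.End.mul_apply, LinearMap.neg_apply] at this
  rw [this, neg_neg, coeffB]

theorem compatible_of_coeffF_eq_zero {X : ZCoeff m (Cl (m + 1))} (hX : coeffF m X = 0)
    (hd : coeffTildeZ m X = 0) : Compatible X :=
  ⟨by rw [coeffF_coeffFd hX, hd], by rw [hX, map_zero, map_zero]⟩

theorem compatible_coeffFd {X : ZCoeff m (Cl (m + 1))} (hX : coeffF m X = 0)
    (hd : coeffTildeZd m X = 0) : Compatible (coeffFd m X) := by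
  refine ⟨by rw [coeffFd_coeffFd, map_zero, map_zero], ?_⟩
  rw [coeffF_coeffFd hX]
  have := coeffB_apply_eq X
  rwa [hd, map_zero, neg_zero] at this

theorem coeffA_eq_zero {X : ZCoeff m (Cl (m + 1))} (hX : coeffF m X = 0) : coeffA m X = 0 := by
  rw [coeffA, Module.End.mul_apply, hX, map_zero]

theorem coeffB_coeffFd (X : ZCoeff m (Cl (m + 1))) : coeffB m (coeffFd m X) = 0 := by
  rw [coeffB, Module.End.mul_apply, coeffFd_coeffFd, map_zero]

theorem coeffA_coeffFd {X : ZCoeff m (Cl (m + 1))} (hX : coeffF m X = 0) :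
    coeffA m (coeffFd m X) = coeffTildeZ m X := by
  rw [coeffA, Module.End.mul_apply, coeffF_coeffFd hX]

/-- Multiply the part of bidegree `(a, b)` of a power series by `χ a b`. -/
def coeffWeight {E : Type*} [AddCommGroup E] [Module ℂ E] (χ : ℕ → ℕ → ℂ) :
    Module.End ℂ (ZCoeff k E) where
  toFun C := fun α β => χ (∑ j, α j) (∑ j, β j) • C α β
  map_add' _ _ := by ext; exact smul_add _ _ _
  map_smul' c _ := by ext; exact smul_comm _ c _

theorem coeffWeight_apply {E : Type*} [AddCommGroup E] [Module ℂ E] (χ : ℕ → ℕ → ℂ)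
    (C : ZCoeff k E) (α β : Fin k → ℕ) :
    coeffWeight χ C α β = χ (∑ j, α j) (∑ j, β j) • C α β := rfl

theorem coeffMulLeft_weight (a : Cl n) (χ : ℕ → ℕ → ℂ) (X : ZCoeff k (Cl n)) :
    coeffMulLeft a (coeffWeight χ X) = coeffWeight χ (coeffMulLeft a X) := by
  ext α β
  exact mul_smul_comm _ _ _

theorem coeffDz_weight {E : Type*} [NormedAddCommGroup E] [NormedSpace ℂ E] (j : Fin k)
    (χ : ℕ → ℕ → ℂ) (X : ZCoeff k E) :
    coeffDz j (coeffWeight χ X) = coeffWeight (fun a b => χ (a + 1) b) (coeffDz j X) := by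
  ext α β
  simp only [coeffDz_apply, coeffWeight_apply, sum_add_single]
  exact smul_comm _ _ _

theorem coeffDzc_weight {E : Type*} [NormedAddCommGroup E] [NormedSpace ℂ E] (j : Fin k)
    (χ : ℕ → ℕ → ℂ) (X : ZCoeff k E) :
    coeffDzc j (coeffWeight χ X) = coeffWeight (fun a b => χ a (b + 1)) (coeffDzc j X) := by
  ext α β
  simp only [coeffDzc_apply, coeffWeight_apply, sum_add_single]
  exact smul_comm _ _ _

theorem coeffDirac_weight (c : Fin k → Cl n) (χ : ℕ → ℕ → ℂ) (X : ZCoeff k (Cl n)) :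
    coeffDirac c (coeffWeight χ X) = coeffWeight (fun a b => χ (a + 1) b) (coeffDirac c X) := by
  simp only [coeffDirac_apply, coeffDz_weight, coeffMulLeft_weight, map_sum]

theorem coeffDiracc_weight (c : Fin k → Cl n) (χ : ℕ → ℕ → ℂ) (X : ZCoeff k (Cl n)) :
    coeffDiracc c (coeffWeight χ X) = coeffWeight (fun a b => χ a (b + 1)) (coeffDiracc c X) := by
  simp only [coeffDiracc_apply, coeffDzc_weight, coeffMulLeft_weight, map_sum]

theorem Compatible.weight {X : ZCoeff m (Cl (m + 1))} (hX : Compatible X) (χ : ℕ → ℕ → ℂ) :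
    Compatible (coeffWeight χ X) := by
  constructor
  · rw [coeffFd, coeffMulLeft_weight, coeffF, coeffMulLeft_weight, coeffTildeZ, coeffDirac_weight]
    exact (congrArg _ hX.left).trans (map_zero _)
  · rw [coeffF, coeffMulLeft_weight, coeffFd, coeffMulLeft_weight, coeffTildeZd, coeffDiracc_weight]
    exact (congrArg _ hX.right).trans (map_zero _)

theorem coeffA_weight (χ : ℕ → ℕ → ℂ) (X : ZCoeff m (Cl (m + 1))) :
    coeffA m (coeffWeight χ X) = coeffWeight (fun a b => χ (a + 1) b) (coeffA m X) := by
  simp only [coeffA, coeffF, coeffTildeZ, Module.End.mul_apply, coeffMulLeft_weight,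
    coeffDirac_weight]

theorem coeffB_weight (χ : ℕ → ℕ → ℂ) (X : ZCoeff m (Cl (m + 1))) :
    coeffB m (coeffWeight χ X) = coeffWeight (fun a b => χ a (b + 1)) (coeffB m X) := by
  simp only [coeffB, coeffFd, coeffTildeZd, Module.End.mul_apply, coeffMulLeft_weight,
    coeffDiracc_weight]

theorem coeffL_weight (χ : ℕ → ℕ → ℂ) (X : ZCoeff m (Cl (m + 1))) :
    coeffL m (coeffWeight χ X) = coeffWeight (fun a b => χ (a + 1) (b + 1)) (coeffL m X) := by
  simp only [coeffL, coeffTildeZ, coeffTildeZd, LinearMap.neg_apply, LinearMap.add_apply,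
    Module.End.mul_apply, coeffDirac_weight, coeffDiracc_weight, map_neg, map_add]

theorem coeffL_pow_weight (s : ℕ) (χ : ℕ → ℕ → ℂ) (X : ZCoeff m (Cl (m + 1))) :
    (coeffL m ^ s) (coeffWeight χ X) =
      coeffWeight (fun a b => χ (a + s) (b + s)) ((coeffL m ^ s) X) := by
  induction s generalizing χ with
  | zero => simp
  | succ s ih =>
    rw [pow_succ', Module.End.mul_apply, ih, coeffL_weight]
    simp only [add_right_comm _ 1 s, add_assoc]
    rfl

theorem ckPhi_weight (s t : ℕ) (χ : ℕ → ℕ → ℂ) (X : ZCoeff m (Cl (m + 1))) :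
    ckPhi m s t (coeffWeight χ X) =
      coeffWeight (fun a b => χ (a + s) (b + t)) (ckPhi m s t X) := by
  simp only [ckPhi, ckCoeff, LinearMap.smul_apply, map_smul]
  congr 1
  split_ifs with h1 h2 h3
  · subst h1; exact coeffL_pow_weight _ _ _
  · subst h2
    rw [Module.End.mul_apply, Module.End.mul_apply, coeffA_weight, coeffL_pow_weight]
    simp only [add_assoc]
  · subst h3
    rw [Module.End.mul_apply, Module.End.mul_apply, coeffB_weight, coeffL_pow_weight]
    simp only [add_assoc]
  · simp

/-- A removes one degree in z_1, …, z_{n-1} and comes with one z_n; B does the same for the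
conjugates, and L for both. Hence the bidegree in all n variables is preserved, and cutting out a
bidegree commutes with extending. -/
theorem ckSeries_weight (χ : ℕ → ℕ → ℂ) (X : ZCoeff m (Cl (m + 1))) :
    ckSeries m (coeffWeight χ X) = coeffWeight χ (ckSeries m X) := by
  ext α β
  simp only [ckSeries, coeffExtend, ckPhi_weight, coeffWeight_apply]
  rw [Fin.sum_univ_castSucc, Fin.sum_univ_castSucc]

end Operators

/-! ### Convergence of the extension series in weighted ℓ¹ norms. -/

section Bounds

variable {k n m : ℕ} {E : Type*} [NormedAddCommGroup E]

/-- The weighted `ℓ¹` norm of a power series, with weights depending on the total degree. -/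
def coeffNorm (g : ℕ → ℝ≥0∞) (X : ZCoeff k E) : ℝ≥0∞ :=
  ∑' γ : (Fin k → ℕ) × (Fin k → ℕ), ‖X γ.1 γ.2‖ₑ * g (∑ j, γ.1 j + ∑ j, γ.2 j)

/-- The change of the weights under differentiation. -/
def stepWeight (g : ℕ → ℝ≥0∞) : ℕ → ℝ≥0∞ := fun N => N * g (N - 1)

theorem coeffNorm_add_le (g : ℕ → ℝ≥0∞) (X Y : ZCoeff k E) :
    coeffNorm g (X + Y) ≤ coeffNorm g X + coeffNorm g Y := by
  rw [coeffNorm, coeffNorm, coeffNorm, ← ENNReal.tsum_add]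
  refine ENNReal.tsum_le_tsum fun γ => ?_
  rw [← add_mul]
  exact mul_le_mul_left (enorm_add_le _ _) _

theorem coeffNorm_neg (g : ℕ → ℝ≥0∞) (X : ZCoeff k E) : coeffNorm g (-X) = coeffNorm g X := by
  simp [coeffNorm]

theorem coeffNorm_zero (g : ℕ → ℝ≥0∞) : coeffNorm g (0 : ZCoeff k E) = 0 := by
  simp [coeffNorm]

theorem coeffNorm_sum_le {ι : Type*} (s : Finset ι) (g : ℕ → ℝ≥0∞) (X : ι → ZCoeff k E) :
    coeffNorm g (∑ i ∈ s, X i) ≤ ∑ i ∈ s, coeffNorm g (X i) :=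
  Finset.le_sum_of_subadditive _ (coeffNorm_zero g).le (coeffNorm_add_le g) _ _

theorem coeffNorm_smul [NormedSpace ℂ E] (g : ℕ → ℝ≥0∞) (c : ℂ) (X : ZCoeff k E) :
    coeffNorm g (c • X) = ‖c‖ₑ * coeffNorm g X := by
  rw [coeffNorm, coeffNorm, ← ENNReal.tsum_mul_left]
  refine tsum_congr fun γ => ?_
  rw [← mul_assoc, ← enorm_smul]
  rfl

theorem enorm_natCast_complex (N : ℕ) : ‖(N : ℂ)‖ₑ = N := by
  rw [← ofReal_norm, Complex.norm_natCast, ENNReal.ofReal_natCast]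

theorem coeffNorm_dz_le [NormedSpace ℂ E] (g : ℕ → ℝ≥0∞) (j : Fin k) (X : ZCoeff k E) :
    coeffNorm g (coeffDz j X) ≤ ∑' γ : (Fin k → ℕ) × (Fin k → ℕ),
      (γ.1 j : ℝ≥0∞) * (‖X γ.1 γ.2‖ₑ * g (∑ j, γ.1 j + ∑ j, γ.2 j - 1)) := by
  have hinj : Function.Injective (fun γ : (Fin k → ℕ) × (Fin k → ℕ) =>
      ((γ.1 + Pi.single j 1, γ.2) : (Fin k → ℕ) × (Fin k → ℕ))) := by
    rintro ⟨a, b⟩ ⟨a', b'⟩ hab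
    simpa using hab
  refine le_trans (le_of_eq ?_) (ENNReal.tsum_comp_le_tsum_of_injective hinj _)
  refine tsum_congr fun γ => ?_
  rw [coeffDz_apply, enorm_smul, enorm_natCast_complex, sum_add_single, mul_assoc, add_right_comm,
    Nat.add_sub_cancel]
  simp

theorem coeffNorm_dzc_le [NormedSpace ℂ E] (g : ℕ → ℝ≥0∞) (j : Fin k) (X : ZCoeff k E) :
    coeffNorm g (coeffDzc j X) ≤ ∑' γ : (Fin k → ℕ) × (Fin k → ℕ),
      (γ.2 j : ℝ≥0∞) * (‖X γ.1 γ.2‖ₑ * g (∑ j, γ.1 j + ∑ j, γ.2 j - 1)) := by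
  have hinj : Function.Injective (fun γ : (Fin k → ℕ) × (Fin k → ℕ) =>
      ((γ.1, γ.2 + Pi.single j 1) : (Fin k → ℕ) × (Fin k → ℕ))) := by
    rintro ⟨a, b⟩ ⟨a', b'⟩ hab
    simpa using hab
  refine le_trans (le_of_eq ?_) (ENNReal.tsum_comp_le_tsum_of_injective hinj _)
  refine tsum_congr fun γ => ?_
  rw [coeffDzc_apply, enorm_smul, enorm_natCast_complex, sum_add_single, mul_assoc, ← add_assoc,
    Nat.add_sub_cancel]
  simp

/-- The factors α_j add up to |α|, at most the total degree, so all partial derivatives together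
cost one weight step, with no factor from the dimension. -/
theorem sum_coeffNorm_dz_le [NormedSpace ℂ E] (g : ℕ → ℝ≥0∞) (X : ZCoeff k E) :
    ∑ j, coeffNorm g (coeffDz j X) ≤ coeffNorm (stepWeight g) X := by
  refine (Finset.sum_le_sum fun j _ => coeffNorm_dz_le g j X).trans ?_
  rw [← Summable.tsum_finsetSum fun _ _ => ENNReal.summable]
  refine ENNReal.tsum_le_tsum fun γ => ?_
  rw [← Finset.sum_mul, ← Nat.cast_sum, stepWeight, ← mul_assoc, ← mul_assoc, mul_comm ‖_‖ₑ]
  gcongr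
  exact Nat.le_add_right _ _

theorem sum_coeffNorm_dzc_le [NormedSpace ℂ E] (g : ℕ → ℝ≥0∞) (X : ZCoeff k E) :
    ∑ j, coeffNorm g (coeffDzc j X) ≤ coeffNorm (stepWeight g) X := by
  refine (Finset.sum_le_sum fun j _ => coeffNorm_dzc_le g j X).trans ?_
  rw [← Summable.tsum_finsetSum fun _ _ => ENNReal.summable]
  refine ENNReal.tsum_le_tsum fun γ => ?_
  rw [← Finset.sum_mul, ← Nat.cast_sum, stepWeight, ← mul_assoc, ← mul_assoc, mul_comm ‖_‖ₑ]
  gcongr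
  exact Nat.le_add_left _ _

theorem coeffNorm_mulLeft_le (g : ℕ → ℝ≥0∞) {K : ℝ≥0∞} {a : Cl n}
    (ha : ∀ x : Cl n, ‖a * x‖ₑ ≤ K * ‖x‖ₑ) (X : ZCoeff k (Cl n)) :
    coeffNorm g (coeffMulLeft a X) ≤ K * coeffNorm g X := by
  rw [coeffNorm, coeffNorm, ← ENNReal.tsum_mul_left]
  refine ENNReal.tsum_le_tsum fun γ => ?_
  rw [← mul_assoc, coeffMulLeft_apply]
  gcongr
  exact ha _

theorem coeffNorm_dirac_le (g : ℕ → ℝ≥0∞) {K : ℝ≥0∞} {c : Fin k → Cl n}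
    (hc : ∀ j, ∀ x : Cl n, ‖c j * x‖ₑ ≤ K * ‖x‖ₑ) (X : ZCoeff k (Cl n)) :
    coeffNorm g (coeffDirac c X) ≤ K * coeffNorm (stepWeight g) X := by
  rw [coeffDirac_apply]
  refine (coeffNorm_sum_le _ _ _).trans
    ((Finset.sum_le_sum fun j _ => coeffNorm_mulLeft_le g (hc j) _).trans ?_)
  rw [← Finset.mul_sum]
  gcongr
  exact sum_coeffNorm_dz_le g X

theorem coeffNorm_diracc_le (g : ℕ → ℝ≥0∞) {K : ℝ≥0∞} {c : Fin k → Cl n}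
    (hc : ∀ j, ∀ x : Cl n, ‖c j * x‖ₑ ≤ K * ‖x‖ₑ) (X : ZCoeff k (Cl n)) :
    coeffNorm g (coeffDiracc c X) ≤ K * coeffNorm (stepWeight g) X := by
  rw [coeffDiracc_apply]
  refine (coeffNorm_sum_le _ _ _).trans
    ((Finset.sum_le_sum fun j _ => coeffNorm_mulLeft_le g (hc j) _).trans ?_)
  rw [← Finset.mul_sum]
  gcongr
  exact sum_coeffNorm_dzc_le g X

theorem exists_mul_bound (n : ℕ) : ∃ K : ℝ≥0, 1 ≤ K ∧
    (∀ (j : Fin n) (x : Cl n), ‖f j * x‖ₑ ≤ K * ‖x‖ₑ) ∧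
    ∀ (j : Fin n) (x : Cl n), ‖fd j * x‖ₑ ≤ K * ‖x‖ₑ := by
  have key : ∀ (a x : Cl n) (K : ℝ≥0), ‖mulLeftL a‖₊ ≤ K → ‖a * x‖ₑ ≤ K * ‖x‖ₑ := by
    intro a x K hK
    rw [enorm_eq_nnnorm, enorm_eq_nnnorm, ← ENNReal.coe_mul, ENNReal.coe_le_coe]
    exact ((mulLeftL a).le_opNNNorm x).trans (mul_le_mul_left hK _)
  refine ⟨1 + (∑ j, ‖mulLeftL (f j : Cl n)‖₊ + ∑ j, ‖mulLeftL (fd j : Cl n)‖₊), le_self_add,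
    fun j x => key _ _ _ ?_, fun j x => key _ _ _ ?_⟩
  · exact (Finset.single_le_sum (f := fun j => ‖mulLeftL (f j : Cl n)‖₊)
      (fun _ _ => zero_le) (Finset.mem_univ j)).trans (le_self_add.trans le_add_self)
  · exact (Finset.single_le_sum (f := fun j => ‖mulLeftL (fd j : Cl n)‖₊)
      (fun _ _ => zero_le) (Finset.mem_univ j)).trans (le_add_self.trans le_add_self)

/-- A and B are of first order and L of second order, so the coefficient at (s, t) has order exactly
s + t. -/
theorem exists_ckPhi_bound (m : ℕ) : ∃ κ : ℝ≥0, ∀ (s t : ℕ) (g : ℕ → ℝ≥0∞)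
    (X : ZCoeff m (Cl (m + 1))), coeffNorm g (ckPhi m s t X) ≤
      ((s.factorial * t.factorial : ℕ) : ℝ≥0∞)⁻¹ *
        ((κ : ℝ≥0∞) ^ (s + t) * coeffNorm (stepWeight^[s + t] g) X) := by
  obtain ⟨K, hK1, hf, hfd⟩ := exists_mul_bound (m + 1)
  have hK1' : (1 : ℝ≥0∞) ≤ K := by exact_mod_cast hK1
  -- K² suffices for A and B, and 2K² for the two summands of L; as κ ≥ 1, the bound for L also fits
  -- under κ², one κ per derivative.
  refine ⟨2 * (K * K), ?_⟩
  have hκ : ((2 * (K * K) : ℝ≥0) : ℝ≥0∞) = K * K + K * K := by push_cast; ring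
  rw [hκ]
  set κ : ℝ≥0∞ := K * K + K * K with hκ'
  have hK2 : (K * K : ℝ≥0∞) ≤ κ := le_self_add
  have hκ1 : 1 ≤ κ := (one_le_mul hK1' hK1').trans hK2
  have hd : ∀ g (X : ZCoeff m (Cl (m + 1))),
      coeffNorm g (coeffTildeZ m X) ≤ K * coeffNorm (stepWeight g) X := fun g X =>
    coeffNorm_dirac_le g (fun j => hfd _) X
  have hδ : ∀ g (X : ZCoeff m (Cl (m + 1))),
      coeffNorm g (coeffTildeZd m X) ≤ K * coeffNorm (stepWeight g) X := fun g X =>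
    coeffNorm_diracc_le g (fun j => hf _) X
  have hA : ∀ g (X : ZCoeff m (Cl (m + 1))),
      coeffNorm g (coeffA m X) ≤ κ * coeffNorm (stepWeight g) X := fun g X => by
    refine (hd g _).trans ((mul_le_mul_right (coeffNorm_mulLeft_le _ (hf _) X) _).trans ?_)
    rw [← mul_assoc]
    exact mul_le_mul_left hK2 _
  have hB : ∀ g (X : ZCoeff m (Cl (m + 1))),
      coeffNorm g (coeffB m X) ≤ κ * coeffNorm (stepWeight g) X := fun g X => by
    refine (hδ g _).trans ((mul_le_mul_right (coeffNorm_mulLeft_le _ (hfd _) X) _).trans ?_)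
    rw [← mul_assoc]
    exact mul_le_mul_left hK2 _
  have hL : ∀ g (X : ZCoeff m (Cl (m + 1))),
      coeffNorm g (coeffL m X) ≤ κ ^ 2 * coeffNorm (stepWeight^[2] g) X := fun g X => by
    have e : coeffL m X = -(coeffTildeZ m (coeffTildeZd m X) + coeffTildeZd m (coeffTildeZ m X)) :=
      rfl
    rw [e, coeffNorm_neg]
    refine (coeffNorm_add_le _ _ _).trans ((add_le_add
      ((hd g _).trans (mul_le_mul_right (hδ _ X) _))
      ((hδ g _).trans (mul_le_mul_right (hd _ X) _))).trans ?_)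
    rw [← mul_assoc, ← add_mul]
    refine mul_le_mul_left ?_ _
    rw [pow_two]
    exact le_mul_of_one_le_left' hκ1
  have hLs : ∀ (s : ℕ) g (X : ZCoeff m (Cl (m + 1))),
      coeffNorm g ((coeffL m ^ s) X) ≤ κ ^ (2 * s) * coeffNorm (stepWeight^[2 * s] g) X := by
    intro s
    induction s with
    | zero => intro g X; simp
    | succ s ih =>
      intro g X
      rw [pow_succ, Module.End.mul_apply]
      refine (ih g _).trans ((mul_le_mul_right (hL _ X) _).trans_eq ?_)
      rw [← mul_assoc, ← pow_add, ← Function.iterate_add_apply, add_comm 2, mul_add, mul_one]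
  intro s t g X
  rw [ckPhi, ckCoeff, LinearMap.smul_apply, coeffNorm_smul]
  refine mul_le_mul' ?_ ?_
  · rw [enorm_inv (Nat.cast_ne_zero.2 (by positivity)), enorm_natCast_complex]
  split_ifs with h1 h2 h3
  · subst h1
    rw [← two_mul s]
    exact hLs s g X
  · subst h2
    rw [Module.End.mul_apply, show t + 1 + t = 2 * t + 1 by ring]
    refine (hLs t g _).trans ((mul_le_mul_right (hA _ X) _).trans_eq ?_)
    rw [← mul_assoc, ← pow_succ, Function.iterate_succ_apply']
  · subst h3
    rw [Module.End.mul_apply, show s + (s + 1) = 2 * s + 1 by ring]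
    refine (hLs s g _).trans ((mul_le_mul_right (hB _ X) _).trans_eq ?_)
    rw [← mul_assoc, ← pow_succ, Function.iterate_succ_apply']
  · rw [LinearMap.zero_apply, coeffNorm_zero]
    exact zero_le

theorem stepWeight_iterate (k : ℕ) (g : ℕ → ℝ≥0∞) (N : ℕ) :
    stepWeight^[k] g N = (N.descFactorial k : ℝ≥0∞) * g (N - k) := by
  induction k generalizing N with
  | zero => simp
  | succ k ih =>
    rw [Function.iterate_succ_apply', stepWeight, ih, ← mul_assoc, ← Nat.cast_mul, Nat.sub_sub,
      add_comm 1 k]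
    congr 2
    cases N with
    | zero => simp
    | succ N => rw [Nat.add_sub_cancel, Nat.succ_descFactorial_succ]

theorem coeffNorm_extend (ρ : ℝ≥0∞) (φ : ℕ → ℕ → ZCoeff m E) :
    coeffNorm (fun N => ρ ^ N) (coeffExtend φ) =
      ∑' x : ℕ × ℕ, ρ ^ (x.1 + x.2) * coeffNorm (fun N => ρ ^ N) (φ x.1 x.2) := by
  let e := Fin.snocEquiv fun _ : Fin (m + 1) => ℕ
  let e2 : (ℕ × ℕ) × ((Fin m → ℕ) × (Fin m → ℕ)) ≃ (Fin (m + 1) → ℕ) × (Fin (m + 1) → ℕ) :=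
    (Equiv.prodProdProdComm _ _ _ _).trans (Equiv.prodCongr e e)
  rw [coeffNorm, ← e2.tsum_eq, ENNReal.tsum_prod']
  refine tsum_congr fun x => ?_
  rw [coeffNorm, ← ENNReal.tsum_mul_left]
  refine tsum_congr fun y => ?_
  obtain ⟨s, t⟩ := x
  obtain ⟨α, β⟩ := y
  have h1 : e2 ((s, t), (α, β)) = (Fin.snoc (α := fun _ => ℕ) α s, Fin.snoc (α := fun _ => ℕ) β t) :=
    rfl
  rw [h1]
  simp only [coeffExtend, Fin.snoc_last, Fin.snoc_castSucc, Fin.sum_univ_castSucc]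
  rw [add_add_add_comm, pow_add]
  ring

/-- With k = s + t, N!/((N-k)! s! t!) is the product of the binomials (N over k) and (k over s).
Summing over s gives 2^k, and the binomial theorem sums over k. -/
theorem tsum_choose_bound (κ ρ : ℝ≥0∞) (N : ℕ) :
    ∑' x : ℕ × ℕ, (ρ * κ) ^ (x.1 + x.2) *
      (((x.1.factorial * x.2.factorial : ℕ) : ℝ≥0∞)⁻¹ *
        ((N.descFactorial (x.1 + x.2) : ℝ≥0∞) * ρ ^ (N - (x.1 + x.2)))) = ((1 + 2 * κ) * ρ) ^ N := by
  have hterm : ∀ x : ℕ × ℕ, (ρ * κ) ^ (x.1 + x.2) *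
      (((x.1.factorial * x.2.factorial : ℕ) : ℝ≥0∞)⁻¹ *
        ((N.descFactorial (x.1 + x.2) : ℝ≥0∞) * ρ ^ (N - (x.1 + x.2)))) =
      ((x.1 + x.2).choose x.1 : ℝ≥0∞) *
        ((N.choose (x.1 + x.2) : ℝ≥0∞) * ((ρ * κ) ^ (x.1 + x.2) * ρ ^ (N - (x.1 + x.2)))) := by
    rintro ⟨s, t⟩
    have h1 : ((N.descFactorial (s + t) : ℕ) : ℝ≥0∞) =
        ((s.factorial * t.factorial : ℕ) : ℝ≥0∞) *
          (((s + t).choose s : ℝ≥0∞) * (N.choose (s + t) : ℝ≥0∞)) := by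
      rw [Nat.descFactorial_eq_factorial_mul_choose, ← Nat.add_choose_mul_factorial_mul_factorial]
      push_cast
      rw [Nat.choose_symm_add]
      ring
    have h2 : ((s.factorial * t.factorial : ℕ) : ℝ≥0∞)⁻¹ *
        ((s.factorial * t.factorial : ℕ) : ℝ≥0∞) = 1 :=
      ENNReal.inv_mul_cancel (Nat.cast_ne_zero.2 (by positivity)) (ENNReal.natCast_ne_top _)
    simp only [h1]
    rw [mul_assoc (_ : ℝ≥0∞) _ (ρ ^ _), ← mul_assoc (_ : ℝ≥0∞)⁻¹, h2, one_mul]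
    ring
  rw [tsum_congr hterm, ← (Finset.HasAntidiagonal.sigmaAntidiagonalEquivProd (A := ℕ)).tsum_eq, ENNReal.tsum_sigma']
  have hin : ∀ k : ℕ, ∑' x : Finset.HasAntidiagonal.antidiagonal k,
      ((((Finset.HasAntidiagonal.sigmaAntidiagonalEquivProd ⟨k, x⟩).1 +
        (Finset.HasAntidiagonal.sigmaAntidiagonalEquivProd ⟨k, x⟩).2).choose
          (Finset.HasAntidiagonal.sigmaAntidiagonalEquivProd ⟨k, x⟩).1 : ℕ) : ℝ≥0∞) *
        ((N.choose ((Finset.HasAntidiagonal.sigmaAntidiagonalEquivProd ⟨k, x⟩).1 +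
          (Finset.HasAntidiagonal.sigmaAntidiagonalEquivProd ⟨k, x⟩).2) : ℝ≥0∞) *
          ((ρ * κ) ^ ((Finset.HasAntidiagonal.sigmaAntidiagonalEquivProd ⟨k, x⟩).1 +
            (Finset.HasAntidiagonal.sigmaAntidiagonalEquivProd ⟨k, x⟩).2) *
          ρ ^ (N - ((Finset.HasAntidiagonal.sigmaAntidiagonalEquivProd ⟨k, x⟩).1 +
            (Finset.HasAntidiagonal.sigmaAntidiagonalEquivProd ⟨k, x⟩).2)))) =
      (2 * (ρ * κ)) ^ k * ρ ^ (N - k) * (N.choose k : ℝ≥0∞) := by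
    intro k
    have hx : ∀ x : Finset.HasAntidiagonal.antidiagonal k, (x : ℕ × ℕ).1 + (x : ℕ × ℕ).2 = k :=
      fun x => Finset.HasAntidiagonal.mem_antidiagonal.1 x.2
    simp only [Finset.HasAntidiagonal.sigmaAntidiagonalEquivProd_apply, hx]
    rw [ENNReal.tsum_mul_right, tsum_fintype,
      Finset.sum_coe_sort (Finset.HasAntidiagonal.antidiagonal k)
        (fun x : ℕ × ℕ => (k.choose x.1 : ℝ≥0∞)),
      Finset.Nat.sum_antidiagonal_eq_sum_range_succ_mk, ← Nat.cast_sum, Nat.sum_range_choose,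
      mul_pow]
    push_cast
    ring
  rw [tsum_congr hin, tsum_eq_sum (s := Finset.range (N + 1)), ← add_pow]
  · congr 1; ring
  · intro k hk
    rw [Nat.choose_eq_zero_of_lt (by simpa using hk)]
    simp

/-- After exchanging the sums, a coefficient of degree N is multiplied by the sum in
`tsum_choose_bound`, that is ((1 + 2κ)ρ)^N; hence θ = 1 + 2κ. -/
theorem exists_ckSeries_bound (m : ℕ) : ∃ θ : ℝ≥0, 1 ≤ θ ∧ ∀ (ρ : ℝ≥0∞) (X : ZCoeff m (Cl (m + 1))),
    coeffNorm (fun N => ρ ^ N) (ckSeries m X) ≤ coeffNorm (fun N => (θ * ρ) ^ N) X := by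
  obtain ⟨κ, hκ⟩ := exists_ckPhi_bound m
  refine ⟨1 + 2 * κ, le_self_add, fun ρ X => ?_⟩
  rw [ckSeries, coeffNorm_extend]
  have h1 : ∀ x : ℕ × ℕ, ρ ^ (x.1 + x.2) * coeffNorm (fun N => ρ ^ N) (ckPhi m x.1 x.2 X) ≤
      ρ ^ (x.1 + x.2) * (((x.1.factorial * x.2.factorial : ℕ) : ℝ≥0∞)⁻¹ *
        ((κ : ℝ≥0∞) ^ (x.1 + x.2) * coeffNorm (stepWeight^[x.1 + x.2] fun N => ρ ^ N) X)) :=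
    fun x => by
      gcongr
      exact hκ x.1 x.2 _ X
  refine (ENNReal.tsum_le_tsum h1).trans_eq ?_
  clear h1 hκ
  simp only [coeffNorm, stepWeight_iterate]
  simp only [← ENNReal.tsum_mul_left]
  rw [ENNReal.tsum_comm]
  refine tsum_congr fun γ => ?_
  push_cast
  rw [← tsum_choose_bound, ← ENNReal.tsum_mul_left]
  refine tsum_congr fun x => ?_
  rw [mul_pow]
  push_cast
  ring

theorem coeffNorm_pow_ne_top_iff (ρ : ℝ≥0) (X : ZCoeff k E) :
    coeffNorm (fun N => (ρ : ℝ≥0∞) ^ N) X ≠ ∞ ↔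
      Summable fun γ : (Fin k → ℕ) × (Fin k → ℕ) =>
        ‖X γ.1 γ.2‖ * (ρ : ℝ) ^ (∑ j, γ.1 j + ∑ j, γ.2 j) := by
  have h : coeffNorm (fun N => (ρ : ℝ≥0∞) ^ N) X =
      ∑' γ : (Fin k → ℕ) × (Fin k → ℕ),
        ((‖X γ.1 γ.2‖₊ * ρ ^ (∑ j, γ.1 j + ∑ j, γ.2 j) : ℝ≥0) : ℝ≥0∞) := by
    refine tsum_congr fun γ => ?_
    push_cast
    rfl
  rw [h, ENNReal.tsum_coe_ne_top_iff_summable, ← NNReal.summable_coe]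
  push_cast
  rfl

/-- The sum of a power series. -/
def zSum [NormedSpace ℂ E] (X : ZCoeff k E) (z : Fin k → ℂ) : E :=
  ∑' γ : (Fin k → ℕ) × (Fin k → ℕ), zMonomial γ.1 γ.2 z • X γ.1 γ.2

theorem hasZSumOn_zSum [NormedSpace ℂ E] [CompleteSpace E] {X : ZCoeff k E} {R : ℝ}
    (h : ∀ ρ : ℝ≥0, (ρ : ℝ) < R → coeffNorm (fun N => (ρ : ℝ≥0∞) ^ N) X ≠ ∞) :
    HasZSumOn (zSum X) X R := by
  intro z hz
  refine Summable.hasSum (Summable.of_norm_bounded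
    ((coeffNorm_pow_ne_top_iff ‖z‖₊ X).1 (h ‖z‖₊ hz)) fun γ => ?_)
  rw [norm_smul, mul_comm]
  exact mul_le_mul_of_nonneg_left (norm_zMonomial_le _ _ le_rfl) (norm_nonneg _)

/-- The extension series of a power series converging on a ball converges on a smaller ball. -/
theorem exists_hasZSumOn_ckSeries (m : ℕ) : ∃ θ : ℝ, 1 ≤ θ ∧ ∀ (R : ℝ)
    (G : (Fin m → ℂ) → Cl (m + 1)) (X : ZCoeff m (Cl (m + 1))), HasZSumOn G X (θ * R) →
      HasZSumOn (zSum (ckSeries m X)) (ckSeries m X) R := by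
  obtain ⟨θ, hθ, hb⟩ := exists_ckSeries_bound m
  refine ⟨θ, hθ, fun R G X hX => hasZSumOn_zSum fun ρ hρ => ne_top_of_le_ne_top ?_ (hb ρ X)⟩
  rw [← ENNReal.coe_mul, coeffNorm_pow_ne_top_iff]
  refine hX.summable_norm (NNReal.coe_nonneg _) ?_
  rw [NNReal.coe_mul]
  exact mul_lt_mul_of_pos_left hρ (lt_of_lt_of_le one_pos (by exact_mod_cast hθ))

end Bounds

/-! ### The terms T_k as parts of the extension series. -/

section Terms

variable {k n m : ℕ}

theorem HasZSumOn.mulLeft {G : (Fin k → ℂ) → Cl n} {X : ZCoeff k (Cl n)} {R : ℝ}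
    (h : HasZSumOn G X R) (a : Cl n) : HasZSumOn (fun z => a * G z) (coeffMulLeft a X) R :=
  h.map (mulLeftL a)

theorem HasZSeries.mulLeft {G : (Fin k → ℂ) → Cl n} {X : ZCoeff k (Cl n)} (h : HasZSeries G X)
    (a : Cl n) : HasZSeries (fun z => a * G z) (coeffMulLeft a X) := by
  obtain ⟨R, hR, hG⟩ := hasZSeries_iff.1 h
  exact hasZSeries_iff.2 ⟨R, hR, hG.mulLeft a⟩

theorem HasZSumOn.diracZ {G : (Fin n → ℂ) → Cl n} {X : ZCoeff n (Cl n)} {R : ℝ}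
    (h : HasZSumOn G X R) : HasZSumOn (diracZ G) (coeffDirac fd X) R := by
  rw [coeffDirac_apply]
  exact HasZSumOn.sum _ fun j _ => (h.dz j).mulLeft _

theorem HasZSumOn.diracZd {G : (Fin n → ℂ) → Cl n} {X : ZCoeff n (Cl n)} {R : ℝ}
    (h : HasZSumOn G X R) : HasZSumOn (diracZd G) (coeffDiracc f X) R := by
  rw [coeffDiracc_apply]
  exact HasZSumOn.sum _ fun j _ => (h.dzc j).mulLeft _

theorem HasZSumOn.tildeDiracZ {G : (Fin m → ℂ) → Cl (m + 1)} {X : ZCoeff m (Cl (m + 1))} {R : ℝ}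
    (h : HasZSumOn G X R) : HasZSumOn (tildeDiracZ G) (coeffTildeZ m X) R := by
  rw [coeffTildeZ, coeffDirac_apply]
  exact HasZSumOn.sum _ fun j _ => (h.dz j).mulLeft _

theorem HasZSumOn.tildeDiracZd {G : (Fin m → ℂ) → Cl (m + 1)} {X : ZCoeff m (Cl (m + 1))} {R : ℝ}
    (h : HasZSumOn G X R) : HasZSumOn (tildeDiracZd G) (coeffTildeZd m X) R := by
  rw [coeffTildeZd, coeffDiracc_apply]
  exact HasZSumOn.sum _ fun j _ => (h.dzc j).mulLeft _

theorem HasZSumOn.ckOp {G : (Fin m → ℂ) → Cl (m + 1)} {X : ZCoeff m (Cl (m + 1))} {R : ℝ}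
    (h : HasZSumOn G X R) (w : ℂ) :
    HasZSumOn (ckOp w G) ((w • coeffA m + (starRingEnd ℂ w) • coeffB m) X) R :=
  ((h.mulLeft _).tildeDiracZ.const_smul w).add
    ((h.mulLeft _).tildeDiracZd.const_smul (starRingEnd ℂ w))

theorem HasZSumOn.ckOp_iterate {G : (Fin m → ℂ) → Cl (m + 1)} {X : ZCoeff m (Cl (m + 1))} {R : ℝ}
    (h : HasZSumOn G X R) (w : ℂ) (k : ℕ) :
    HasZSumOn ((HermClifford.ckOp w)^[k] G)
      (((w • coeffA m + (starRingEnd ℂ w) • coeffB m) ^ k) X) R := by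
  induction k with
  | zero => exact h
  | succ k ih =>
    rw [Function.iterate_succ_apply', pow_succ', Module.End.mul_apply]
    exact ih.ckOp w

/-- `G` is the sum of an everywhere convergent power series. -/
def HasZSum {E : Type*} [NormedAddCommGroup E] [NormedSpace ℂ E] (G : (Fin k → ℂ) → E)
    (C : ZCoeff k E) : Prop := ∀ R, HasZSumOn G C R

theorem HasZSum.hasSum {E : Type*} [NormedAddCommGroup E] [NormedSpace ℂ E] {G : (Fin k → ℂ) → E}
    {C : ZCoeff k E} (h : HasZSum G C) (z : Fin k → ℂ) :
    HasSum (fun γ : (Fin k → ℕ) × (Fin k → ℕ) => zMonomial γ.1 γ.2 z • C γ.1 γ.2) (G z) :=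
  h (‖z‖ + 1) z (lt_add_one _)

theorem HasZSum.unique {E : Type*} [NormedAddCommGroup E] [NormedSpace ℂ E] {G H : (Fin k → ℂ) → E}
    {C : ZCoeff k E} (h : HasZSum G C) (h' : HasZSum H C) : G = H :=
  funext fun z => (h.hasSum z).unique (h'.hasSum z)

theorem HasZSum.eq_zero {E : Type*} [NormedAddCommGroup E] [NormedSpace ℂ E] {G : (Fin k → ℂ) → E}
    (h : HasZSum G 0) (z : Fin k → ℂ) : G z = 0 :=
  (h.hasSum z).unique (by simp)

theorem HasZSum.ckSeries {p : (Fin m → ℂ) → Cl (m + 1)} {X : ZCoeff m (Cl (m + 1))}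
    (h : HasZSum p X) : HasZSum (zSum (ckSeries m X)) (ckSeries m X) := by
  obtain ⟨θ, -, hθ⟩ := exists_hasZSumOn_ckSeries m
  exact fun R => hθ R p X (h _)

/-- Split off the exponents of `z_n` and `z_n^c`. -/
def snocPairEquiv (m : ℕ) :
    (ℕ × ℕ) × ((Fin m → ℕ) × (Fin m → ℕ)) ≃ (Fin (m + 1) → ℕ) × (Fin (m + 1) → ℕ) :=
  (Equiv.prodProdProdComm _ _ _ _).trans
    (Equiv.prodCongr (Fin.snocEquiv fun _ => ℕ) (Fin.snocEquiv fun _ => ℕ))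

theorem snocPairEquiv_apply (s t : ℕ) (α β : Fin m → ℕ) :
    snocPairEquiv m ((s, t), (α, β)) =
      (Fin.snoc (α := fun _ => ℕ) α s, Fin.snoc (α := fun _ => ℕ) β t) := rfl

theorem zMonomial_snoc (α β : Fin m → ℕ) (s t : ℕ) (z : Fin (m + 1) → ℂ) :
    zMonomial (Fin.snoc (α := fun _ => ℕ) α s) (Fin.snoc (α := fun _ => ℕ) β t) z =
      zMonomial α β (Fin.init z) * (z (Fin.last m) ^ s * starRingEnd ℂ (z (Fin.last m)) ^ t) := by
  rw [zMonomial, Fin.prod_univ_castSucc]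
  simp only [Fin.snoc_castSucc, Fin.snoc_last]
  rfl

theorem coeffExtend_snoc {E : Type*} (φ : ℕ → ℕ → ZCoeff m E) (α β : Fin m → ℕ) (s t : ℕ) :
    coeffExtend φ (Fin.snoc (α := fun _ => ℕ) α s) (Fin.snoc (α := fun _ => ℕ) β t) =
      φ s t α β := by
  simp only [coeffExtend, Fin.snoc_castSucc, Fin.snoc_last]

/-- By the collapse of the k-th power, T_k is the part of the extension series of total degree k in
z_n, z_n^c. -/
theorem ckTerm_eq_tsum {p : (Fin m → ℂ) → Cl (m + 1)} {X : ZCoeff m (Cl (m + 1))}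
    (hp : HasZSum p X) (hX : Compatible X) (k : ℕ) (z : Fin (m + 1) → ℂ) :
    ckTerm k p z = ∑' γ : (Fin (m + 1) → ℕ) × (Fin (m + 1) → ℕ),
      if γ.1 (Fin.last m) + γ.2 (Fin.last m) = k then
        zMonomial γ.1 γ.2 z • ckSeries m X γ.1 γ.2 else 0 := by
  set w := z (Fin.last m) with hw
  have hs := hp.ckSeries.hasSum z
  have hs' : Summable fun x : (ℕ × ℕ) × ((Fin m → ℕ) × (Fin m → ℕ)) =>
      zMonomial x.2.1 x.2.2 (Fin.init z) • (w ^ x.1.1 * starRingEnd ℂ w ^ x.1.2) •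
        ckPhi m x.1.1 x.1.2 X x.2.1 x.2.2 := by
    refine ((snocPairEquiv m).summable_iff.2 hs.summable).congr fun x => ?_
    obtain ⟨⟨s, t⟩, ⟨α, β⟩⟩ := x
    simp only [Function.comp_apply, snocPairEquiv_apply, zMonomial_snoc, ckSeries, coeffExtend_snoc,
      mul_smul]
    rfl
  have h1 : HasSum (fun γ : (Fin m → ℕ) × (Fin m → ℕ) => zMonomial γ.1 γ.2 (Fin.init z) •
      (((((k / 2).factorial * ((k + 1) / 2).factorial : ℕ) : ℂ)⁻¹ •
      ((w • coeffA m + (starRingEnd ℂ w) • coeffB m) ^ k) X) γ.1 γ.2)) (ckTerm k p z) :=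
    (((hp (‖(Fin.init z : Fin m → ℂ)‖ + 1)).ckOp_iterate w k).const_smul _) _ (lt_add_one _)
  rw [hX.pow_eq_sum] at h1
  rw [← (snocPairEquiv m).tsum_eq]
  have h2 : ∀ x : (ℕ × ℕ) × ((Fin m → ℕ) × (Fin m → ℕ)),
      (if (snocPairEquiv m x).1 (Fin.last m) + (snocPairEquiv m x).2 (Fin.last m) = k then
        zMonomial (snocPairEquiv m x).1 (snocPairEquiv m x).2 z •
          ckSeries m X (snocPairEquiv m x).1 (snocPairEquiv m x).2 else 0) =
      if x.1.1 + x.1.2 = k then zMonomial x.2.1 x.2.2 (Fin.init z) •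
        (w ^ x.1.1 * starRingEnd ℂ w ^ x.1.2) • ckPhi m x.1.1 x.1.2 X x.2.1 x.2.2 else 0 := by
    rintro ⟨⟨s, t⟩, ⟨α, β⟩⟩
    simp only [snocPairEquiv_apply, zMonomial_snoc, ckSeries, coeffExtend_snoc, mul_smul,
      Fin.snoc_last]
    rfl
  rw [tsum_congr h2, ← h1.tsum_eq]
  have hs2 : Summable fun x : (ℕ × ℕ) × ((Fin m → ℕ) × (Fin m → ℕ)) =>
      if x.1.1 + x.1.2 = k then zMonomial x.2.1 x.2.2 (Fin.init z) •
        (w ^ x.1.1 * starRingEnd ℂ w ^ x.1.2) • ckPhi m x.1.1 x.1.2 X x.2.1 x.2.2 else 0 := by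
    refine (hs'.indicator {x | x.1.1 + x.1.2 = k}).congr fun x => ?_
    simp [Set.indicator_apply]
  rw [hs2.tsum_prod, tsum_eq_sum (s := Finset.HasAntidiagonal.antidiagonal k),
    ← Summable.tsum_finsetSum]
  · refine tsum_congr fun γ => ?_
    simp only [Finset.sum_apply, Pi.smul_apply, Finset.smul_sum]
    refine Finset.sum_congr rfl fun x hx => ?_
    rw [if_pos (Finset.HasAntidiagonal.mem_antidiagonal.1 hx)]
  · exact fun x _ => hs2.prod_factor x
  · intro x hx
    rw [Finset.HasAntidiagonal.mem_antidiagonal] at hx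
    simp [hx]

theorem hasSum_ckTerm {p : (Fin m → ℂ) → Cl (m + 1)} {X : ZCoeff m (Cl (m + 1))}
    (hp : HasZSum p X) (hX : Compatible X) (z : Fin (m + 1) → ℂ) :
    HasSum (fun k => ckTerm k p z) (zSum (ckSeries m X) z) :=
  (hasSum_fiberwise (hp.ckSeries.hasSum z)
    fun γ => γ.1 (Fin.last m) + γ.2 (Fin.last m)).congr_fun fun k => ckTerm_eq_tsum hp hX k z

/-- The indicator function of the bidegree `(a, b)`. -/
def bidegree (a b : ℕ) : ℕ → ℕ → ℂ := fun p q => if p = a ∧ q = b then 1 else 0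

theorem hasZSum_bihomPart {E : Type*} [NormedAddCommGroup E] [NormedSpace ℂ E] (C : ZCoeff k E)
    (a b : ℕ) : HasZSum (bihomPart C a b) (coeffWeight (bidegree a b) C) := by
  intro R z _
  rw [bihomPart, ← Finset.sum_product']
  have h : ∀ γ : (Fin k → ℕ) × (Fin k → ℕ),
      γ ∉ Finset.Nat.antidiagonalTuple k a ×ˢ Finset.Nat.antidiagonalTuple k b →
      zMonomial γ.1 γ.2 z • coeffWeight (bidegree a b) C γ.1 γ.2 = 0 := by
    intro γ hγ
    simp only [Finset.mem_product, Finset.Nat.mem_antidiagonalTuple] at hγ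
    simp [coeffWeight_apply, bidegree, hγ]
  have e := hasSum_sum_of_ne_finset_zero (L := SummationFilter.unconditional _) h
  convert e using 1
  refine Finset.sum_congr rfl fun γ hγ => ?_
  simp only [Finset.mem_product, Finset.Nat.mem_antidiagonalTuple] at hγ
  simp [coeffWeight_apply, bidegree, hγ]

/-- The series of G is grouped by degree in z, degree in z^c, and degree in z_n, z_n^c together. By
`ckSeries_weight` each group is a term T_k of one bihomogeneous part. -/
theorem hasSum_ckTerm_bidegree {G : (Fin (m + 1) → ℂ) → Cl (m + 1)} {X : ZCoeff m (Cl (m + 1))}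
    {R : ℝ} (hG : HasZSumOn G (ckSeries m X) R) (hX : Compatible X)
    {p : ℕ → ℕ → (Fin m → ℂ) → Cl (m + 1)}
    (hp : ∀ a b, HasZSum (p a b) (coeffWeight (bidegree a b) X)) {z : Fin (m + 1) → ℂ}
    (hz : ‖z‖ < R) :
    HasSum (fun d : ℕ × ℕ × ℕ => ckTerm d.2.2 (p d.1 d.2.1) z) (G z) := by
  refine (hasSum_fiberwise (hG z hz) fun γ => (∑ j, γ.1 j, ∑ j, γ.2 j,
    γ.1 (Fin.last m) + γ.2 (Fin.last m))).congr_fun ?_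
  rintro ⟨a, b, k⟩
  rw [ckTerm_eq_tsum (hp a b) (hX.weight _), ckSeries_weight]
  refine tsum_congr fun γ => ?_
  simp only [Prod.mk.injEq, coeffWeight_apply, bidegree]
  by_cases h1 : γ.1 (Fin.last m) + γ.2 (Fin.last m) = k
  · by_cases h2 : ∑ j, γ.1 j = a ∧ ∑ j, γ.2 j = b
    · simp [h1, h2]
    · simp [h1, h2]
  · simp [h1]

theorem ckPhi_eq_zero_of_A {X : ZCoeff m (Cl (m + 1))} (hA : coeffA m X = 0) {s t : ℕ}
    (h1 : s ≠ t) (h2 : t ≠ s + 1) : ckPhi m s t X = 0 := by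
  rw [ckPhi, ckCoeff, if_neg h1, if_neg h2]
  split_ifs
  · rw [LinearMap.smul_apply, Module.End.mul_apply, hA, map_zero, smul_zero]
  · rw [smul_zero, LinearMap.zero_apply]

theorem ckPhi_eq_zero_of_B {X : ZCoeff m (Cl (m + 1))} (hB : coeffB m X = 0) {s t : ℕ}
    (h1 : s ≠ t) (h2 : s ≠ t + 1) : ckPhi m s t X = 0 := by
  rw [ckPhi, ckCoeff, if_neg h1, if_neg h2]
  split_ifs
  · rw [LinearMap.smul_apply, Module.End.mul_apply, hB, map_zero, smul_zero]
  · rw [smul_zero, LinearMap.zero_apply]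

theorem ckTerm_eq_zero {p : (Fin m → ℂ) → Cl (m + 1)} {X : ZCoeff m (Cl (m + 1))} {a b : ℕ}
    (hp : HasZSum p (coeffWeight (bidegree a b) X)) (hX : Compatible X) {k : ℕ}
    (hk : ∀ s t, s + t = k → s ≤ a → t ≤ b → ckPhi m s t X = 0) (z : Fin (m + 1) → ℂ) :
    ckTerm k p z = 0 := by
  rw [ckTerm_eq_tsum hp (hX.weight _)]
  refine (tsum_congr fun γ => ?_).trans tsum_zero
  split_ifs with h
  · rw [ckSeries_weight, coeffWeight_apply, bidegree]
    split_ifs with h2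
    · have h3 := hk _ _ h
        ((Finset.single_le_sum (fun _ _ => Nat.zero_le _) (Finset.mem_univ _)).trans_eq h2.1)
        ((Finset.single_le_sum (fun _ _ => Nat.zero_le _) (Finset.mem_univ _)).trans_eq h2.2)
      rw [ckSeries, coeffExtend, h3]
      simp
    · simp
  · rfl

/-- With A X = 0 only t = s and t = s + 1 remain; since s ≤ a and t ≤ b, k = s + t is at most min(2a
+ 1, 2b). -/
theorem hasSum_ckExt0 {p : (Fin m → ℂ) → Cl (m + 1)} {X : ZCoeff m (Cl (m + 1))} {a b : ℕ}
    (hp : HasZSum p (coeffWeight (bidegree a b) X)) (hX : Compatible X) (hA : coeffA m X = 0)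
    (z : Fin (m + 1) → ℂ) : HasSum (fun k => ckTerm k p z) (ckExt0 a b p z) := by
  refine hasSum_sum_of_ne_finset_zero fun k hk => ckTerm_eq_zero hp hX (fun s t hst hs ht => ?_) z
  rw [Finset.mem_range] at hk
  refine ckPhi_eq_zero_of_A hA ?_ ?_ <;> omega

/-- With B X = 0 only s = t and s = t + 1 remain, so k is at most min(2a, 2b + 1). -/
theorem hasSum_ckExt1 {p : (Fin m → ℂ) → Cl (m + 1)} {X : ZCoeff m (Cl (m + 1))} {a b : ℕ}
    (hp : HasZSum (fun u => fd (Fin.last m) * p u) (coeffWeight (bidegree a b) X))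
    (hX : Compatible X) (hB : coeffB m X = 0) (z : Fin (m + 1) → ℂ) :
    HasSum (fun k => ckTerm k (fun u => fd (Fin.last m) * p u) z) (ckExt1 a b p z) := by
  refine hasSum_sum_of_ne_finset_zero fun k hk => ckTerm_eq_zero hp hX (fun s t hst hs ht => ?_) z
  rw [Finset.mem_range] at hk
  refine ckPhi_eq_zero_of_B hB ?_ ?_ <;> omega

theorem hasZSum_ckExt0 {p : (Fin m → ℂ) → Cl (m + 1)} {X : ZCoeff m (Cl (m + 1))} {a b : ℕ}
    (hp : HasZSum p (coeffWeight (bidegree a b) X)) (hX : Compatible X) (hA : coeffA m X = 0) :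
    HasZSum (ckExt0 a b p) (coeffWeight (bidegree a b) (ckSeries m X)) := by
  have h : ckExt0 a b p = zSum (ckSeries m (coeffWeight (bidegree a b) X)) :=
    funext fun z => (hasSum_ckExt0 hp hX hA z).unique (hasSum_ckTerm hp (hX.weight _) z)
  rw [h, ← ckSeries_weight]
  exact hp.ckSeries

theorem hasZSum_ckExt1 {p : (Fin m → ℂ) → Cl (m + 1)} {X : ZCoeff m (Cl (m + 1))} {a b : ℕ}
    (hp : HasZSum (fun u => fd (Fin.last m) * p u) (coeffWeight (bidegree a b) X))
    (hX : Compatible X) (hB : coeffB m X = 0) :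
    HasZSum (ckExt1 a b p) (coeffWeight (bidegree a b) (ckSeries m X)) := by
  have h : ckExt1 a b p = zSum (ckSeries m (coeffWeight (bidegree a b) X)) :=
    funext fun z => (hasSum_ckExt1 hp hX hB z).unique (hasSum_ckTerm hp (hX.weight _) z)
  rw [h, ← ckSeries_weight]
  exact hp.ckSeries

end Terms

/-! ### The polynomial extensions: initial data, values and uniqueness. -/

section Extension

variable {k n m : ℕ}

theorem incl_castSucc (u : Fin m → ℂ) (j : Fin m) : incl u j.castSucc = u j := by
  simp [incl]

theorem incl_last (u : Fin m → ℂ) : incl u (Fin.last m) = 0 := by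
  simp [incl]

theorem norm_incl (u : Fin m → ℂ) : ‖incl u‖ = ‖u‖ := by
  refine le_antisymm ((pi_norm_le_iff_of_nonneg (norm_nonneg u)).2 fun j => ?_)
    ((pi_norm_le_iff_of_nonneg (norm_nonneg _)).2 fun j => ?_)
  · refine Fin.lastCases ?_ (fun j => ?_) j
    · rw [incl_last, norm_zero]; exact norm_nonneg u
    · rw [incl_castSucc]; exact norm_le_pi_norm u j
  · rw [← incl_castSucc u j]; exact norm_le_pi_norm _ _

theorem HasZSumOn.restrict {E : Type*} [NormedAddCommGroup E] [NormedSpace ℂ E]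
    {G : (Fin (m + 1) → ℂ) → E} {φ : ℕ → ℕ → ZCoeff m E} {R : ℝ}
    (h : HasZSumOn G (coeffExtend φ) R) : HasZSumOn (fun u => G (incl u)) (φ 0 0) R := by
  intro u hu
  have h1 := h (incl u) (by rwa [norm_incl])
  have hinj : Function.Injective fun γ : (Fin m → ℕ) × (Fin m → ℕ) =>
      snocPairEquiv m ((0, 0), γ) :=
    (snocPairEquiv m).injective.comp fun _ _ h => (Prod.ext_iff.1 h).2
  refine ((hinj.hasSum_iff ?_).2 h1).congr_fun ?_
  · intro γ hγ
    obtain ⟨⟨⟨s, t⟩, ⟨α, β⟩⟩, rfl⟩ := (snocPairEquiv m).surjective γ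
    have hst : s ≠ 0 ∨ t ≠ 0 := by
      by_contra! hcon
      obtain ⟨rfl, rfl⟩ := hcon
      exact hγ ⟨(α, β), rfl⟩
    rw [snocPairEquiv_apply, zMonomial_snoc, incl_last]
    rcases hst with h0 | h0 <;> simp [h0]
  · rintro ⟨α, β⟩
    simp only [Function.comp_apply, snocPairEquiv_apply, zMonomial_snoc, coeffExtend_snoc, pow_zero,
      mul_one]
    simp [incl]

theorem coeffDz_last_iterate {E : Type*} [NormedAddCommGroup E] [NormedSpace ℂ E] (i : ℕ)
    (φ : ℕ → ℕ → ZCoeff m E) :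
    (coeffDz (Fin.last m))^[i] (coeffExtend φ) =
      coeffExtend fun s t => (((s + i).descFactorial i : ℕ) : ℂ) • φ (s + i) t := by
  induction i with
  | zero => simp
  | succ i ih =>
    rw [Function.iterate_succ_apply', ih, coeffDz_last_extend]
    congr 1
    funext s t
    rw [smul_smul, ← Nat.cast_mul, add_right_comm, add_assoc s i 1, ← add_assoc s i 1,
      Nat.descFactorial_succ, show s + i + 1 - i = s + 1 by omega]

theorem coeffDzc_last_iterate {E : Type*} [NormedAddCommGroup E] [NormedSpace ℂ E] (i : ℕ)
    (φ : ℕ → ℕ → ZCoeff m E) :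
    (coeffDzc (Fin.last m))^[i] (coeffExtend φ) =
      coeffExtend fun s t => (((t + i).descFactorial i : ℕ) : ℂ) • φ s (t + i) := by
  induction i with
  | zero => simp
  | succ i ih =>
    rw [Function.iterate_succ_apply', ih, coeffDzc_last_extend]
    congr 1
    funext s t
    rw [smul_smul, ← Nat.cast_mul, add_right_comm, add_assoc t i 1, ← add_assoc t i 1,
      Nat.descFactorial_succ, show t + i + 1 - i = t + 1 by omega]

theorem HasZSum.dz_iterate {E : Type*} [NormedAddCommGroup E] [NormedSpace ℂ E]
    [FiniteDimensional ℂ E] {G : (Fin k → ℂ) → E} {C : ZCoeff k E} (h : HasZSum G C) (j : Fin k)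
    (i : ℕ) : HasZSum ((dz j)^[i] G) ((coeffDz j)^[i] C) := by
  induction i with
  | zero => exact h
  | succ i ih =>
    rw [Function.iterate_succ_apply', Function.iterate_succ_apply']
    exact fun R => (ih R).dz j

theorem HasZSum.dzc_iterate {E : Type*} [NormedAddCommGroup E] [NormedSpace ℂ E]
    [FiniteDimensional ℂ E] {G : (Fin k → ℂ) → E} {C : ZCoeff k E} (h : HasZSum G C) (j : Fin k)
    (i : ℕ) : HasZSum ((dzc j)^[i] G) ((coeffDzc j)^[i] C) := by
  induction i with
  | zero => exact h
  | succ i ih =>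
    rw [Function.iterate_succ_apply', Function.iterate_succ_apply']
    exact fun R => (ih R).dzc j

theorem HasZSum.dz_iterate_incl {E : Type*} [NormedAddCommGroup E] [NormedSpace ℂ E]
    [FiniteDimensional ℂ E] {G : (Fin (m + 1) → ℂ) → E} {φ : ℕ → ℕ → ZCoeff m E}
    (h : HasZSum G (coeffExtend φ)) (i : ℕ) :
    HasZSum (fun u => (dz (Fin.last m))^[i] G (incl u)) ((i.factorial : ℂ) • φ i 0) := by
  intro R
  have h1 := h.dz_iterate (Fin.last m) i R
  rw [coeffDz_last_iterate] at h1
  simpa [Nat.descFactorial_self] using h1.restrict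

theorem HasZSum.dzc_iterate_incl {E : Type*} [NormedAddCommGroup E] [NormedSpace ℂ E]
    [FiniteDimensional ℂ E] {G : (Fin (m + 1) → ℂ) → E} {φ : ℕ → ℕ → ZCoeff m E}
    (h : HasZSum G (coeffExtend φ)) (i : ℕ) :
    HasZSum (fun u => (dzc (Fin.last m))^[i] G (incl u)) ((i.factorial : ℂ) • φ 0 i) := by
  intro R
  have h1 := h.dzc_iterate (Fin.last m) i R
  rw [coeffDzc_last_iterate] at h1
  simpa [Nat.descFactorial_self] using h1.restrict

theorem HasZSum.coeff_unique {E : Type*} [NormedAddCommGroup E] [NormedSpace ℂ E]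
    [FiniteDimensional ℂ E] {G : (Fin k → ℂ) → E} {C D : ZCoeff k E} (h : HasZSum G C)
    (h' : HasZSum G D) : C = D :=
  (h 1).coeff_unique one_pos (h' 1)

theorem HasZSumOn.hermiteanMonogenicOn {G : (Fin n → ℂ) → Cl n} {X : ZCoeff n (Cl n)} {R : ℝ}
    (h : HasZSumOn G X R) (h1 : coeffDirac fd X = 0) (h2 : coeffDiracc f X = 0) :
    HermiteanMonogenicOn G (Metric.ball 0 R) := by
  refine ⟨Metric.isOpen_ball, h.contDiffOn, fun z hz => ?_⟩
  have hz' := mem_ball_zero_iff.1 hz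
  have e1 := h.diracZ z hz'
  have e2 := h.diracZd z hz'
  rw [h1] at e1
  rw [h2] at e2
  exact ⟨e1.unique (by simp), e2.unique (by simp)⟩

theorem HasZSum.hermiteanMonogenicOn {G : (Fin n → ℂ) → Cl n} {X : ZCoeff n (Cl n)}
    (h : HasZSum G X) (h1 : coeffDirac fd X = 0) (h2 : coeffDiracc f X = 0) :
    HermiteanMonogenicOn G Set.univ := by
  refine ⟨isOpen_univ, contDiffOn_univ.2 (contDiff_iff_contDiffAt.2 fun z => ?_), fun z _ => ?_⟩
  · exact (h (‖z‖ + 1)).contDiffOn.contDiffAt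
      (Metric.isOpen_ball.mem_nhds (mem_ball_zero_iff.2 (lt_add_one _)))
  · exact ((h (‖z‖ + 1)).hermiteanMonogenicOn h1 h2).2.2 z (mem_ball_zero_iff.2 (lt_add_one _))

theorem HasZSum.coeff_of_hermiteanMonogenicOn {G : (Fin n → ℂ) → Cl n} {X : ZCoeff n (Cl n)}
    (h : HasZSum G X) (hG : HermiteanMonogenicOn G Set.univ) :
    coeffDirac fd X = 0 ∧ coeffDiracc f X = 0 :=
  ⟨(h 1).diracZ.coeff_eq_zero one_pos fun z _ => (hG.2.2 z (Set.mem_univ z)).1,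
    (h 1).diracZd.coeff_eq_zero one_pos fun z _ => (hG.2.2 z (Set.mem_univ z)).2⟩

/-- Null solutions are harmonic, so (s+1)(t+1) φ_{s+1,t+1} = -∑_{j<n} ∂_{z_j} ∂_{z_j^c} φ_{s,t}, and
induction on s starts from the pure coefficients. -/
theorem coeffExtend_eq_zero_of_monogenic {φ : ℕ → ℕ → ZCoeff m (Cl (m + 1))}
    (h1 : coeffDirac fd (coeffExtend φ) = 0) (h2 : coeffDiracc f (coeffExtend φ) = 0)
    (hs : ∀ s, φ s 0 = 0) (ht : ∀ t, φ 0 t = 0) (s t : ℕ) : φ s t = 0 := by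
  have hharm : ∑ j : Fin (m + 1), coeffDz j (coeffDzc j (coeffExtend φ)) = 0 := by
    have e := LinearMap.congr_fun (coeffDirac_mul_coeffDiracc_add (n := m + 1) fd f
      fun i j => (add_comm _ _).trans ((f_mul_fd_add_swap _ _).trans (by simp [eq_comm])))
      (coeffExtend φ)
    rw [LinearMap.add_apply, Module.End.mul_apply, Module.End.mul_apply, h1, h2, map_zero, map_zero,
      add_zero, LinearMap.sum_apply] at e
    exact e.symm
  rw [Fin.sum_univ_castSucc, coeffDzc_last_extend, coeffDz_last_extend] at hharm
  simp only [coeffDzc_castSucc_extend, coeffDz_castSucc_extend] at hharm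
  induction s generalizing t with
  | zero => exact ht t
  | succ s ih =>
    cases t with
    | zero => exact hs _
    | succ t =>
      ext α β
      have e := congrFun (congrFun hharm (Fin.snoc (α := fun _ => ℕ) α s))
        (Fin.snoc (α := fun _ => ℕ) β t)
      simp only [Pi.add_apply, Finset.sum_apply, coeffExtend_snoc, ih, map_zero, Pi.zero_apply,
        Finset.sum_const_zero, zero_add, Pi.smul_apply, smul_smul, ← Nat.cast_mul] at e
      exact (smul_eq_zero.1 e).resolve_left (Nat.cast_ne_zero.2 (by positivity))

theorem exists_eq_coeffExtend {E : Type*} (X : ZCoeff (m + 1) E) :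
    ∃ φ : ℕ → ℕ → ZCoeff m E, X = coeffExtend φ := by
  refine ⟨fun s t α β => X (Fin.snoc (α := fun _ => ℕ) α s) (Fin.snoc (α := fun _ => ℕ) β t), ?_⟩
  ext α β
  have h : ∀ α : Fin (m + 1) → ℕ, Fin.snoc (α := fun _ => ℕ) (fun j => α j.castSucc)
      (α (Fin.last m)) = α := fun α => Fin.snoc_init_self (α := fun _ => ℕ) α
  simp only [coeffExtend, h]

/-- A Hermitean monogenic polynomial of given bidegree is determined by its pure derivatives in
`z_n` and in `z_n^c` on the hyperplane `z_n = 0`. -/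
theorem IsHMPoly.ext_of_incl {r a b : ℕ} {M N : (Fin (m + 1) → ℂ) → Cl (m + 1)}
    (hM : IsHMPoly r a b M) (hN : IsHMPoly r a b N)
    (hz : ∀ i ≤ a, ∀ u, (dz (Fin.last m))^[i] M (incl u) = (dz (Fin.last m))^[i] N (incl u))
    (hzc : ∀ i ≤ b, ∀ u, (dzc (Fin.last m))^[i] M (incl u) = (dzc (Fin.last m))^[i] N (incl u)) :
    M = N := by
  obtain ⟨C, rfl⟩ := hM.bihom
  obtain ⟨D, rfl⟩ := hN.bihom
  have sC := hasZSum_bihomPart C a b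
  have sD := hasZSum_bihomPart D a b
  have mC := sC.coeff_of_hermiteanMonogenicOn hM.monogenic
  have mD := sD.coeff_of_hermiteanMonogenicOn hN.monogenic
  -- In bidegree (a, b) no exponent of z_n exceeds a and none of z_n^c exceeds b, so the finitely
  -- many prescribed derivatives give all pure coefficients.
  have hsupp : ∀ (C : ZCoeff (m + 1) (Cl (m + 1))) (φ : ℕ → ℕ → ZCoeff m (Cl (m + 1))),
      coeffWeight (bidegree a b) C = coeffExtend φ →
      (∀ i, a < i → φ i 0 = 0) ∧ ∀ i, b < i → φ 0 i = 0 := by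
    intro C φ h
    constructor
    · intro i hi
      ext α β
      rw [← coeffExtend_snoc φ α β i 0, ← h, coeffWeight_apply, bidegree, if_neg, zero_smul]
      · rfl
      · rw [Fin.sum_univ_castSucc, Fin.snoc_last]
        omega
    · intro i hi
      ext α β
      rw [← coeffExtend_snoc φ α β 0 i, ← h, coeffWeight_apply, bidegree, if_neg, zero_smul]
      · rfl
      · rw [Fin.sum_univ_castSucc (fun j => (Fin.snoc (α := fun _ => ℕ) β i : Fin (m + 1) → ℕ) j),
          Fin.snoc_last]
        omega
  obtain ⟨φ, hφ⟩ := exists_eq_coeffExtend (coeffWeight (bidegree a b) C)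
  obtain ⟨ψ, hψ⟩ := exists_eq_coeffExtend (coeffWeight (bidegree a b) D)
  obtain ⟨φz, φzc⟩ := hsupp C φ hφ
  obtain ⟨ψz, ψzc⟩ := hsupp D ψ hψ
  rw [hφ] at sC mC
  rw [hψ] at sD mD
  have hs : ∀ i, φ i 0 = ψ i 0 := by
    intro i
    rcases le_or_gt i a with hi | hi
    · have h1 := sC.dz_iterate_incl i
      rw [funext (hz i hi)] at h1
      exact smul_right_injective _ (Nat.cast_ne_zero.2 i.factorial_ne_zero)
        (h1.coeff_unique (sD.dz_iterate_incl i))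
    · rw [φz i hi, ψz i hi]
  have ht : ∀ i, φ 0 i = ψ 0 i := by
    intro i
    rcases le_or_gt i b with hi | hi
    · have h1 := sC.dzc_iterate_incl i
      rw [funext (hzc i hi)] at h1
      exact smul_right_injective _ (Nat.cast_ne_zero.2 i.factorial_ne_zero)
        (h1.coeff_unique (sD.dzc_iterate_incl i))
    · rw [φzc i hi, ψzc i hi]
  have hsub : coeffExtend φ - coeffExtend ψ = coeffExtend fun s t => φ s t - ψ s t := rfl
  have key := coeffExtend_eq_zero_of_monogenic (φ := fun s t => φ s t - ψ s t)
    (by rw [← hsub, map_sub, mC.1, mD.1, sub_zero]) (by rw [← hsub, map_sub, mC.2, mD.2, sub_zero])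
    (fun s => sub_eq_zero.2 (hs s)) (fun t => sub_eq_zero.2 (ht t))
  have hφψ : φ = ψ := funext fun s => funext fun t => sub_eq_zero.1 (key s t)
  rw [hφψ] at sC
  exact sC.unique sD

theorem coeffDirac_mem {c : Fin k → Cl n} {a : Cl n} {W : Submodule ℂ (Cl n)}
    (hW : ∀ j, ∀ x ∈ W, c j * (a * x) ∈ W) {X : ZCoeff k (Cl n)} (hX : ∀ α β, X α β ∈ W)
    (α β : Fin k → ℕ) : coeffDirac c (coeffMulLeft a X) α β ∈ W := by
  rw [coeffDirac_apply, Finset.sum_apply, Finset.sum_apply]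
  refine W.sum_mem fun j _ => ?_
  rw [coeffMulLeft_apply, coeffDz_apply, mul_smul_comm]
  exact W.smul_mem _ (hW j _ (hX _ _))

theorem coeffDiracc_mem {c : Fin k → Cl n} {a : Cl n} {W : Submodule ℂ (Cl n)}
    (hW : ∀ j, ∀ x ∈ W, c j * (a * x) ∈ W) {X : ZCoeff k (Cl n)} (hX : ∀ α β, X α β ∈ W)
    (α β : Fin k → ℕ) : coeffDiracc c (coeffMulLeft a X) α β ∈ W := by
  rw [coeffDiracc_apply, Finset.sum_apply, Finset.sum_apply]
  refine W.sum_mem fun j _ => ?_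
  rw [coeffMulLeft_apply, coeffDzc_apply, mul_smul_comm]
  exact W.smul_mem _ (hW j _ (hX _ _))

/-- L is a scalar operator, so it respects any subspace of values. -/
theorem coeffL_pow_mem {W : Submodule ℂ (Cl (m + 1))} {X : ZCoeff m (Cl (m + 1))}
    (hX : ∀ α β, X α β ∈ W) (s : ℕ) (α β : Fin m → ℕ) : (coeffL m ^ s) X α β ∈ W := by
  induction s generalizing α β with
  | zero => exact hX α β
  | succ s ih =>
    rw [pow_succ', Module.End.mul_apply, coeffL_eq, LinearMap.neg_apply, LinearMap.sum_apply]
    refine W.neg_mem ?_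
    rw [Finset.sum_apply, Finset.sum_apply]
    rw [← coeffL_eq]
    exact W.sum_mem fun j _ => W.smul_mem _ (W.smul_mem _ (ih _ _))

/-- A lowers the spinor degree by f_n and then raises it by f_j^†; B raises first and lowers
afterwards. Positivity of r makes room for the lowering in A. -/
theorem ckSeries_mem {r : ℕ} (hr : 0 < r) {X : ZCoeff m (Cl (m + 1))}
    (hX : ∀ α β, X α β ∈ spinorPart (m + 1) r) (α β : Fin (m + 1) → ℕ) :
    ckSeries m X α β ∈ spinorPart (m + 1) r := by
  obtain ⟨r, rfl⟩ := Nat.exists_eq_succ_of_ne_zero hr.ne'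
  have hA : ∀ α β, coeffA m X α β ∈ spinorPart (m + 1) (r + 1) := coeffDirac_mem
    (fun j x hx => fd_mul_mem_bladeSpace (Set.mem_univ _) (f_mul_mem_bladeSpace _ hx)) hX
  have hB : ∀ α β, coeffB m X α β ∈ spinorPart (m + 1) (r + 1) := coeffDiracc_mem
    (fun j x hx => f_mul_mem_bladeSpace _ (fd_mul_mem_bladeSpace (Set.mem_univ _) hx)) hX
  rw [ckSeries, coeffExtend, ckPhi, ckCoeff]
  refine Submodule.smul_mem _ _ ?_
  split_ifs
  · exact coeffL_pow_mem hX _ _ _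
  · exact coeffL_pow_mem hA _ _ _
  · exact coeffL_pow_mem hB _ _ _
  · exact Submodule.zero_mem _

theorem isHMPoly_of_hasZSum {r a b : ℕ} (hr : 0 < r) {M : (Fin (m + 1) → ℂ) → Cl (m + 1)}
    {X : ZCoeff m (Cl (m + 1))}
    (hM : HasZSum M (coeffWeight (bidegree a b) (ckSeries m X))) (hX : Compatible X)
    (hXr : ∀ α β, X α β ∈ spinorPart (m + 1) r) : IsHMPoly r a b M where
  bihom := ⟨ckSeries m X, hM.unique (hasZSum_bihomPart _ _ _)⟩
  values z := (hM (‖z‖ + 1)).mem _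
    (fun _ _ => Submodule.smul_mem _ _ (ckSeries_mem hr hXr _ _)) (lt_add_one _)
  monogenic := hM.hermiteanMonogenicOn
    (by rw [coeffDirac_weight, hX.coeffDirac_ckSeries, map_zero])
    (by rw [coeffDiracc_weight, hX.coeffDiracc_ckSeries, map_zero])

theorem ckPhi_zero_zero (X : ZCoeff m (Cl (m + 1))) : ckPhi m 0 0 X = X := by
  simp [ckPhi, ckCoeff]

theorem ckPhi_one_zero (X : ZCoeff m (Cl (m + 1))) : ckPhi m 1 0 X = coeffA m X := by
  simp [ckPhi, ckCoeff]

theorem ckPhi_zero_one (X : ZCoeff m (Cl (m + 1))) : ckPhi m 0 1 X = coeffB m X := by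
  simp [ckPhi, ckCoeff]

theorem ckPhi_zero_right (X : ZCoeff m (Cl (m + 1))) {i : ℕ} (hi : 2 ≤ i) : ckPhi m i 0 X = 0 := by
  simp [ckPhi, ckCoeff, show i ≠ 0 by omega, show i ≠ 1 by omega]

theorem ckPhi_zero_left (X : ZCoeff m (Cl (m + 1))) {i : ℕ} (hi : 2 ≤ i) : ckPhi m 0 i X = 0 := by
  simp [ckPhi, ckCoeff, show ¬ 0 = i by omega, show i ≠ 1 by omega]

/-- The pure derivatives on the hyperplane are i! φ_{i,0} and i! φ_{0,i}. Here φ_{1,0} = AC = 0 and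
φ_{0,1} = BC = -f_n^† δC, while pure coefficients of order at least 2 vanish. -/
theorem isCKExt0_ckExt0 {r a b : ℕ} (hr : 0 < r) {C : ZCoeff m (Cl (m + 1))}
    (hC : ∀ α β, C α β ∈ tildeSpinorPart m r) (hF : coeffF m C = 0) (hd : coeffTildeZ m C = 0) :
    IsCKExt0 r a b (bihomPart C a b) (ckExt0 a b (bihomPart C a b)) := by
  have hX := compatible_of_coeffF_eq_zero hF hd
  have hp := hasZSum_bihomPart C a b
  have hM := hasZSum_ckExt0 hp hX (coeffA_eq_zero hF)
  have hA : coeffA m (coeffWeight (bidegree a b) C) = 0 := by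
    rw [coeffA_weight, coeffA_eq_zero hF, map_zero]
  have hM' := hM
  rw [← ckSeries_weight, ckSeries] at hM'
  refine ⟨isHMPoly_of_hasZSum hr hM hX fun α β => bladeSpace_mono (Set.subset_univ _) r (hC α β),
    ?_, ?_, ?_, ?_⟩
  · have h := fun R => (hM' R).restrict
    rw [ckPhi_zero_zero] at h
    exact congrFun (HasZSum.unique h hp)
  · have h := hM'.dzc_iterate_incl 1
    rw [ckPhi_zero_one, coeffB_apply_eq] at h
    have h2 : HasZSum (fun u => -(fd (Fin.last m) * tildeDiracZd (bihomPart C a b) u))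
        (((Nat.factorial 1 : ℕ) : ℂ) •
          -coeffFd m (coeffTildeZd m (coeffWeight (bidegree a b) C))) := fun R => by
      have := ((hp R).tildeDiracZd.mulLeft (fd (Fin.last m))).const_smul (-1)
      simpa [coeffFd] using this
    exact congrFun (h.unique h2)
  · intro j hj _ u
    have h := hM'.dzc_iterate_incl j
    rw [ckPhi_zero_left _ hj, smul_zero] at h
    exact h.eq_zero u
  · intro i hi _ u
    have h := hM'.dz_iterate_incl i
    rw [ckPhi_eq_zero_of_A hA (by omega) (by omega), smul_zero] at h
    exact h.eq_zero u

/-- The roles are exchanged: B f_n^† C = 0, and A f_n^† C = dC because f_n f_n^† C = C. -/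
theorem isCKExt1_ckExt1 {r a b : ℕ} (hr : 0 < r) {C : ZCoeff m (Cl (m + 1))}
    (hC : ∀ α β, C α β ∈ tildeSpinorPart m (r - 1)) (hF : coeffF m C = 0)
    (hd : coeffTildeZd m C = 0) :
    IsCKExt1 r a b (bihomPart C a b) (ckExt1 a b (bihomPart C a b)) := by
  have hX := compatible_coeffFd hF hd
  have hp := hasZSum_bihomPart C a b
  have hp' : HasZSum (fun u => fd (Fin.last m) * bihomPart C a b u)
      (coeffWeight (bidegree a b) (coeffFd m C)) := by
    rw [coeffFd, ← coeffMulLeft_weight]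
    exact fun R => (hp R).mulLeft _
  have hM := hasZSum_ckExt1 hp' hX (coeffB_coeffFd C)
  have hB : coeffB m (coeffWeight (bidegree a b) (coeffFd m C)) = 0 := by
    rw [coeffB_weight, coeffB_coeffFd, map_zero]
  have hM' := hM
  rw [← ckSeries_weight, ckSeries] at hM'
  have hXr : ∀ α β, coeffFd m C α β ∈ spinorPart (m + 1) r := fun α β => by
    have := fd_mul_mem_bladeSpace (Set.mem_univ (Fin.last m))
      (bladeSpace_mono (Set.subset_univ _) _ (hC α β))
    rwa [Nat.sub_add_cancel hr] at this
  refine ⟨isHMPoly_of_hasZSum hr hM hX hXr, ?_, ?_, ?_, ?_⟩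
  · have h := fun R => (hM' R).restrict
    rw [ckPhi_zero_zero] at h
    exact congrFun (HasZSum.unique h hp')
  · intro j hj _ u
    have h := hM'.dzc_iterate_incl j
    rw [ckPhi_eq_zero_of_B hB (by omega) (by omega), smul_zero] at h
    exact h.eq_zero u
  · have h := hM'.dz_iterate_incl 1
    have hF' : coeffF m (coeffWeight (bidegree a b) C) = 0 := by
      rw [coeffF, coeffMulLeft_weight]
      exact (congrArg _ hF).trans (map_zero _)
    rw [ckPhi_one_zero, coeffFd, ← coeffMulLeft_weight, ← coeffFd, coeffA_coeffFd hF',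
      Nat.factorial_one, Nat.cast_one, one_smul] at h
    exact congrFun (h.unique fun R => (hp R).tildeDiracZ)
  · intro i hi _ u
    have h := hM'.dz_iterate_incl i
    rw [ckPhi_zero_right _ hi, smul_zero] at h
    exact h.eq_zero u

theorem IsCKExt0.unique {r a b : ℕ} {p : (Fin m → ℂ) → Cl (m + 1)}
    {M N : (Fin (m + 1) → ℂ) → Cl (m + 1)} (hM : IsCKExt0 r a b p M) (hN : IsCKExt0 r a b p N) :
    M = N := by
  refine hM.poly.ext_of_incl hN.poly (fun i hi u => ?_) fun i hi u => ?_
  · rcases Nat.eq_zero_or_pos i with rfl | h0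
    · exact (hM.restrict u).trans (hN.restrict u).symm
    · rw [hM.dz_ge i h0 hi u, hN.dz_ge i h0 hi u]
  · rcases Nat.eq_zero_or_pos i with rfl | h0
    · exact (hM.restrict u).trans (hN.restrict u).symm
    · rcases Nat.eq_or_lt_of_le (Nat.succ_le_of_lt h0) with rfl | h1
      · exact (hM.dzc_one u).trans (hN.dzc_one u).symm
      · rw [hM.dzc_ge i h1 hi u, hN.dzc_ge i h1 hi u]

theorem IsCKExt1.unique {r a b : ℕ} {p : (Fin m → ℂ) → Cl (m + 1)}
    {M N : (Fin (m + 1) → ℂ) → Cl (m + 1)} (hM : IsCKExt1 r a b p M) (hN : IsCKExt1 r a b p N) :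
    M = N := by
  refine hM.poly.ext_of_incl hN.poly (fun i hi u => ?_) fun i hi u => ?_
  · rcases Nat.eq_zero_or_pos i with rfl | h0
    · exact (hM.restrict u).trans (hN.restrict u).symm
    · rcases Nat.eq_or_lt_of_le (Nat.succ_le_of_lt h0) with rfl | h1
      · exact (hM.dz_one u).trans (hN.dz_one u).symm
      · rw [hM.dz_ge i h1 hi u, hN.dz_ge i h1 hi u]
  · rcases Nat.eq_zero_or_pos i with rfl | h0
    · exact (hM.restrict u).trans (hN.restrict u).symm
    · rw [hM.dzc_ge i h0 hi u, hN.dzc_ge i h0 hi u]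

end Extension

/-! ### Necessity of the compatibility conditions, and summation of the extensions. -/

section Main

variable {k n m : ℕ}

/-- The inclusion of `{z_n = 0}` as a continuous real-linear map. -/
def inclL (m : ℕ) : (Fin m → ℂ) →L[ℝ] (Fin (m + 1) → ℂ) :=
  ContinuousLinearMap.pi (Fin.snoc (α := fun _ => (Fin m → ℂ) →L[ℝ] ℂ)
    (fun j => ContinuousLinearMap.proj j) 0)

theorem inclL_apply (u : Fin m → ℂ) : inclL m u = incl u := by
  ext j
  refine Fin.lastCases ?_ (fun j => ?_) j <;> simp [inclL, incl]

theorem inclL_single (j : Fin m) (c : ℂ) : inclL m (Pi.single j c) = Pi.single j.castSucc c := by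
  rw [inclL_apply]
  ext i
  refine Fin.lastCases ?_ (fun i => ?_) i
  · rw [incl_last, Pi.single_eq_of_ne (Fin.castSucc_lt_last j).ne']
  · rw [incl_castSucc]
    rcases eq_or_ne i j with rfl | h
    · simp
    · rw [Pi.single_eq_of_ne h, Pi.single_eq_of_ne fun h' => h (Fin.castSucc_injective _ h')]

theorem fderiv_eq_of_incl {F : (Fin m → ℂ) → Cl n} {G : (Fin (m + 1) → ℂ) → Cl n} {u : Fin m → ℂ}
    (hG : DifferentiableAt ℝ G (incl u)) (h : ∀ᶠ v in 𝓝 u, G (incl v) = F v) :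
    HasFDerivAt F ((fderiv ℝ G (incl u)).comp (inclL m)) u := by
  have h1 : HasFDerivAt (fun v => G (inclL m v)) _ u :=
    HasFDerivAt.comp u (by rw [inclL_apply]; exact hG.hasFDerivAt) (inclL m).hasFDerivAt
  refine h1.congr_of_eventuallyEq ?_
  filter_upwards [h] with v hv
  rw [inclL_apply, hv]

theorem dz_eq_of_incl {F : (Fin m → ℂ) → Cl n} {G : (Fin (m + 1) → ℂ) → Cl n} {u : Fin m → ℂ}
    (hG : DifferentiableAt ℝ G (incl u)) (h : ∀ᶠ v in 𝓝 u, G (incl v) = F v) (j : Fin m) :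
    dz j F u = dz j.castSucc G (incl u) := by
  rw [dz, dz, (fderiv_eq_of_incl hG h).fderiv, ContinuousLinearMap.comp_apply,
    ContinuousLinearMap.comp_apply, inclL_single, inclL_single]

theorem dzc_eq_of_incl {F : (Fin m → ℂ) → Cl n} {G : (Fin (m + 1) → ℂ) → Cl n} {u : Fin m → ℂ}
    (hG : DifferentiableAt ℝ G (incl u)) (h : ∀ᶠ v in 𝓝 u, G (incl v) = F v) (j : Fin m) :
    dzc j F u = dzc j.castSucc G (incl u) := by
  rw [dzc, dzc, (fderiv_eq_of_incl hG h).fderiv, ContinuousLinearMap.comp_apply,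
    ContinuousLinearMap.comp_apply, inclL_single, inclL_single]

theorem hasFDerivAt_mulLeft {F : (Fin k → ℂ) → Cl n} {u : Fin k → ℂ}
    (hF : DifferentiableAt ℝ F u) (a : Cl n) :
    HasFDerivAt (fun v => a * F v) (((mulLeftL a).restrictScalars ℝ).comp (fderiv ℝ F u)) u :=
  ((mulLeftL a).restrictScalars ℝ).hasFDerivAt.comp u hF.hasFDerivAt

theorem dz_mulLeft {F H : (Fin k → ℂ) → Cl n} {u : Fin k → ℂ} (hF : DifferentiableAt ℝ F u)
    {a : Cl n} (h : ∀ᶠ v in 𝓝 u, H v = a * F v) (j : Fin k) : dz j H u = a * dz j F u := by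
  have h' : H =ᶠ[𝓝 u] fun v => a * F v := h
  rw [dz, dz, h'.fderiv_eq, (hasFDerivAt_mulLeft hF a).fderiv, mul_smul_comm, mul_sub,
    mul_smul_comm]
  rfl

theorem dzc_mulLeft {F H : (Fin k → ℂ) → Cl n} {u : Fin k → ℂ} (hF : DifferentiableAt ℝ F u)
    {a : Cl n} (h : ∀ᶠ v in 𝓝 u, H v = a * F v) (j : Fin k) : dzc j H u = a * dzc j F u := by
  have h' : H =ᶠ[𝓝 u] fun v => a * F v := h
  rw [dzc, dzc, h'.fderiv_eq, (hasFDerivAt_mulLeft hF a).fderiv, mul_smul_comm, mul_add,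
    mul_smul_comm]
  rfl

/-- The element f_n f_n^† fixes spinors free of f_n^† and kills multiples of f_n^†. The components
of F thus arise from F by constant left multiplications and inherit its analyticity. -/
theorem tildeSpinorPart_decomp_left {r : ℕ} {x y z : Cl (m + 1)} (hy : y ∈ tildeSpinorPart m r)
    (h : x = y + fd (Fin.last m) * z) : y = f (Fin.last m) * fd (Fin.last m) * x := by
  rw [h, mul_add, ← mul_assoc (f (Fin.last m) * _) (fd _), mul_assoc (f _) (fd _) (fd _),
    fd_mul_self, mul_zero, zero_mul, add_zero, f_mul_fd_self, sub_mul, one_mul, mul_assoc, f_last_mul_of_mem hy, mul_zero, sub_zero]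

theorem tildeSpinorPart_decomp_right {r s : ℕ} {x y z : Cl (m + 1)} (hy : y ∈ tildeSpinorPart m r)
    (hz : z ∈ tildeSpinorPart m s) (h : x = y + fd (Fin.last m) * z) : z = f (Fin.last m) * x := by
  rw [h, mul_add, f_last_mul_of_mem hy, zero_add, ← mul_assoc, f_mul_fd_self, sub_mul, one_mul,
    mul_assoc, f_last_mul_of_mem hz, mul_zero, sub_zero]

/-- The product f_n f_n^† commutes with every f_j^†, j < n, so ∂̃_z F^0 = f_n (f_n^† ∂̃_z F), and
f_n^† does not distinguish ∂̃_z F from ∂_z G on the hyperplane. The second identity uses f_n in the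
same way. -/
theorem tildeDirac_eq_zero_of_extension {F F0 F1 : (Fin m → ℂ) → Cl (m + 1)}
    {G : (Fin (m + 1) → ℂ) → Cl (m + 1)} {u : Fin m → ℂ}
    (hG : DifferentiableAt ℝ G (incl u)) (h1 : diracZ G (incl u) = 0) (h2 : diracZd G (incl u) = 0)
    (h : ∀ᶠ v in 𝓝 u, G (incl v) = F v)
    (h3 : ∀ᶠ v in 𝓝 u, F0 v = f (Fin.last m) * fd (Fin.last m) * F v)
    (h4 : ∀ᶠ v in 𝓝 u, F1 v = f (Fin.last m) * F v) :
    tildeDiracZ F0 u = 0 ∧ tildeDiracZd F1 u = 0 := by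
  have hF : DifferentiableAt ℝ F u := (fderiv_eq_of_incl hG h).differentiableAt
  constructor
  · have e1 : tildeDiracZ F0 u = f (Fin.last m) * (fd (Fin.last m) * tildeDiracZ F u) := by
      simp only [tildeDiracZ, dz_mulLeft hF h3, Finset.mul_sum]
      refine Finset.sum_congr rfl fun j _ => ?_
      rw [← mul_assoc, ← mul_assoc, ← mul_assoc, ← mul_assoc]
      congr 1
      rw [mul_assoc (f _) (fd _), fd_mul_fd (Fin.last m), mul_neg, ← mul_assoc,
        f_mul_fd_of_ne (Fin.castSucc_lt_last j).ne', neg_mul, neg_neg]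
    have e2 : fd (Fin.last m) * tildeDiracZ F u = fd (Fin.last m) * diracZ G (incl u) := by
      simp only [tildeDiracZ, diracZ, dz_eq_of_incl hG h]
      rw [Fin.sum_univ_castSucc, mul_add, ← mul_assoc (fd (Fin.last m)) (fd (Fin.last m)),
        fd_mul_self, zero_mul, add_zero]
    rw [e1, e2, h1, mul_zero, mul_zero]
  · have e1 : tildeDiracZd F1 u = -(f (Fin.last m) * tildeDiracZd F u) := by
      simp only [tildeDiracZd, dzc_mulLeft hF h4, Finset.mul_sum, ← Finset.sum_neg_distrib]
      refine Finset.sum_congr rfl fun j _ => ?_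
      rw [← mul_assoc, ← mul_assoc, f_mul_f, neg_mul]
    have e2 : f (Fin.last m) * tildeDiracZd F u = f (Fin.last m) * diracZd G (incl u) := by
      simp only [tildeDiracZd, diracZd, dzc_eq_of_incl hG h]
      rw [Fin.sum_univ_castSucc, mul_add, ← mul_assoc (f (Fin.last m)) (f (Fin.last m)),
        f_mul_self, zero_mul, add_zero]
    rw [e1, e2, h2, mul_zero, neg_zero]

theorem ckSeries_add (X Y : ZCoeff m (Cl (m + 1))) :
    ckSeries m (X + Y) = ckSeries m X + ckSeries m Y := by
  ext α β
  simp only [ckSeries, coeffExtend, map_add, Pi.add_apply]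

theorem hasZSum_add_mulLeft_bihomPart (C D : ZCoeff m (Cl (m + 1))) (a b : ℕ) :
    HasZSum (fun u => bihomPart C a b u + fd (Fin.last m) * bihomPart D a b u)
      (coeffWeight (bidegree a b) (C + coeffFd m D)) := by
  rw [map_add, coeffFd, ← coeffMulLeft_weight]
  exact fun R => (hasZSum_bihomPart C a b R).add ((hasZSum_bihomPart D a b R).mulLeft _)

theorem hasSum_ckTerm_add {C D : ZCoeff m (Cl (m + 1))} (hC : Compatible C)
    (hD : Compatible (coeffFd m D)) (hA : coeffA m C = 0) (a b : ℕ) (z : Fin (m + 1) → ℂ) :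
    HasSum (fun k => ckTerm k
        (fun u => bihomPart C a b u + fd (Fin.last m) * bihomPart D a b u) z)
      (ckExt0 a b (bihomPart C a b) z + ckExt1 a b (bihomPart D a b) z) := by
  have hp := hasZSum_add_mulLeft_bihomPart C D a b
  have hp' : HasZSum (fun u => fd (Fin.last m) * bihomPart D a b u)
      (coeffWeight (bidegree a b) (coeffFd m D)) := by
    rw [coeffFd, ← coeffMulLeft_weight]
    exact fun R => (hasZSum_bihomPart D a b R).mulLeft _
  have h0 := hasZSum_ckExt0 (hasZSum_bihomPart C a b) hC hA
  have h1 := hasZSum_ckExt1 hp' hD (coeffB_coeffFd D)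
  have h2 : HasZSum (fun z => ckExt0 a b (bihomPart C a b) z + ckExt1 a b (bihomPart D a b) z)
      (ckSeries m (coeffWeight (bidegree a b) (C + coeffFd m D))) := by
    rw [ckSeries_weight, ckSeries_add, map_add]
    exact fun R => (h0 R).add (h1 R)
  have h3 := hasSum_ckTerm hp ((hC.add hD).weight _) z
  rwa [hp.ckSeries.unique h2] at h3

end Main

end

end HermClifford

/-! ### The theorem. -/

open HermClifford in
theorem mainTheorem7 (m r : ℕ) (hr : 0 < r) (hrm : r < m + 1)
    (F F0 F1 : (Fin m → ℂ) → Cl (m + 1))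
    (hF : AnalyticAt ℝ F 0)
    (hFval : ∀ᶠ u in 𝓝 (0 : Fin m → ℂ), F u ∈ spinorPart (m + 1) r)
    (hF0 : ∀ᶠ u in 𝓝 (0 : Fin m → ℂ), F0 u ∈ tildeSpinorPart m r)
    (hF1 : ∀ᶠ u in 𝓝 (0 : Fin m → ℂ), F1 u ∈ tildeSpinorPart m (r - 1))
    (hdec : ∀ᶠ u in 𝓝 (0 : Fin m → ℂ), F u = F0 u + fd (Fin.last m) * F1 u) :
    -- necessity of the compatibility conditions
    ((∃ (Ω : Set (Fin (m + 1) → ℂ)) (G : (Fin (m + 1) → ℂ) → Cl (m + 1)),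
        0 ∈ Ω ∧ HermiteanMonogenicOn G Ω ∧ ∀ u, incl u ∈ Ω → G (incl u) = F u) →
      ∀ᶠ u in 𝓝 (0 : Fin m → ℂ), tildeDiracZ F0 u = 0 ∧ tildeDiracZd F1 u = 0) ∧
    -- sufficiency, by summation of the polynomial CK-extensions
    ((∀ᶠ u in 𝓝 (0 : Fin m → ℂ), tildeDiracZ F0 u = 0 ∧ tildeDiracZd F1 u = 0) →
      (∃ C0 C1, HasZSeries F0 C0 ∧ HasZSeries F1 C1) ∧
      ∀ C0 C1, HasZSeries F0 C0 → HasZSeries F1 C1 →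
        (∀ α β, C0 α β ∈ tildeSpinorPart m r ∧ C1 α β ∈ tildeSpinorPart m (r - 1)) ∧
        (∀ a b,
          (∀ u, tildeDiracZ (bihomPart C0 a b) u = 0) ∧
          (∀ u, tildeDiracZd (bihomPart C1 a b) u = 0) ∧
          IsCKExt0 r a b (bihomPart C0 a b) (ckExt0 a b (bihomPart C0 a b)) ∧
          (∀ M, IsCKExt0 r a b (bihomPart C0 a b) M → M = ckExt0 a b (bihomPart C0 a b)) ∧
          IsCKExt1 r a b (bihomPart C1 a b) (ckExt1 a b (bihomPart C1 a b)) ∧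
          (∀ M, IsCKExt1 r a b (bihomPart C1 a b) M → M = ckExt1 a b (bihomPart C1 a b))) ∧
        ∃ (Ω : Set (Fin (m + 1) → ℂ)) (G : (Fin (m + 1) → ℂ) → Cl (m + 1)),
          0 ∈ Ω ∧ HermiteanMonogenicOn G Ω ∧
          (∀ z ∈ Ω, G z ∈ spinorPart (m + 1) r) ∧
          (∀ z ∈ Ω, HasSum
            (fun d : ℕ × ℕ =>
              ckExt0 d.1 d.2 (bihomPart C0 d.1 d.2) z + ckExt1 d.1 d.2 (bihomPart C1 d.1 d.2) z)
            (G z)) ∧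
          (∀ z ∈ Ω, HasSum
            (fun d : ℕ × ℕ × ℕ =>
              ckTerm d.2.2 (fun u => bihomPart C0 d.1 d.2.1 u +
                fd (Fin.last m) * bihomPart C1 d.1 d.2.1 u) z)
            (G z)) ∧
          ∀ u, incl u ∈ Ω → G (incl u) = F u) := by
  have hm : ∀ {u : Fin m → ℂ}, F0 u ∈ tildeSpinorPart m r → F1 u ∈ tildeSpinorPart m (r - 1) →
      F u = F0 u + fd (Fin.last m) * F1 u →
      F0 u = f (Fin.last m) * fd (Fin.last m) * F u ∧ F1 u = f (Fin.last m) * F u :=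
    fun h0 h1 h => ⟨tildeSpinorPart_decomp_left h0 h, tildeSpinorPart_decomp_right h0 h1 h⟩
  refine ⟨?_, fun hcomp => ⟨?_, ?_⟩⟩
  · rintro ⟨Ω, G, h0, ⟨hΩ, hG1, hG2⟩, hGF⟩
    have hΩ' : ∀ᶠ u in 𝓝 (0 : Fin m → ℂ), incl u ∈ Ω := by
      have h1 : Tendsto (inclL m) (𝓝 0) (𝓝 0) := by
        simpa using (inclL m).continuous.tendsto 0
      filter_upwards [h1 (hΩ.mem_nhds h0)] with u hu
      rwa [Set.mem_preimage, inclL_apply] at hu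
    -- The identities are differentiated at u, so they are needed on a neighbourhood of each u near
    -- the origin.
    filter_upwards [eventually_eventually_nhds.2 hΩ', eventually_eventually_nhds.2 hF0,
      eventually_eventually_nhds.2 hF1, eventually_eventually_nhds.2 hdec] with u h1 h2 h3 h4
    have hu : incl u ∈ Ω := h1.self_of_nhds
    refine tildeDirac_eq_zero_of_extension
      ((hG1.contDiffAt (hΩ.mem_nhds hu)).differentiableAt one_ne_zero) (hG2 _ hu).1 (hG2 _ hu).2
      (h1.mono fun v hv => hGF v hv) ?_ ?_
    · filter_upwards [h2, h3, h4] with v e2 e3 e4 using (hm e2 e3 e4).1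
    · filter_upwards [h2, h3, h4] with v e2 e3 e4 using (hm e2 e3 e4).2
  · obtain ⟨C, hC⟩ := hF.exists_hasZSeries
    refine ⟨coeffMulLeft (f (Fin.last m) * fd (Fin.last m)) C, coeffMulLeft (f (Fin.last m)) C,
      ?_, ?_⟩
    · filter_upwards [hC.mulLeft (f (Fin.last m) * fd (Fin.last m)), hF0, hF1, hdec]
        with u h1 h2 h3 h4
      rwa [(hm h2 h3 h4).1]
    · filter_upwards [hC.mulLeft (f (Fin.last m)), hF0, hF1, hdec] with u h1 h2 h3 h4
      rwa [(hm h2 h3 h4).2]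
  · intro C0 C1 hC0 hC1
    obtain ⟨R, hR, hball⟩ := Metric.eventually_nhds_iff.1
      (hC0.and (hC1.and (hF0.and (hF1.and (hdec.and hcomp)))))
    simp only [dist_zero_right] at hball
    have hS0 : HasZSumOn F0 C0 R := fun u hu => (hball hu).1
    have hS1 : HasZSumOn F1 C1 R := fun u hu => (hball hu).2.1
    have hm0 := hS0.coeff_mem hR (tildeSpinorPart m r) fun u hu => (hball hu).2.2.1
    have hm1 := hS1.coeff_mem hR (tildeSpinorPart m (r - 1)) fun u hu => (hball hu).2.2.2.1
    have hf0 : coeffF m C0 = 0 := by ext α β; exact f_last_mul_of_mem (hm0 α β)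
    have hf1 : coeffF m C1 = 0 := by ext α β; exact f_last_mul_of_mem (hm1 α β)
    have hd0 : coeffTildeZ m C0 = 0 :=
      hS0.tildeDiracZ.coeff_eq_zero hR fun u hu => (hball hu).2.2.2.2.2.1
    have hd1 : coeffTildeZd m C1 = 0 :=
      hS1.tildeDiracZd.coeff_eq_zero hR fun u hu => (hball hu).2.2.2.2.2.2
    have hc0 : Compatible C0 := compatible_of_coeffF_eq_zero hf0 hd0
    have hc1 : Compatible (coeffFd m C1) := compatible_coeffFd hf1 hd1
    refine ⟨fun α β => ⟨hm0 α β, hm1 α β⟩, fun a b => ⟨fun u => ?_, fun u => ?_, ?_⟩, ?_⟩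
    · have h : HasZSum (tildeDiracZ (bihomPart C0 a b)) 0 := fun R => by
        have := (hasZSum_bihomPart C0 a b R).tildeDiracZ
        rwa [coeffTildeZ, coeffDirac_weight, ← coeffTildeZ, hd0, map_zero] at this
      exact h.eq_zero u
    · have h : HasZSum (tildeDiracZd (bihomPart C1 a b)) 0 := fun R => by
        have := (hasZSum_bihomPart C1 a b R).tildeDiracZd
        rwa [coeffTildeZd, coeffDiracc_weight, ← coeffTildeZd, hd1, map_zero] at this
      exact h.eq_zero u
    · have e0 := isCKExt0_ckExt0 (a := a) (b := b) hr hm0 hf0 hd0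
      have e1 := isCKExt1_ckExt1 (a := a) (b := b) hr hm1 hf1 hd1
      exact ⟨e0, fun M hM => hM.unique e0, e1, fun M hM => hM.unique e1⟩
    · obtain ⟨θ, hθ1, hθ⟩ := exists_hasZSumOn_ckSeries m
      have hθ0 : 0 < θ := one_pos.trans_le hθ1
      have hX : Compatible (C0 + coeffFd m C1) := hc0.add hc1
      have hSF : HasZSumOn F (C0 + coeffFd m C1) R :=
        (hS0.add (hS1.mulLeft _)).congr fun u hu => (hball hu).2.2.2.2.1
      -- The extension of a series convergent for ‖u‖ < R is controlled on the ball of radius R/θ.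
      have hG := hθ (R / θ) F (C0 + coeffFd m C1) (by rwa [mul_div_cancel₀ _ hθ0.ne'])
      have hXr : ∀ α β, (C0 + coeffFd m C1) α β ∈ spinorPart (m + 1) r := fun α β => by
        refine Submodule.add_mem _ (bladeSpace_mono (Set.subset_univ _) r (hm0 α β)) ?_
        have := fd_mul_mem_bladeSpace (Set.mem_univ (Fin.last m))
          (bladeSpace_mono (Set.subset_univ _) _ (hm1 α β))
        rwa [Nat.sub_add_cancel hr] at this
      have htriple : ∀ z ∈ Metric.ball (0 : Fin (m + 1) → ℂ) (R / θ), HasSum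
          (fun d : ℕ × ℕ × ℕ => ckTerm d.2.2 (fun u => bihomPart C0 d.1 d.2.1 u +
            fd (Fin.last m) * bihomPart C1 d.1 d.2.1 u) z)
          (zSum (ckSeries m (C0 + coeffFd m C1)) z) := fun z hz =>
        hasSum_ckTerm_bidegree hG hX (hasZSum_add_mulLeft_bihomPart C0 C1)
          (mem_ball_zero_iff.1 hz)
      refine ⟨Metric.ball 0 (R / θ), zSum (ckSeries m (C0 + coeffFd m C1)),
        Metric.mem_ball_self (div_pos hR hθ0),
        hG.hermiteanMonogenicOn hX.coeffDirac_ckSeries hX.coeffDiracc_ckSeries,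
        fun z hz => hG.mem _ (ckSeries_mem hr hXr) (mem_ball_zero_iff.1 hz), fun z hz => ?_,
        htriple, fun u hu => ?_⟩
      -- Summing the triple series over k first yields the two polynomial extensions of bidegree (a,
      -- b).
      · exact ((Equiv.prodAssoc ℕ ℕ ℕ).hasSum_iff.2 (htriple z hz)).prod_fiberwise fun d =>
          hasSum_ckTerm_add hc0 hc1 (coeffA_eq_zero hf0) d.1 d.2 z
      · have hu' : ‖u‖ < R / θ := by rwa [mem_ball_zero_iff, norm_incl] at hu
        have h1 := hG.restrict u hu'
        rw [ckPhi_zero_zero] at h1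
        exact h1.unique (hSF u (hu'.trans_le (div_le_self hR.le hθ1)))
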